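/- Let $d\in\mathbb N$, $m>0$, let $\hbar_n>0$ with $\hbar_n\to 0$, and let $\psi_{\hbar_n}\in C^1(\mathbb R^d,\mathbb C\setminus\{0\})$ satisfy $\|\psi_{\hbar_n}\|_{L^2(\mathbb R^d)}=1$. Let $$w_{\hbar_n}(x,v):=\frac1{(2\pi)^d}\int_{\mathbb R^d}e^{-iv\cdot y}\,\psi_{\hbar_n}\big(x+\tfrac{\hbar_n}2y\big)\,\overline{\psi_{\hbar_n}\big(x-\tfrac{\hbar_n}2y\big)}\,dy$$ be the Wigner function of the pure state $|\psi_{\hbar_n}\rangle\langle\psi_{\hbar_n}|$, and assume that $w_{\hbar_n}\to w$ in $\mathcal S'(\mathbb R^d\times\mathbb R^d)$. Velocity moments are understood in the sense of distributions in $x$: for $T\in\mathcal S'(\mathbb R^d\times\mathbb R^d)$, a polynomial $p$ and $f\in L^1_{loc}(\mathbb R^d)$, $\int p(v)\,T\,dv=f$ means that $$\lim_{k\to\infty}\langle T,\varphi(x)p(v)\chi(v/k)\rangle=\int f\varphi\,dx$$ for all $\varphi,\chi\in C^\infty_c(\mathbb R^d)$ with $\chi=1$ near $0$. Assume that the densities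 $\rho_{\hbar_n}=\int w_{\hbar_n}dv$ (a continuous, in fact $C^1$, function), the currents $J_{\hbar_n}=\frac1m\int v\,w_{\hbar_n}dv$, the kinetic energy densities $\mathcal E_{\hbar_n}=\frac1{2m}\int|v|^2w_{\hbar_n}dv$, and the moments $\rho=\int w\,dv$, $J=\frac1m\int v\,w\,dv$, $\mathcal E=\frac1{2m}\int|v|^2w\,dv$ are functions such that, as $n\to\infty$, - $\hbar_n\|\nabla\rho_{\hbar_n}\|_{L^2(B(0,R))}\to0$ for all $R>0$; - $\mathcal E_{\hbar_n}\to\mathcal E$ weakly in $L^2(\mathbb R^d)$; - $\rho_{\hbar_n}\to\rho$ and $J_{\hbar_n}\to J$ strongly in $L^2_{loc}(\mathbb R^d)$. Set $u(x):=J(x)/\rho(x)$ if $\rho(x)>0$ and $u(x):=0$ otherwise. Then $\rho\ge0$ almost everywhere, and $w$ is the monokinetic, positive Borel measure on $\mathbb R^d_x\times\mathbb R^d_v$ $$w=\rho(x)\,\delta(v-m\,u(x)),$$ that is, the image of the measure $\rho(x)\,dx$ under the map $x\mapsto(x,m\,u(x))$. In particular $w=\rho(x)\,\delta(v-u(x))$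 when $m=1$. -/

import Mathlib

open MeasureTheory Filter Topology
open scoped ENNReal ContDiff SchwartzMap ComplexConjugate

noncomputable section

namespace Semiclassical

/-- The space `ℝ^d` with its Euclidean norm and Lebesgue measure. -/
abbrev Space (d : ℕ) : Type := EuclideanSpace ℝ (Fin d)

/-- The density matrix `R(X, Y) = ψ(X) * conj ψ(Y)` of the pure state `|ψ⟩⟨ψ|`. -/
def densityMatrix {d : ℕ} (ψ : Space d → ℂ) (X Y : Space d) : ℂ :=
  ψ X * conj (ψ Y)

/-- The Wigner function of the pure state `|ψ⟩⟨ψ|`: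
`w(x, v) = (2π)^(-d) ∫ exp(-i v·y) R(x + ℏy/2, x - ℏy/2) dy`.
For `ψ` in `L²` and `ℏ > 0` the integrand is integrable for every `(x, v)`. -/
def wigner {d : ℕ} (hbar : ℝ) (ψ : Space d → ℂ) (z : Space d × Space d) : ℂ :=
  (((2 * Real.pi) ^ d : ℝ) : ℂ)⁻¹ *
    ∫ y : Space d, Complex.exp (-(Complex.I * ((inner ℝ z.2 y : ℝ) : ℂ))) *
      densityMatrix ψ (z.1 + (hbar / 2) • y) (z.1 - (hbar / 2) • y)

/-- The Wigner function acting on Schwartz functions of `(x, v)` by integration. For `ψ` in `L²`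
the Wigner function is bounded, so the integrand is integrable. -/
def wignerAction {d : ℕ} (hbar : ℝ) (ψ : Space d → ℂ) (Φ : 𝓢(Space d × Space d, ℂ)) : ℂ :=
  ∫ z : Space d × Space d, wigner hbar ψ z * Φ z

/-- The test function `(x, v) ↦ φ(x) p(v) χ(v / (n + 1))` on phase space. -/
def cutoffTest {d : ℕ} {p φ χ : Space d → ℝ} (hp : ContDiff ℝ ∞ p)
    (hφ : ContDiff ℝ ∞ φ) (hφc : HasCompactSupport φ)
    (hχ : ContDiff ℝ ∞ χ) (hχc : HasCompactSupport χ) (n : ℕ) :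
    𝓢(Space d × Space d, ℂ) :=
  HasCompactSupport.toSchwartzMap
    (f := fun z : Space d × Space d =>
      ((φ z.1 * p z.2 * χ (((n : ℝ) + 1)⁻¹ • z.2) : ℝ) : ℂ))
    (by
      have hn : ((n : ℝ) + 1)⁻¹ ≠ 0 := by positivity
      have hχn : HasCompactSupport fun v : Space d => χ (((n : ℝ) + 1)⁻¹ • v) :=
        hχc.comp_homeomorph (Homeomorph.smulOfNeZero _ hn)
      refine HasCompactSupport.intro (hφc.isCompact.prod hχn.isCompact) ?_
      intro z hz
      rw [Set.mem_prod, not_and_or] at hz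
      rcases hz with h | h
      · simp [image_eq_zero_of_notMem_tsupport h]
      · have h0 : χ (((n : ℝ) + 1)⁻¹ • z.2) = 0 :=
          image_eq_zero_of_notMem_tsupport (f := fun v : Space d => χ (((n : ℝ) + 1)⁻¹ • v)) h
        simp [h0])
    (by
      refine Complex.ofRealCLM.contDiff.comp ?_
      refine ((hφ.comp contDiff_fst).mul (hp.comp contDiff_snd)).mul ?_
      exact hχ.comp (contDiff_snd.const_smul _))

/-- `∫ p(v) T(·, dv) = f` for a (tempered) distribution `T` on phase space: the locally integrable
function `f` is the limit, in the sense of distributions in `x`, of the moments of `T` with weight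
`p(v) χ(v / n)`, for every smooth compactly supported cutoff `χ` that equals `1` near `0`.
When `T` is a positive Borel measure and `p ≥ 0`, this says that `f(x) dx` is the image under
`(x, v) ↦ x` of the measure `p T`. When `T` is a Wigner function, it gives a meaning to the moments,
whose integrals in `v` need not converge absolutely. -/
def HasVelocityMoment {d : ℕ} (T : 𝓢(Space d × Space d, ℂ) → ℂ) (p f : Space d → ℝ) : Prop :=
  LocallyIntegrable f volume ∧
  ∃ hp : ContDiff ℝ ∞ p,
    ∀ (φ χ : Space d → ℝ) (hφ : ContDiff ℝ ∞ φ) (hφc : HasCompactSupport φ)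
      (hχ : ContDiff ℝ ∞ χ) (hχc : HasCompactSupport χ), (∀ᶠ v in 𝓝 0, χ v = 1) →
      Tendsto (fun n : ℕ => T (cutoffTest hp hφ hφc hχ hχc n)) atTop
        (𝓝 ((∫ x : Space d, f x * φ x : ℝ) : ℂ))

/-- `ρ = ∫ T dv`. -/
def IsDensity {d : ℕ} (T : 𝓢(Space d × Space d, ℂ) → ℂ) (ρ : Space d → ℝ) : Prop :=
  HasVelocityMoment T (fun _ => 1) ρ

/-- `J = (1/m) ∫ v T dv`. -/
def IsCurrent {d : ℕ} (m : ℝ) (T : 𝓢(Space d × Space d, ℂ) → ℂ) (J : Space d → Space d) : Prop :=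
  ∀ j : Fin d, HasVelocityMoment T (fun v => (1 / m) * v j) (fun x => J x j)

/-- `E = (1/2m) ∫ |v|² T dv`. -/
def IsKineticEnergy {d : ℕ} (m : ℝ) (T : 𝓢(Space d × Space d, ℂ) → ℂ) (E : Space d → ℝ) : Prop :=
  HasVelocityMoment T (fun v => (1 / (2 * m)) * ‖v‖ ^ 2) E

/-- Weak convergence in `L²(ℝ^d)`. -/
def TendstoWeaklyL2 {d : ℕ} (f : ℕ → Space d → ℝ) (g : Space d → ℝ) : Prop :=
  (∀ n, MemLp (f n) 2 volume) ∧ MemLp g 2 volume ∧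
  ∀ h : Space d → ℝ, MemLp h 2 volume →
    Tendsto (fun n => ∫ x, f n x * h x) atTop (𝓝 (∫ x, g x * h x))

/-- Strong convergence in `L²_loc(ℝ^d)`. -/
def TendstoL2Loc {d : ℕ} {F : Type*} [NormedAddCommGroup F]
    (f : ℕ → Space d → F) (g : Space d → F) : Prop :=
  ∀ r : ℝ, 0 < r →
    (∀ n, MemLp (f n) 2 (volume.restrict (Metric.ball 0 r))) ∧
    MemLp g 2 (volume.restrict (Metric.ball 0 r)) ∧
    Tendsto (fun n => eLpNorm (f n - g) 2 (volume.restrict (Metric.ball 0 r))) atTop (𝓝 0)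

/-- The velocity field `u = J / ρ` where `ρ > 0`, and `u = 0` elsewhere. -/
def velocity {d : ℕ} (ρ : Space d → ℝ) (J : Space d → Space d) (x : Space d) : Space d :=
  {y | 0 < ρ y}.indicator (fun y => (ρ y)⁻¹ • J y) x

/-- The measure `ρ(x) δ(v - V(x))` on phase space: the image of `ρ(x) dx` under `x ↦ (x, V(x))`. -/
def monokinetic {d : ℕ} (ρ : Space d → ℝ) (V : Space d → Space d) : Measure (Space d × Space d) :=
  (volume.withDensity fun x => ENNReal.ofReal (ρ x)).map fun x => (x, V x)

/-- The tempered distribution `w` is the positive Borel measure `μ`. -/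
def IsMeasure {d : ℕ} (w : 𝓢'(Space d × Space d, ℂ)) (μ : Measure (Space d × Space d)) : Prop :=
  ∀ Φ : 𝓢(Space d × Space d, ℂ), Integrable (fun z => Φ z) μ ∧ w Φ = ∫ z, Φ z ∂μ

end Semiclassical

end

open Semiclassical

/-! The limit `w` is nonnegative, and its velocity moments of orders 0, 1 and 2 satisfy the equality
case of Cauchy–Schwarz. A nonnegative measure with vanishing velocity variance at almost every `x`
must sit on a graph, and the first moment says which graph.

Everything starts from `wignerAction_eq_integral_correlation`. In Fourier variables dual to `v`,
pairing a Wigner function with `Φ` means integrating over `η` the correlation of `ψ` with weight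
`Φ̃(x, η)`, taken at shift `πℏη`.

Positivity. Tested against `|g|²`, the Wigner function is a double integral over frequencies `y, z`.
Translating `x` by `πℏ(y + z)` would turn it into the squared norm `∫ |∫ g̃(x, y) ψ(x + 2πℏy) dy|²
dx`. The only obstruction is that the symbol is translated too, which costs `O(ℏ)` for fixed `y, z`
because `g̃` is Lipschitz in `x` (`tendsto_wignerAction_normSq_sub`). Hence `w` is nonnegative on
squares, and then on nonnegative test functions, since `f + εθ²` is the square of `θ√(f + ε)`
(`nonneg_of_normSq_nonneg`).

Moments at fixed `ℏ`. Rescaling the cutoff in `v` turns a moment of degree `r` into the Taylor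
coefficient of order `r` of the correlation at shift zero (`wignerAction_cutoffTest`). This gives `ρ
= |ψ|²`, `mJ = ℏ Im(ψ̄∇ψ)` and, weakly, `2mE = ℏ²|∇ψ|² - (ℏ²/4)Δ|ψ|²`. As `ψ` is only `C¹`, the
second-order expansion uses second differences and a discrete integration by parts. Multiplying by
`ρ` and using `ρ|∂ψ|² = (Im ψ̄∂ψ)² + (∂ρ)²/4` yields `2mEρ = m²|J|²` up to terms carrying `ℏ²` and
`∇ρ` (`energy_density_identity`). These vanish in the limit by the gradient hypothesis, the energy
term passes as a weak times a strong limit, and `2mEρ = m²|J|²` holds a.e. for `w`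
(`energy_density_limit`).

Rigidity. Since `E` is the energy of `w` itself, no energy is lost at infinite velocity, and `E = 0`
a.e. where `ρ = 0` (`energy_eq_zero_of_density_eq_zero`). With `V = mu` this gives `2mE = ρ|V|²` and
`mJ = ρV`. Hence for smooth `b` the moment of `|v - b(x)|²` against `φ` is `∫ φρ|V - b|²`, as small
as desired by density of smooth functions in `L²(φρ dx)`. Positivity of `w` converts this smallness
into `⟨w, Φ⟩ = ∫ ρ Φ(x, V(x)) dx` (`abs_sub_le_of_moments`, `re_eq_integral_monokinetic`). Density
of compactly supported functions in the Schwartz space finishes the proof. -/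

open Semiclassical

/-! ### Schwartz functions on phase space and their Fourier transform in velocity -/

namespace Semiclassical

open scoped FourierTransform

/-- The integrable weight `(1 + ‖η‖)^(-(d+1))`. -/
noncomputable def decayWeight {d : ℕ} (η : Space d) : ℝ := ((1 + ‖η‖) ^ (d + 1))⁻¹

lemma decayWeight_pos {d : ℕ} (η : Space d) : 0 < decayWeight η := by
  unfold decayWeight; positivity

lemma decayWeight_nonneg {d : ℕ} (η : Space d) : 0 ≤ decayWeight η := (decayWeight_pos η).le

lemma integrable_decayWeight {d : ℕ} : Integrable (decayWeight (d := d)) := by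
  have h := integrable_one_add_norm (E := Space d) (μ := volume) (r := ((d + 1 : ℕ) : ℝ))
    (by simp)
  refine h.congr (Eventually.of_forall fun η => ?_)
  simp only [decayWeight]
  rw [Real.rpow_neg (by positivity), Real.rpow_natCast]

lemma norm_iteratedFDeriv_slice_le {d : ℕ} (Φ : 𝓢(Space d × Space d, ℂ)) (x v : Space d) (n : ℕ) :
    ‖iteratedFDeriv ℝ n (fun v => Φ (x, v)) v‖ ≤ ‖iteratedFDeriv ℝ n Φ (x, v)‖ := by
  have h1 : (fun v => Φ (x, v)) = (fun z => Φ ((x, (0 : Space d)) + z)) ∘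
      (ContinuousLinearMap.inr ℝ (Space d) (Space d)) := by
    ext v; simp
  have h2 : ContDiff ℝ n (fun z => Φ ((x, (0 : Space d)) + z)) :=
    (Φ.smooth n).comp (contDiff_const.add contDiff_id)
  rw [h1, ContinuousLinearMap.iteratedFDeriv_comp_right _ h2 v le_rfl]
  refine (ContinuousMultilinearMap.norm_compContinuousLinearMap_le _ _).trans ?_
  rw [iteratedFDeriv_comp_add_left]
  have h3 : (x, (0 : Space d)) + (ContinuousLinearMap.inr ℝ (Space d) (Space d)) v = (x, v) := by
    simp
  rw [h3]
  refine mul_le_of_le_one_right (norm_nonneg _) (Finset.prod_le_one (fun _ _ => norm_nonneg _) ?_)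
  intro _ _
  exact ContinuousLinearMap.norm_inr_le_one ℝ (Space d) (Space d)

/-- The restriction of a Schwartz function on phase space to a fibre `{x} × ℝ^d`. -/
noncomputable def slice {d : ℕ} (Φ : 𝓢(Space d × Space d, ℂ)) (x : Space d) : 𝓢(Space d, ℂ) where
  toFun v := Φ (x, v)
  smooth' := (Φ.smooth ⊤).comp (contDiff_const.prodMk contDiff_id)
  decay' k n := by
    obtain ⟨C, hC⟩ := Φ.decay' k n
    refine ⟨C, fun v => le_trans ?_ (hC (x, v))⟩
    gcongr
    · simp
    · exact norm_iteratedFDeriv_slice_le Φ x v n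

@[simp] lemma slice_apply {d : ℕ} (Φ : 𝓢(Space d × Space d, ℂ)) (x v : Space d) :
    slice Φ x v = Φ (x, v) := rfl

lemma seminorm_slice_le {d : ℕ} (Φ : 𝓢(Space d × Space d, ℂ)) (x : Space d) (k n : ℕ) :
    SchwartzMap.seminorm ℂ k n (slice Φ x) ≤ SchwartzMap.seminorm ℂ k n Φ := by
  refine SchwartzMap.seminorm_le_bound ℂ k n _ (apply_nonneg _ _) fun v => ?_
  refine le_trans ?_ (SchwartzMap.le_seminorm ℂ k n Φ (x, v))
  gcongr
  · simp
  · exact norm_iteratedFDeriv_slice_le Φ x v n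

lemma exists_schwartz_decay {d : ℕ} {E : Type*} [NormedAddCommGroup E] [NormedSpace ℝ E]
    (Φ : 𝓢(E, ℂ)) (n : ℕ) :
    ∃ C, 0 ≤ C ∧ ∀ z, ‖iteratedFDeriv ℝ n Φ z‖ ≤ C * ((1 + ‖z‖) ^ (d + 1))⁻¹ := by
  refine ⟨2 ^ (d + 1) * ((Finset.Iic (d + 1, n)).sup fun m => SchwartzMap.seminorm ℂ m.1 m.2) Φ,
    by positivity, fun z => ?_⟩
  have h := SchwartzMap.one_add_le_sup_seminorm_apply (𝕜 := ℂ) (m := (d + 1, n)) (k := d + 1)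
    (n := n) le_rfl le_rfl Φ z
  rw [← div_eq_mul_inv, le_div_iff₀ (by positivity), mul_comm]
  exact h

/-- The Fourier transform of a Schwartz function on phase space in the velocity variable. -/
noncomputable def partialFourier {d : ℕ} (Φ : 𝓢(Space d × Space d, ℂ)) (x η : Space d) : ℂ := 𝓕 (slice Φ x) η

/-- The Fourier transform is continuous on Schwartz space, so the weighted supremum is controlled by
finitely many seminorms of the slice. These are bounded by seminorms of `Φ`, which makes the
constant independent of `x`. -/
lemma exists_partialFourier_le {d : ℕ} (Φ : 𝓢(Space d × Space d, ℂ)) :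
    ∃ C, 0 ≤ C ∧ ∀ x η, ‖partialFourier Φ x η‖ ≤ C * decayWeight η := by
  have hws := schwartz_withSeminorms ℂ (Space d) ℂ
  let T := FourierTransform.fourierCLM ℂ 𝓢(Space d, ℂ)
  let q₀ : Seminorm ℂ 𝓢(Space d, ℂ) :=
    (Finset.Iic ((d + 1, 0) : ℕ × ℕ)).sup fun m => SchwartzMap.seminorm ℂ m.1 m.2
  let q : Seminorm ℂ 𝓢(Space d, ℂ) := q₀.comp T.toLinearMap
  have hq : Continuous q := by
    have h1 : Continuous q₀ := by
      exact Seminorm.continuous_finsetSup fun i _ => hws.continuous_seminorm i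
    exact h1.comp T.continuous
  obtain ⟨s, C, -, hC⟩ := Seminorm.bound_of_continuous hws q hq
  refine ⟨2 ^ (d + 1) * (C * (s.sup (schwartzSeminormFamily ℂ (Space d × Space d) ℂ)) Φ),
    by positivity, fun x η => ?_⟩
  have h1 := SchwartzMap.one_add_le_sup_seminorm_apply (𝕜 := ℂ) (m := (d + 1, 0)) (k := d + 1)
    (n := 0) le_rfl le_rfl (𝓕 (slice Φ x)) η
  have h2 : q (slice Φ x) ≤ C * (s.sup (schwartzSeminormFamily ℂ (Space d) ℂ)) (slice Φ x) :=
    hC (slice Φ x)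
  have h3 : (s.sup (schwartzSeminormFamily ℂ (Space d) ℂ)) (slice Φ x) ≤
      (s.sup (schwartzSeminormFamily ℂ (Space d × Space d) ℂ)) Φ := by
    apply Seminorm.finset_sup_apply_le (apply_nonneg _ _)
    intro i hi
    refine (seminorm_slice_le Φ x i.1 i.2).trans ?_
    exact Seminorm.le_finset_sup_apply (p := schwartzSeminormFamily ℂ (Space d × Space d) ℂ) hi
  rw [decayWeight, ← div_eq_mul_inv, le_div_iff₀ (by positivity), mul_comm]
  rw [norm_iteratedFDeriv_zero] at h1
  refine h1.trans ?_
  have h4 : ((Finset.Iic (d + 1, 0)).sup fun m : ℕ × ℕ => SchwartzMap.seminorm ℂ m.1 m.2)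
    (𝓕 (slice Φ x)) = q (slice Φ x) := rfl
  dsimp only
  rw [h4]
  gcongr
  exact h2.trans (by gcongr)

lemma exists_slice_lipschitz {d : ℕ} (Φ : 𝓢(Space d × Space d, ℂ)) :
    ∃ C, 0 ≤ C ∧ ∀ x x' v, ‖Φ (x, v) - Φ (x', v)‖ ≤ C * decayWeight v * ‖x - x'‖ := by
  obtain ⟨C, hC0, hC⟩ := exists_schwartz_decay (d := d) Φ 1
  refine ⟨C, hC0, fun x x' v => ?_⟩
  have hd : ∀ z ∈ (Set.univ : Set (Space d)), HasFDerivWithinAt (fun y => Φ (y, v))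
      ((fderiv ℝ Φ (z, v)).comp (ContinuousLinearMap.inl ℝ (Space d) (Space d))) Set.univ z := by
    intro z _
    have h1 : HasFDerivAt (fun y : Space d => (y, v))
        (ContinuousLinearMap.inl ℝ (Space d) (Space d)) z := hasFDerivAt_prodMk_left z v
    exact ((Φ.hasFDerivAt (z, v)).comp z h1).hasFDerivWithinAt
  refine convex_univ.norm_image_sub_le_of_norm_hasFDerivWithin_le (f := fun y => Φ (y, v))
    hd ?_ (Set.mem_univ x') (Set.mem_univ x)
  intro z _
  refine (ContinuousLinearMap.opNorm_comp_le _ _).trans ?_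
  refine (mul_le_of_le_one_right (norm_nonneg _)
    (ContinuousLinearMap.norm_inl_le_one ℝ (Space d) (Space d))).trans ?_
  have h2 := hC (z, v)
  rw [← norm_iteratedFDeriv_fderiv, norm_iteratedFDeriv_zero] at h2
  refine h2.trans ?_
  unfold decayWeight
  gcongr
  simp

/-- Uniformity in `η` comes from the `L¹` norm in `v` of the difference of slices. This bound later
shows that translating a symbol by `O(ℏ)` is harmless. -/
lemma exists_partialFourier_lipschitz {d : ℕ} (Φ : 𝓢(Space d × Space d, ℂ)) :
    ∃ C, 0 ≤ C ∧ ∀ x x' η, ‖partialFourier Φ x η - partialFourier Φ x' η‖ ≤ C * ‖x - x'‖ := by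
  obtain ⟨C, hC0, hC⟩ := exists_slice_lipschitz Φ
  refine ⟨C * ∫ v : Space d, decayWeight v, mul_nonneg hC0
    (integral_nonneg fun v => decayWeight_nonneg v), fun x x' η => ?_⟩
  have h1 : partialFourier Φ x η - partialFourier Φ x' η = 𝓕 (slice Φ x - slice Φ x') η := by
    have := (FourierTransform.fourierCLM ℂ 𝓢(Space d, ℂ)).map_sub (slice Φ x) (slice Φ x')
    exact (congrArg (fun f : 𝓢(Space d, ℂ) => f η) this).symm
  rw [h1, SchwartzMap.fourier_coe]
  refine (VectorFourier.norm_fourierIntegral_le_integral_norm _ _ _ _ _).trans ?_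
  calc ∫ v, ‖(slice Φ x - slice Φ x') v‖ ≤ ∫ v : Space d, C * decayWeight v * ‖x - x'‖ := by
        refine integral_mono_of_nonneg (Eventually.of_forall fun _ => norm_nonneg _)
          ((integrable_decayWeight.const_mul C).mul_const _) (Eventually.of_forall fun v => ?_)
        exact hC x x' v
    _ = _ := by rw [integral_mul_const, integral_const_mul]

lemma continuous_partialFourier {d : ℕ} (Φ : 𝓢(Space d × Space d, ℂ)) :
    Continuous fun z : Space d × Space d => partialFourier Φ z.1 z.2 := by
  obtain ⟨C, hC0, hC⟩ := exists_partialFourier_lipschitz Φ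
  rw [continuous_iff_continuousAt]
  rintro ⟨x, η⟩
  have h1 : Tendsto (fun z : Space d × Space d => partialFourier Φ x z.2) (𝓝 (x, η))
      (𝓝 (partialFourier Φ x η)) :=
    ((𝓕 (slice Φ x)).continuous.comp continuous_snd).tendsto (x, η)
  have h2 : Tendsto (fun z : Space d × Space d => partialFourier Φ z.1 z.2 - partialFourier Φ x z.2)
      (𝓝 (x, η)) (𝓝 0) := by
    refine squeeze_zero_norm (a := fun z : Space d × Space d => C * ‖z.1 - x‖)
      (fun z => hC z.1 x z.2) ?_
    have : Continuous fun z : Space d × Space d => C * ‖z.1 - x‖ := by fun_prop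
    simpa using this.tendsto (x, η)
  have h3 := h2.add h1
  simp only [sub_add_cancel, zero_add] at h3
  exact h3

end Semiclassical

/-! ### The Wigner function as an integral of correlations of the wave function -/

namespace Semiclassical

open scoped FourierTransform

lemma continuous_partialFourier_left {d : ℕ} (Φ : 𝓢(Space d × Space d, ℂ)) (η : Space d) :
    Continuous fun x => partialFourier Φ x η :=
  Continuous.comp (g := fun z : Space d × Space d => partialFourier Φ z.1 z.2)
    (f := fun x => (x, η)) (continuous_partialFourier Φ) (by fun_prop)

section WaveFunction

variable {d : ℕ} {ψ : Space d → ℂ}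

lemma integrable_norm_sq (hL : MemLp ψ 2 volume) : Integrable fun x => ‖ψ x‖ ^ 2 :=
  (memLp_two_iff_integrable_sq_norm hL.1).1 hL

lemma integral_norm_sq_eq_one (hL : MemLp ψ 2 volume) (h1 : eLpNorm ψ 2 volume = 1) :
    ∫ x, ‖ψ x‖ ^ 2 = 1 := by
  have h := hL.eLpNorm_eq_integral_rpow_norm (by norm_num) (by norm_num)
  rw [h1] at h
  have h2 := ENNReal.ofReal_eq_one.1 h.symm
  have h3 : ∫ x, ‖ψ x‖ ^ (2 : ENNReal).toReal = ∫ x, ‖ψ x‖ ^ 2 := by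
    congr 1; ext x; norm_num
  rw [h3] at h2
  have h4 : 0 ≤ ∫ x, ‖ψ x‖ ^ 2 := integral_nonneg fun x => by positivity
  have h5 := congrArg (fun t : ℝ => t ^ (2 : ℝ)) h2
  simp only [Real.one_rpow] at h5
  rw [← Real.rpow_mul h4] at h5
  norm_num at h5
  exact h5

lemma integrable_norm_mul_norm_shift (hc : Continuous ψ) (hL : MemLp ψ 2 volume) (s t : Space d) :
    Integrable fun x => ‖ψ (x + s)‖ * ‖ψ (x + t)‖ := by
  have h := integrable_norm_sq hL
  refine Integrable.mono' (((h.comp_add_right s).add (h.comp_add_right t)))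
    (by fun_prop) (Eventually.of_forall fun x => ?_)
  simp only [Pi.add_apply]
  rw [Real.norm_of_nonneg (by positivity)]
  nlinarith [sq_nonneg (‖ψ (x + s)‖ - ‖ψ (x + t)‖), sq_nonneg (‖ψ (x + s)‖ + ‖ψ (x + t)‖),
    norm_nonneg (ψ (x + s)), norm_nonneg (ψ (x + t))]

/-- Arithmetic–geometric mean and translation invariance. The bound does not depend on the shifts,
hence not on `ℏ`, and this drives the dominated convergence arguments. -/
lemma integral_norm_mul_norm_shift_le (hc : Continuous ψ) (hL : MemLp ψ 2 volume)
    (s t : Space d) :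
    ∫ x, ‖ψ (x + s)‖ * ‖ψ (x + t)‖ ≤ ∫ x, ‖ψ x‖ ^ 2 := by
  have h := integrable_norm_sq hL
  calc ∫ x, ‖ψ (x + s)‖ * ‖ψ (x + t)‖
      ≤ ∫ x, (‖ψ (x + s)‖ ^ 2 + ‖ψ (x + t)‖ ^ 2) * (1 / 2) := by
        refine integral_mono (integrable_norm_mul_norm_shift hc hL s t)
          (((h.comp_add_right s).add (h.comp_add_right t)).mul_const _) fun x => ?_
        dsimp only
        nlinarith [sq_nonneg (‖ψ (x + s)‖ - ‖ψ (x + t)‖)]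
    _ = ∫ x, ‖ψ x‖ ^ 2 := by
        rw [integral_mul_const, integral_add (h.comp_add_right s) (h.comp_add_right t),
          integral_add_right_eq_self (fun x => ‖ψ x‖ ^ 2) s,
          integral_add_right_eq_self (fun x => ‖ψ x‖ ^ 2) t]
        ring

lemma norm_densityMatrix (X Y : Space d) : ‖densityMatrix ψ X Y‖ = ‖ψ X‖ * ‖ψ Y‖ := by
  simp [densityMatrix]

lemma continuous_densityMatrix (hc : Continuous ψ) :
    Continuous fun z : Space d × Space d => densityMatrix ψ z.1 z.2 := by
  unfold densityMatrix
  have : Continuous fun z : ℂ => conj z := Complex.continuous_conj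
  fun_prop

lemma continuous_densityMatrix_comp {X : Type*} [TopologicalSpace X] (hc : Continuous ψ)
    {f g : X → Space d} (hf : Continuous f) (hg : Continuous g) :
    Continuous fun z => densityMatrix ψ (f z) (g z) :=
  (continuous_densityMatrix hc).comp (hf.prodMk hg)

lemma integrable_densityMatrix_line (hc : Continuous ψ) (hL : MemLp ψ 2 volume) {c : ℝ}
    (hc0 : c ≠ 0) (x : Space d) :
    Integrable fun y : Space d => ‖densityMatrix ψ (x + c • y) (x - c • y)‖ := by
  have h := integrable_norm_sq hL
  have h1 : Integrable fun y : Space d => ‖ψ (x + c • y)‖ ^ 2 :=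
    (h.comp_add_left x).comp_smul hc0
  have h2 : Integrable fun y : Space d => ‖ψ (x - c • y)‖ ^ 2 :=
    (h.comp_sub_left x).comp_smul hc0
  refine Integrable.mono' (h1.add h2) ?_ (Eventually.of_forall fun y => ?_)
  · exact (continuous_densityMatrix_comp hc (by fun_prop) (by fun_prop)).norm.aestronglyMeasurable
  · rw [norm_norm, norm_densityMatrix, Pi.add_apply]
    nlinarith [sq_nonneg (‖ψ (x + c • y)‖ - ‖ψ (x - c • y)‖),
      sq_nonneg (‖ψ (x + c • y)‖ + ‖ψ (x - c • y)‖)]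

/-- The constant blows up like `|c|^(-d)`; it only serves to justify Fubini at a fixed `ℏ`. -/
lemma exists_integral_densityMatrix_line_le (hc : Continuous ψ) (hL : MemLp ψ 2 volume) {c : ℝ}
    (hc0 : c ≠ 0) :
    ∃ M, 0 ≤ M ∧ ∀ x : Space d, ∫ y : Space d, ‖densityMatrix ψ (x + c • y) (x - c • y)‖ ≤ M := by
  have h := integrable_norm_sq hL
  have h1 (x : Space d) : Integrable fun y : Space d => ‖ψ (x + c • y)‖ ^ 2 :=
    (h.comp_add_left x).comp_smul hc0
  have h2 (x : Space d) : Integrable fun y : Space d => ‖ψ (x - c • y)‖ ^ 2 :=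
    (h.comp_sub_left x).comp_smul hc0
  refine ⟨|(c ^ d)⁻¹| * ∫ x, ‖ψ x‖ ^ 2,
    mul_nonneg (abs_nonneg _) (integral_nonneg fun x => by positivity), fun x => ?_⟩
  calc ∫ y : Space d, ‖densityMatrix ψ (x + c • y) (x - c • y)‖
      ≤ ∫ y : Space d, (‖ψ (x + c • y)‖ ^ 2 + ‖ψ (x - c • y)‖ ^ 2) * (1 / 2) := by
        refine integral_mono (integrable_densityMatrix_line hc hL hc0 x)
          (((h1 x).add (h2 x)).mul_const _) fun y => ?_
        simp only [norm_densityMatrix]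
        nlinarith [sq_nonneg (‖ψ (x + c • y)‖ - ‖ψ (x - c • y)‖)]
    _ = |(c ^ d)⁻¹| * ∫ x, ‖ψ x‖ ^ 2 := by
        rw [integral_mul_const, integral_add (h1 x) (h2 x),
          Measure.integral_comp_smul volume (fun y => ‖ψ (x + y)‖ ^ 2) c,
          Measure.integral_comp_smul volume (fun y => ‖ψ (x - y)‖ ^ 2) c,
          integral_add_left_eq_self (fun x => ‖ψ x‖ ^ 2) x,
          integral_sub_left_eq_self (fun x => ‖ψ x‖ ^ 2) volume x]
        simp only [finrank_euclideanSpace, Fintype.card_fin, smul_eq_mul]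
        ring

lemma integrable_schwartz_phaseSpace (Φ : 𝓢(Space d × Space d, ℂ)) : Integrable Φ volume := by
  have : (volume : Measure (Space d × Space d)).IsAddHaarMeasure :=
    inferInstanceAs ((volume : Measure (Space d)).prod volume).IsAddHaarMeasure
  exact Φ.integrable

lemma norm_oscillation (v y : Space d) :
    ‖Complex.exp (-(Complex.I * ((inner ℝ v y : ℝ) : ℂ)))‖ = 1 := by
  rw [← mul_neg, mul_comm, ← Complex.ofReal_neg]
  exact Complex.norm_exp_ofReal_mul_I _

lemma continuous_oscillation {X : Type*} [TopologicalSpace X] {f g : X → Space d}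
    (hf : Continuous f) (hg : Continuous g) :
    Continuous fun z => Complex.exp (-(Complex.I * ((inner ℝ (f z) (g z) : ℝ) : ℂ))) := by
  have : Continuous fun z => (inner ℝ (f z) (g z) : ℝ) := hf.inner hg
  fun_prop

/-- The integrals defining the pairing of a Wigner function with a Schwartz function, taken in
the order: velocity, frequency, position. -/
lemma wignerAction_eq_integral_integral (hc : Continuous ψ) (hL : MemLp ψ 2 volume) {h : ℝ}
    (hh : 0 < h) (Φ : 𝓢(Space d × Space d, ℂ)) :
    wignerAction h ψ Φ = ∫ x, ∫ η, partialFourier Φ x η *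
      densityMatrix ψ (x + (Real.pi * h) • η) (x - (Real.pi * h) • η) := by
  have hh2 : h / 2 ≠ 0 := by positivity
  obtain ⟨M, hM0, hM⟩ := exists_integral_densityMatrix_line_le hc hL hh2
  let K : ℂ := (((2 * Real.pi) ^ d : ℝ) : ℂ)⁻¹
  let F : (Space d × Space d) × Space d → ℂ := fun q =>
    Φ q.1 * (Complex.exp (-(Complex.I * ((inner ℝ q.1.2 q.2 : ℝ) : ℂ))) *
      densityMatrix ψ (q.1.1 + (h / 2) • q.2) (q.1.1 - (h / 2) • q.2))
  have hFc : Continuous F := by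
    refine (Φ.continuous.comp continuous_fst).mul ((continuous_oscillation ?_ ?_).mul
      (continuous_densityMatrix_comp hc ?_ ?_)) <;> fun_prop
  have hFn : ∀ z y, ‖F (z, y)‖ =
      ‖Φ z‖ * ‖densityMatrix ψ (z.1 + (h / 2) • y) (z.1 - (h / 2) • y)‖ := by
    intro z y
    simp only [F, norm_mul, norm_oscillation, one_mul]
  have hFline : ∀ z, Integrable fun y => F (z, y) := by
    intro z
    refine Integrable.mono' ((integrable_densityMatrix_line hc hL hh2 z.1).const_mul ‖Φ z‖)
      (by fun_prop) (Eventually.of_forall fun y => (hFn z y).le)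
  have hbound : ∀ z, ‖∫ y, ‖F (z, y)‖‖ ≤ M * ‖Φ z‖ := by
    intro z
    rw [Real.norm_of_nonneg (integral_nonneg fun _ => norm_nonneg _)]
    simp only [hFn]
    rw [integral_const_mul, mul_comm]
    exact mul_le_mul_of_nonneg_right (hM z.1) (norm_nonneg _)
  have hF : Integrable F := by
    have : Integrable F ((volume : Measure (Space d × Space d)).prod volume) := by
      rw [integrable_prod_iff hFc.aestronglyMeasurable]
      refine ⟨Eventually.of_forall hFline, ?_⟩
      refine Integrable.mono' ((integrable_schwartz_phaseSpace Φ).norm.const_mul M)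
        hFc.aestronglyMeasurable.norm.integral_prod_right' (Eventually.of_forall hbound)
    exact this
  have hFx : ∀ x, Integrable (fun q : Space d × Space d => F ((x, q.1), q.2))
      ((volume : Measure (Space d)).prod volume) := by
    intro x
    have hcx : Continuous fun q : Space d × Space d => F ((x, q.1), q.2) := by fun_prop
    rw [integrable_prod_iff hcx.aestronglyMeasurable]
    refine ⟨Eventually.of_forall fun v => hFline (x, v), ?_⟩
    refine Integrable.mono' ((slice Φ x).integrable.norm.const_mul M)
      hcx.aestronglyMeasurable.norm.integral_prod_right' (Eventually.of_forall fun v => hbound (x, v))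
  have h1 : wignerAction h ψ Φ = ∫ z, K * ∫ y, F (z, y) := by
    unfold wignerAction wigner
    congr 1; ext z
    rw [mul_assoc, mul_comm _ (Φ z), ← integral_const_mul]
  have h2 : ∫ z, K * ∫ y, F (z, y) = ∫ x, ∫ v, K * ∫ y, F ((x, v), y) := by
    have : Integrable (fun z => K * ∫ y, F (z, y))
        ((volume : Measure (Space d)).prod volume) := by
      have h3 : Integrable F ((volume : Measure (Space d × Space d)).prod volume) := hF
      exact h3.integral_prod_left.const_mul K
    exact integral_prod _ this
  rw [h1, h2]
  congr 1; ext x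
  rw [integral_const_mul]
  have h3 : ∫ v, ∫ y, F ((x, v), y) = ∫ y, ∫ v, F ((x, v), y) := integral_integral_swap (hFx x)
  rw [h3]
  -- The substitution `y = 2πη` matches the normalization of `𝓕`. It turns the shift `(ℏ/2)y` into
  -- `πℏη`, and its Jacobian cancels the prefactor `(2π)^(-d)`.
  let g : Space d → ℂ := fun y => ∫ v, F ((x, v), y)
  have h4 : ∀ η : Space d, g ((2 * Real.pi) • η) = partialFourier Φ x η *
      densityMatrix ψ (x + (Real.pi * h) • η) (x - (Real.pi * h) • η) := by
    intro η
    simp only [g, F]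
    have h5 : (h / 2) • (2 * Real.pi) • η = (Real.pi * h) • η := by
      rw [smul_smul]; congr 1; ring
    rw [h5]
    simp only [← mul_assoc]
    rw [integral_mul_const]
    congr 1
    rw [partialFourier, SchwartzMap.fourier_coe, Real.fourier_eq']
    congr 1; ext v
    rw [slice_apply, smul_eq_mul, mul_comm]
    congr 2
    rw [inner_smul_right]
    push_cast
    ring
  have h5 := Measure.integral_comp_smul volume g (2 * Real.pi)
  simp only [h4] at h5
  rw [h5]
  simp only [finrank_euclideanSpace, Fintype.card_fin, g, K]
  rw [abs_of_pos (by positivity), Complex.real_smul]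
  push_cast
  ring

/-- Pairing of a bounded function with the density matrix along the antidiagonal. -/
noncomputable def correlation (ψ : Space d → ℂ) (a : Space d → ℂ) (s : Space d) : ℂ :=
  ∫ x, a x * densityMatrix ψ (x + s) (x - s)

lemma integrable_densityMatrix_shift (hc : Continuous ψ) (hL : MemLp ψ 2 volume)
    (s t : Space d) : Integrable fun x => densityMatrix ψ (x + s) (x + t) := by
  refine Integrable.mono' (integrable_norm_mul_norm_shift hc hL s t)
    (continuous_densityMatrix_comp hc (by fun_prop) (by fun_prop)).aestronglyMeasurable
    (Eventually.of_forall fun x => (norm_densityMatrix _ _).le)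

lemma integrable_mul_densityMatrix_shift (hc : Continuous ψ) (hL : MemLp ψ 2 volume)
    {a : Space d → ℂ} (ha : Continuous a) {C : ℝ} (hC : ∀ x, ‖a x‖ ≤ C) (s t : Space d) :
    Integrable fun x => a x * densityMatrix ψ (x + s) (x + t) :=
  (integrable_densityMatrix_shift hc hL s t).bdd_mul ha.aestronglyMeasurable
    (Eventually.of_forall hC)

lemma norm_integral_mul_densityMatrix_le (hc : Continuous ψ) (hL : MemLp ψ 2 volume)
    {a : Space d → ℂ} {C : ℝ} (hC0 : 0 ≤ C) (hC : ∀ x, ‖a x‖ ≤ C) (s t : Space d) :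
    ‖∫ x, a x * densityMatrix ψ (x + s) (x + t)‖ ≤ C * ∫ x, ‖ψ x‖ ^ 2 := by
  refine (norm_integral_le_of_norm_le
    ((integrable_norm_mul_norm_shift hc hL s t).const_mul C)
    (Eventually.of_forall fun x => ?_)).trans ?_
  · rw [norm_mul, norm_densityMatrix]
    exact mul_le_mul_of_nonneg_right (hC x) (by positivity)
  · rw [integral_const_mul]
    exact mul_le_mul_of_nonneg_left (integral_norm_mul_norm_shift_le hc hL s t) hC0

lemma norm_correlation_le (hc : Continuous ψ) (hL : MemLp ψ 2 volume)
    {a : Space d → ℂ} {C : ℝ} (hC0 : 0 ≤ C) (hC : ∀ x, ‖a x‖ ≤ C) (s : Space d) :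
    ‖correlation ψ a s‖ ≤ C * ∫ x, ‖ψ x‖ ^ 2 := by
  have := norm_integral_mul_densityMatrix_le hc hL hC0 hC s (-s)
  simpa only [correlation, sub_eq_add_neg] using this

/-- The Wigner function acts through the velocity Fourier transform of the test function. -/
theorem wignerAction_eq_integral_correlation (hc : Continuous ψ) (hL : MemLp ψ 2 volume) {h : ℝ}
    (hh : 0 < h) (Φ : 𝓢(Space d × Space d, ℂ)) :
    wignerAction h ψ Φ =
      ∫ η, correlation ψ (fun x => partialFourier Φ x η) ((Real.pi * h) • η) := by
  rw [wignerAction_eq_integral_integral hc hL hh]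
  unfold correlation
  obtain ⟨C, hC0, hC⟩ := exists_partialFourier_le Φ
  have hcont : Continuous fun q : Space d × Space d => partialFourier Φ q.1 q.2 *
      densityMatrix ψ (q.1 + (Real.pi * h) • q.2) (q.1 - (Real.pi * h) • q.2) :=
    (continuous_partialFourier Φ).mul
      (continuous_densityMatrix_comp hc (by fun_prop) (by fun_prop))
  have hline : ∀ η, Integrable fun x => partialFourier Φ x η *
      densityMatrix ψ (x + (Real.pi * h) • η) (x - (Real.pi * h) • η) := by
    intro η
    have := integrable_mul_densityMatrix_shift hc hL (a := fun x => partialFourier Φ x η)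
      (continuous_partialFourier_left Φ η)
      (fun x => hC x η) ((Real.pi * h) • η) (-((Real.pi * h) • η))
    simpa only [sub_eq_add_neg] using this
  have hint : Integrable (fun q : Space d × Space d => partialFourier Φ q.1 q.2 *
      densityMatrix ψ (q.1 + (Real.pi * h) • q.2) (q.1 - (Real.pi * h) • q.2))
      ((volume : Measure (Space d)).prod volume) := by
    rw [integrable_prod_iff' hcont.aestronglyMeasurable]
    refine ⟨Eventually.of_forall hline, ?_⟩
    refine Integrable.mono' ((integrable_decayWeight.const_mul C).mul_const (∫ x, ‖ψ x‖ ^ 2))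
      hcont.aestronglyMeasurable.norm.prod_swap.integral_prod_right'
      (Eventually.of_forall fun η => ?_)
    rw [Real.norm_of_nonneg (integral_nonneg fun _ => norm_nonneg _)]
    calc ∫ x, ‖partialFourier Φ x η *
          densityMatrix ψ (x + (Real.pi * h) • η) (x - (Real.pi * h) • η)‖
        ≤ ∫ x, C * decayWeight η *
          (‖ψ (x + (Real.pi * h) • η)‖ * ‖ψ (x + -((Real.pi * h) • η))‖) := by
          refine integral_mono (hline η).norm
            ((integrable_norm_mul_norm_shift hc hL _ _).const_mul _) fun x => ?_
          dsimp only
          rw [norm_mul, norm_densityMatrix, ← sub_eq_add_neg]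
          exact mul_le_mul_of_nonneg_right (hC x η) (by positivity)
      _ ≤ _ := by
          rw [integral_const_mul]
          exact mul_le_mul_of_nonneg_left (integral_norm_mul_norm_shift_le hc hL _ _)
            (mul_nonneg hC0 (decayWeight_nonneg η))
  exact integral_integral_swap hint

end WaveFunction

end Semiclassical

/-! ### The Wigner function tested against squares -/

namespace Semiclassical

open scoped FourierTransform

lemma decayWeight_le_one {d : ℕ} (η : Space d) : decayWeight η ≤ 1 := by
  unfold decayWeight
  exact inv_le_one_of_one_le₀ (one_le_pow₀ (by linarith [norm_nonneg η]))

/-- The Fourier transform of `|f|²` is the autocorrelation of the Fourier transform of `f`. -/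
lemma fourier_normSq_eq_integral {d : ℕ} (f f2 : 𝓢(Space d, ℂ))
    (hf : ∀ v, f2 v = f v * conj (f v)) (η : Space d) :
    𝓕 f2 η = ∫ z, 𝓕 f (z + η) * conj (𝓕 f z) := by
  let k : 𝓢(Space d, ℂ) := SchwartzMap.compSubConstCLM ℂ (-η) (𝓕 f)
  have hk : ∀ z, k z = 𝓕 f (z + η) := fun z => by
    simp only [k, SchwartzMap.compSubConstCLM_apply, sub_neg_eq_add]
  have hk' : ∀ v, 𝓕⁻ k v = Complex.exp (↑(-2 * Real.pi * inner ℝ v η) * Complex.I) * f v := by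
    intro v
    have h1 : f v = ∫ z, Complex.exp (↑(2 * Real.pi * inner ℝ z v) * Complex.I) • 𝓕 f z := by
      conv_lhs => rw [← FourierTransform.fourierInv_fourier_eq (F := 𝓢(Space d, ℂ)) f]
      rw [SchwartzMap.fourierInv_coe, Real.fourierInv_eq']
    rw [SchwartzMap.fourierInv_coe, Real.fourierInv_eq', h1, ← integral_const_mul,
      ← integral_add_right_eq_self (fun z =>
        Complex.exp (↑(-2 * Real.pi * inner ℝ v η) * Complex.I) *
          (Complex.exp (↑(2 * Real.pi * inner ℝ z v) * Complex.I) • 𝓕 f z)) η]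
    congr 1; ext z
    rw [hk, smul_eq_mul, smul_eq_mul, ← mul_assoc, ← Complex.exp_add, inner_add_left,
      real_inner_comm v η]
    congr 2
    push_cast
    ring
  -- Plancherel for `f` and its modulation `𝓕⁻ k`, whose Fourier transform is the translate of `𝓕 f`
  -- by `η`.
  have h2 := SchwartzMap.integral_inner_fourier_fourier f (𝓕⁻ k)
  rw [FourierTransform.fourier_fourierInv_eq (E := 𝓢(Space d, ℂ)) k] at h2
  simp only [RCLike.inner_apply, hk, hk'] at h2
  rw [h2, SchwartzMap.fourier_coe, Real.fourier_eq']
  congr 1; ext v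
  rw [hf, smul_eq_mul]
  ring

/-- The common Fubini criterion: the symbol needs a majorant integrable in the parameter alone,
because the integral over `x` of the shifted density matrix is bounded by the mass of `ψ`. -/
lemma integrable_mul_densityMatrix_prod {d : ℕ} {ψ : Space d → ℂ} (hc : Continuous ψ)
    (hL : MemLp ψ 2 volume) {Q : Type*} [TopologicalSpace Q] [SecondCountableTopology Q]
    [MeasurableSpace Q] [OpensMeasurableSpace Q] {ν : Measure Q} [SFinite ν]
    {b : Space d × Q → ℂ} (hb : Continuous b) {B : Q → ℝ} (hB : Integrable B ν)
    (hbB : ∀ x q, ‖b (x, q)‖ ≤ B q) {s t : Q → Space d} (hs : Continuous s) (ht : Continuous t) :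
    Integrable (fun p : Space d × Q => b p * densityMatrix ψ (p.1 + s p.2) (p.1 + t p.2))
      ((volume : Measure (Space d)).prod ν) := by
  have hcont : Continuous fun p : Space d × Q =>
      b p * densityMatrix ψ (p.1 + s p.2) (p.1 + t p.2) :=
    hb.mul (continuous_densityMatrix_comp hc (by fun_prop) (by fun_prop))
  have hline : ∀ q, Integrable fun x =>
      b (x, q) * densityMatrix ψ (x + s q) (x + t q) := fun q =>
    integrable_mul_densityMatrix_shift hc hL (a := fun x => b (x, q)) (by fun_prop)
      (fun x => hbB x q) (s q) (t q)
  rw [integrable_prod_iff' hcont.aestronglyMeasurable]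
  refine ⟨Eventually.of_forall hline, ?_⟩
  refine Integrable.mono' (hB.mul_const (∫ x, ‖ψ x‖ ^ 2))
    hcont.aestronglyMeasurable.norm.prod_swap.integral_prod_right'
    (Eventually.of_forall fun q => ?_)
  rw [Real.norm_of_nonneg (integral_nonneg fun _ => norm_nonneg _)]
  calc ∫ x, ‖b (x, q) * densityMatrix ψ (x + s q) (x + t q)‖
      ≤ ∫ x, B q * (‖ψ (x + s q)‖ * ‖ψ (x + t q)‖) := by
        refine integral_mono (hline q).norm
          ((integrable_norm_mul_norm_shift hc hL _ _).const_mul _) fun x => ?_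
        dsimp only
        rw [norm_mul, norm_densityMatrix]
        exact mul_le_mul_of_nonneg_right (hbB x q) (by positivity)
    _ ≤ _ := by
        rw [integral_const_mul]
        exact mul_le_mul_of_nonneg_left (integral_norm_mul_norm_shift_le hc hL _ _)
          ((norm_nonneg _).trans (hbB 0 q))

section Positivity

variable {d : ℕ}

lemma integrable_decayWeight_prod :
    Integrable (fun q : Space d × Space d => decayWeight q.1 * decayWeight q.2)
      ((volume : Measure (Space d)).prod volume) :=
  integrable_decayWeight.mul_prod integrable_decayWeight

/-- The rank-two symbol `g̃(x, y) conj g̃(x, z)`. -/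
noncomputable def fourierPair (g : 𝓢(Space d × Space d, ℂ)) (x y z : Space d) : ℂ :=
  partialFourier g x y * conj (partialFourier g x z)

lemma continuous_fourierPair (g : 𝓢(Space d × Space d, ℂ)) {X : Type*} [TopologicalSpace X]
    {a b e : X → Space d} (ha : Continuous a) (hb : Continuous b) (he : Continuous e) :
    Continuous fun p => fourierPair g (a p) (b p) (e p) := by
  have h1 : Continuous fun p => partialFourier g (a p) (b p) :=
    Continuous.comp (g := fun z : Space d × Space d => partialFourier g z.1 z.2)
      (f := fun p => (a p, b p)) (continuous_partialFourier g) (ha.prodMk hb)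
  have h2 : Continuous fun p => partialFourier g (a p) (e p) :=
    Continuous.comp (g := fun z : Space d × Space d => partialFourier g z.1 z.2)
      (f := fun p => (a p, e p)) (continuous_partialFourier g) (ha.prodMk he)
  exact h1.mul (Complex.continuous_conj.comp h2)

lemma exists_norm_fourierPair_le (g : 𝓢(Space d × Space d, ℂ)) :
    ∃ C, 0 ≤ C ∧ ∀ x y z, ‖fourierPair g x y z‖ ≤ C * (decayWeight y * decayWeight z) := by
  obtain ⟨C, hC0, hC⟩ := exists_partialFourier_le g
  refine ⟨C * C, mul_nonneg hC0 hC0, fun x y z => ?_⟩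
  rw [fourierPair, norm_mul, RCLike.norm_conj]
  calc _ ≤ (C * decayWeight y) * (C * decayWeight z) :=
        mul_le_mul (hC x y) (hC x z) (norm_nonneg _) (mul_nonneg hC0 (decayWeight_nonneg y))
    _ = _ := by ring

lemma exists_norm_fourierPair_sub_le (g : 𝓢(Space d × Space d, ℂ)) :
    ∃ C, 0 ≤ C ∧ ∀ x x' y z, ‖fourierPair g x y z - fourierPair g x' y z‖ ≤ C * ‖x - x'‖ := by
  obtain ⟨C, hC0, hC⟩ := exists_partialFourier_le g
  obtain ⟨L, hL0, hL⟩ := exists_partialFourier_lipschitz g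
  have hC1 : ∀ x y, ‖partialFourier g x y‖ ≤ C := fun x y =>
    (hC x y).trans (mul_le_of_le_one_right hC0 (decayWeight_le_one y))
  refine ⟨2 * (C * L), by positivity, fun x x' y z => ?_⟩
  have h1 : fourierPair g x y z - fourierPair g x' y z =
      (partialFourier g x y - partialFourier g x' y) * conj (partialFourier g x z) +
      partialFourier g x' y * conj (partialFourier g x z - partialFourier g x' z) := by
    simp only [fourierPair, map_sub]
    ring
  rw [h1]
  refine (norm_add_le _ _).trans ?_
  rw [norm_mul, norm_mul, RCLike.norm_conj, RCLike.norm_conj]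
  have h2 := mul_le_mul (hL x x' y) (hC1 x z) (norm_nonneg _) (by positivity)
  have h3 := mul_le_mul (hC1 x' y) (hL x x' z) (norm_nonneg _) hC0
  linarith

variable {ψ : Space d → ℂ}

/-- The Wigner function tested against `|g|²`, as an integral over pairs of frequencies. -/
lemma wignerAction_normSq_eq (hc : Continuous ψ) (hL : MemLp ψ 2 volume) {h : ℝ} (hh : 0 < h)
    (g g2 : 𝓢(Space d × Space d, ℂ)) (hg : ∀ z, g2 z = g z * conj (g z)) :
    wignerAction h ψ g2 = ∫ q : Space d × Space d,
      (∫ x, fourierPair g x q.1 q.2 * densityMatrix ψ (x + (Real.pi * h) • (q.1 - q.2))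
        (x + -((Real.pi * h) • (q.1 - q.2)))) ∂((volume : Measure (Space d)).prod volume) := by
  obtain ⟨C, hC0, hC⟩ := exists_norm_fourierPair_le g
  set c := Real.pi * h with hcdef
  let F : Space d × Space d → ℂ := fun q =>
    ∫ x, fourierPair g x q.1 q.2 * densityMatrix ψ (x + c • (q.1 - q.2)) (x + -(c • (q.1 - q.2)))
  have hFint : Integrable F ((volume : Measure (Space d)).prod volume) := by
    have := integrable_mul_densityMatrix_prod hc hL (ν := (volume : Measure (Space d)).prod volume)
      (b := fun p : Space d × Space d × Space d => fourierPair g p.1 p.2.1 p.2.2)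
      (continuous_fourierPair g (by fun_prop) (by fun_prop) (by fun_prop))
      (integrable_decayWeight_prod.const_mul C) (fun x q => hC x q.1 q.2)
      (s := fun q => c • (q.1 - q.2)) (t := fun q => -(c • (q.1 - q.2)))
      (by fun_prop) (by fun_prop)
    exact this.integral_prod_right
  -- The shear `(η, z) ↦ (η + z, z)` preserves volume and passes from autocorrelation variables to
  -- the two independent frequencies.
  have hmp := measurePreserving_add_prod (volume : Measure (Space d)) volume
  have hF' : Integrable (fun q : Space d × Space d => F (q.1 + q.2, q.2))
      ((volume : Measure (Space d)).prod volume) := hmp.integrable_comp_of_integrable hFint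
  have h1 : ∫ q, F q ∂((volume : Measure (Space d)).prod volume) =
      ∫ η, ∫ z, F (η + z, z) := by
    rw [integral_prod_symm _ hFint]
    have h2 : ∫ η, ∫ z, F (η + z, z) = ∫ z, ∫ η, F (η + z, z) := integral_integral_swap hF'
    rw [h2]
    congr 1; ext z
    exact (integral_add_right_eq_self (fun y => F (y, z)) z).symm
  change _ = ∫ q, F q ∂((volume : Measure (Space d)).prod volume)
  rw [h1, wignerAction_eq_integral_correlation hc hL hh]
  congr 1; ext η
  have h3 : ∀ x, partialFourier g2 x η = ∫ z, fourierPair g x (η + z) z := by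
    intro x
    rw [partialFourier, fourier_normSq_eq_integral (slice g x) (slice g2 x) (fun v => hg _)]
    simp only [fourierPair, partialFourier, add_comm]
  have h4 : Integrable (fun p : Space d × Space d => fourierPair g p.1 (η + p.2) p.2 *
      densityMatrix ψ (p.1 + c • η) (p.1 + -(c • η))) ((volume : Measure (Space d)).prod volume) :=
    integrable_mul_densityMatrix_prod hc hL
      (b := fun p : Space d × Space d => fourierPair g p.1 (η + p.2) p.2)
      (continuous_fourierPair g (by fun_prop) (by fun_prop) (by fun_prop))
      (integrable_decayWeight.const_mul C) (fun x z => (hC x (η + z) z).trans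
        (mul_le_mul_of_nonneg_left (mul_le_of_le_one_left (decayWeight_nonneg z)
          (decayWeight_le_one _)) hC0))
      (s := fun _ => c • η) (t := fun _ => -(c • η)) (by fun_prop) (by fun_prop)
  have h5 : ∫ x, ∫ z, fourierPair g x (η + z) z * densityMatrix ψ (x + c • η) (x + -(c • η)) =
      ∫ z, ∫ x, fourierPair g x (η + z) z * densityMatrix ψ (x + c • η) (x + -(c • η)) :=
    integral_integral_swap h4
  simp only [correlation, h3, F, add_sub_cancel_right]
  rw [← h5]
  congr 1; ext x
  rw [integral_mul_const, sub_eq_add_neg]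

/-- The squared `L²` norm of the standard quantization of `g` applied to `ψ`. -/
lemma integral_fourierPair_shift_eq (hc : Continuous ψ) (hL : MemLp ψ 2 volume) (c : ℝ)
    (g : 𝓢(Space d × Space d, ℂ)) :
    ∫ q : Space d × Space d,
      (∫ x, fourierPair g (x - c • (q.1 + q.2)) q.1 q.2 *
        densityMatrix ψ (x + c • (q.1 - q.2)) (x + -(c • (q.1 - q.2))))
        ∂((volume : Measure (Space d)).prod volume) =
    ((∫ x, ‖∫ y, partialFourier g x y * ψ (x + (2 * c) • y)‖ ^ 2 : ℝ) : ℂ) := by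
  obtain ⟨C, hC0, hC⟩ := exists_norm_fourierPair_le g
  -- Translating `x` by `c(y + z)` places `ψ` at `x + 2cy` and `ψ̄` at `x + 2cz`. The integrand then
  -- factors in `y` and `z`, and the double integral is a modulus squared.
  have h1 : ∀ q : Space d × Space d,
      (∫ x, fourierPair g (x - c • (q.1 + q.2)) q.1 q.2 *
        densityMatrix ψ (x + c • (q.1 - q.2)) (x + -(c • (q.1 - q.2)))) =
      ∫ x, fourierPair g x q.1 q.2 * densityMatrix ψ (x + (2 * c) • q.1) (x + (2 * c) • q.2) := by
    intro q
    rw [← integral_sub_right_eq_self (fun x => fourierPair g x q.1 q.2 *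
      densityMatrix ψ (x + (2 * c) • q.1) (x + (2 * c) • q.2)) (c • (q.1 + q.2))]
    congr 1; ext x
    congr 2 <;> module
  simp only [h1]
  have h2 : Integrable (fun p : Space d × Space d × Space d => fourierPair g p.1 p.2.1 p.2.2 *
      densityMatrix ψ (p.1 + (2 * c) • p.2.1) (p.1 + (2 * c) • p.2.2))
      ((volume : Measure (Space d)).prod ((volume : Measure (Space d)).prod volume)) :=
    integrable_mul_densityMatrix_prod hc hL
      (b := fun p : Space d × Space d × Space d => fourierPair g p.1 p.2.1 p.2.2)
      (continuous_fourierPair g (by fun_prop) (by fun_prop) (by fun_prop))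
      (integrable_decayWeight_prod.const_mul C) (fun x q => hC x q.1 q.2)
      (s := fun q => (2 * c) • q.1) (t := fun q => (2 * c) • q.2)
      (by fun_prop) (by fun_prop)
  have h3 := integral_integral_swap (f := fun x (q : Space d × Space d) =>
    fourierPair g x q.1 q.2 * densityMatrix ψ (x + (2 * c) • q.1) (x + (2 * c) • q.2)) h2
  rw [← h3, ← integral_complex_ofReal]
  congr 1; ext x
  have h4 : ∀ q : Space d × Space d, fourierPair g x q.1 q.2 *
      densityMatrix ψ (x + (2 * c) • q.1) (x + (2 * c) • q.2) =
      (partialFourier g x q.1 * ψ (x + (2 * c) • q.1)) *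
        conj (partialFourier g x q.2 * ψ (x + (2 * c) • q.2)) := by
    intro q
    simp only [fourierPair, densityMatrix, map_mul]
    ring
  simp only [h4]
  rw [integral_prod_mul (fun y => partialFourier g x y * ψ (x + (2 * c) • y))
    (fun y => conj (partialFourier g x y * ψ (x + (2 * c) • y))), integral_conj, RCLike.mul_conj]
  push_cast
  rfl

end Positivity

end Semiclassical

/-! ### Positivity of semiclassical limits -/

namespace Semiclassical

open scoped FourierTransform

/-- A smooth compactly supported real function as a complex-valued Schwartz function. -/
noncomputable def realSchwartz {E : Type*} [NormedAddCommGroup E] [NormedSpace ℝ E] (f : E → ℝ)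
    (hf : ContDiff ℝ ∞ f) (hfc : HasCompactSupport f) : 𝓢(E, ℂ) :=
  HasCompactSupport.toSchwartzMap (f := fun z => (f z : ℂ))
    (hfc.comp_left (g := fun t : ℝ => (t : ℂ)) Complex.ofReal_zero)
    (Complex.ofRealCLM.contDiff.comp hf)

@[simp] lemma realSchwartz_apply {E : Type*} [NormedAddCommGroup E] [NormedSpace ℝ E] (f : E → ℝ)
    (hf : ContDiff ℝ ∞ f) (hfc : HasCompactSupport f) (z : E) :
    realSchwartz f hf hfc z = (f z : ℂ) := rfl

section Limit

variable {d : ℕ}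

/-- The two quantities differ only in the position argument of the symbol, translated by `πℏ(y +
z)`. The Lipschitz bound makes the difference vanish for each pair of frequencies, and the decay of
`g̃` dominates. -/
lemma tendsto_wignerAction_normSq_sub {hbar : ℕ → ℝ} (hbar_pos : ∀ n, 0 < hbar n)
    (hbar_lim : Tendsto hbar atTop (𝓝 0)) {ψ : ℕ → Space d → ℂ} (hc : ∀ n, Continuous (ψ n))
    (hL : ∀ n, MemLp (ψ n) 2 volume) (h1 : ∀ n, ∫ x, ‖ψ n x‖ ^ 2 = 1)
    (g g2 : 𝓢(Space d × Space d, ℂ)) (hg : ∀ z, g2 z = g z * conj (g z)) :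
    Tendsto (fun n => wignerAction (hbar n) (ψ n) g2 -
      ((∫ x, ‖∫ y, partialFourier g x y * ψ n (x + (2 * (Real.pi * hbar n)) • y)‖ ^ 2 : ℝ) : ℂ))
      atTop (𝓝 0) := by
  obtain ⟨C, hC0, hC⟩ := exists_norm_fourierPair_le g
  obtain ⟨L, hL0, hLip⟩ := exists_norm_fourierPair_sub_le g
  set c : ℕ → ℝ := fun n => Real.pi * hbar n with hcdef
  let ν := (volume : Measure (Space d)).prod (volume : Measure (Space d))
  let R : ℕ → Space d × Space d → Space d → ℂ := fun n q x =>
    densityMatrix (ψ n) (x + c n • (q.1 - q.2)) (x + -(c n • (q.1 - q.2)))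
  let F : ℕ → Space d × Space d → ℂ := fun n q => ∫ x, fourierPair g x q.1 q.2 * R n q x
  let G : ℕ → Space d × Space d → ℂ := fun n q =>
    ∫ x, fourierPair g (x - c n • (q.1 + q.2)) q.1 q.2 * R n q x
  have hFint : ∀ n, Integrable (F n) ν := by
    intro n
    have := integrable_mul_densityMatrix_prod (hc n) (hL n) (ν := ν)
      (b := fun p : Space d × Space d × Space d => fourierPair g p.1 p.2.1 p.2.2)
      (continuous_fourierPair g (by fun_prop) (by fun_prop) (by fun_prop))
      (integrable_decayWeight_prod.const_mul C) (fun x q => hC x q.1 q.2)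
      (s := fun q => c n • (q.1 - q.2)) (t := fun q => -(c n • (q.1 - q.2)))
      (by fun_prop) (by fun_prop)
    exact this.integral_prod_right
  have hGint : ∀ n, Integrable (G n) ν := by
    intro n
    have := integrable_mul_densityMatrix_prod (hc n) (hL n) (ν := ν)
      (b := fun p : Space d × Space d × Space d =>
        fourierPair g (p.1 - c n • (p.2.1 + p.2.2)) p.2.1 p.2.2)
      (continuous_fourierPair g (by fun_prop) (by fun_prop) (by fun_prop))
      (integrable_decayWeight_prod.const_mul C) (fun x q => hC _ q.1 q.2)
      (s := fun q => c n • (q.1 - q.2)) (t := fun q => -(c n • (q.1 - q.2)))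
      (by fun_prop) (by fun_prop)
    exact this.integral_prod_right
  have hdiff : ∀ n q, F n q - G n q = ∫ x, (fourierPair g x q.1 q.2 -
      fourierPair g (x - c n • (q.1 + q.2)) q.1 q.2) * R n q x := by
    intro n q
    have i1 : Integrable fun x => fourierPair g x q.1 q.2 * R n q x :=
      integrable_mul_densityMatrix_shift (hc n) (hL n) (a := fun x => fourierPair g x q.1 q.2)
        (continuous_fourierPair g (by fun_prop) (by fun_prop) (by fun_prop))
        (fun x => hC x q.1 q.2) _ _
    have i2 : Integrable fun x => fourierPair g (x - c n • (q.1 + q.2)) q.1 q.2 * R n q x :=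
      integrable_mul_densityMatrix_shift (hc n) (hL n)
        (a := fun x => fourierPair g (x - c n • (q.1 + q.2)) q.1 q.2)
        (continuous_fourierPair g (by fun_prop) (by fun_prop) (by fun_prop))
        (fun x => hC _ q.1 q.2) _ _
    rw [← integral_sub i1 i2]
    congr 1; ext x
    ring
  have heq : ∀ n, wignerAction (hbar n) (ψ n) g2 -
      ((∫ x, ‖∫ y, partialFourier g x y * ψ n (x + (2 * (Real.pi * hbar n)) • y)‖ ^ 2 : ℝ) : ℂ) =
      ∫ q, (F n q - G n q) ∂ν := by
    intro n
    rw [integral_sub (hFint n) (hGint n),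
      wignerAction_normSq_eq (hc n) (hL n) (hbar_pos n) g g2 hg,
      ← integral_fourierPair_shift_eq (hc n) (hL n) (Real.pi * hbar n) g]
  simp only [heq]
  -- The majorant is independent of `n` because every `ψ n` has mass one.
  have hlim := tendsto_integral_of_dominated_convergence (μ := ν)
    (F := fun n q => F n q - G n q) (f := fun _ => (0 : ℂ))
    (fun q => 2 * (C * (decayWeight q.1 * decayWeight q.2)))
    (fun n => ((hFint n).sub (hGint n)).aestronglyMeasurable)
    ((integrable_decayWeight_prod.const_mul C).const_mul 2)
    (fun n => Eventually.of_forall fun q => ?_) (Eventually.of_forall fun q => ?_)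
  · simpa using hlim
  · rw [hdiff]
    refine (norm_integral_mul_densityMatrix_le (hc n) (hL n)
      (C := 2 * (C * (decayWeight q.1 * decayWeight q.2))) ?_ ?_ _ _).trans ?_
    · have := decayWeight_nonneg q.1
      have := decayWeight_nonneg q.2
      positivity
    · intro x
      refine (norm_sub_le _ _).trans ?_
      linarith [hC x q.1 q.2, hC (x - c n • (q.1 + q.2)) q.1 q.2]
    · rw [h1, mul_one]
  · refine squeeze_zero_norm (a := fun n => L * (|c n| * ‖q.1 + q.2‖)) (fun n => ?_) ?_
    · rw [hdiff]
      refine (norm_integral_mul_densityMatrix_le (hc n) (hL n)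
        (C := L * (|c n| * ‖q.1 + q.2‖)) (by positivity) ?_ _ _).trans ?_
      · intro x
        refine (hLip _ _ _ _).trans ?_
        rw [sub_sub_cancel, norm_smul, Real.norm_eq_abs]
      · rw [h1, mul_one]
    · have h2 : Tendsto c atTop (𝓝 0) := by
        simpa using hbar_lim.const_mul Real.pi
      have h3 := ((h2.abs.mul_const ‖q.1 + q.2‖).const_mul L)
      simpa using h3

/-- A limit of Wigner functions is nonnegative on squares. -/
lemma wigner_limit_normSq_nonneg {hbar : ℕ → ℝ} (hbar_pos : ∀ n, 0 < hbar n)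
    (hbar_lim : Tendsto hbar atTop (𝓝 0)) {ψ : ℕ → Space d → ℂ} (hc : ∀ n, Continuous (ψ n))
    (hL : ∀ n, MemLp (ψ n) 2 volume) (h1 : ∀ n, ∫ x, ‖ψ n x‖ ^ 2 = 1)
    (g g2 : 𝓢(Space d × Space d, ℂ)) (hg : ∀ z, g2 z = g z * conj (g z)) {l : ℂ}
    (hl : Tendsto (fun n => wignerAction (hbar n) (ψ n) g2) atTop (𝓝 l)) :
    0 ≤ l.re ∧ l.im = 0 := by
  have h2 := hl.sub (tendsto_wignerAction_normSq_sub hbar_pos hbar_lim hc hL h1 g g2 hg)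
  simp only [sub_sub_cancel, sub_zero] at h2
  have hre := (Complex.continuous_re.tendsto l).comp h2
  have him := (Complex.continuous_im.tendsto l).comp h2
  simp only [Function.comp_def, Complex.ofReal_re, Complex.ofReal_im] at hre him
  refine ⟨ge_of_tendsto' hre fun n => integral_nonneg fun x => by positivity, ?_⟩
  exact (tendsto_nhds_unique him tendsto_const_nhds)

lemma exists_smooth_cutoff {E : Type*} [NormedAddCommGroup E] [NormedSpace ℝ E]
    [FiniteDimensional ℝ E] {K : Set E} (hK : IsCompact K) :
    ∃ θ : E → ℝ, ContDiff ℝ ∞ θ ∧ HasCompactSupport θ ∧ (∀ x, 0 ≤ θ x) ∧ (∀ x, θ x ≤ 1) ∧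
      ∀ x ∈ K, θ x = 1 := by
  obtain ⟨r, hr⟩ := hK.isBounded.subset_closedBall 0
  let b : ContDiffBump (0 : E) := ⟨max r 1, max r 1 + 1, by positivity, by linarith⟩
  refine ⟨b, b.contDiff, b.hasCompactSupport, fun x => b.nonneg, fun x => b.le_one, fun x hx => ?_⟩
  exact b.one_of_mem_closedBall (Metric.closedBall_subset_closedBall (le_max_left _ _) (hr hx))

/-- A distribution that is nonnegative on squares is nonnegative on nonnegative test functions. -/
lemma nonneg_of_normSq_nonneg {E : Type*} [NormedAddCommGroup E] [NormedSpace ℝ E]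
    [FiniteDimensional ℝ E] (w : 𝓢(E, ℂ) →ₗ[ℂ] ℂ)
    (hw : ∀ g g2 : 𝓢(E, ℂ), (∀ z, g2 z = g z * conj (g z)) → 0 ≤ (w g2).re ∧ (w g2).im = 0)
    {f : E → ℝ} (hf : ContDiff ℝ ∞ f) (hfc : HasCompactSupport f) (hf0 : ∀ z, 0 ≤ f z) :
    0 ≤ (w (realSchwartz f hf hfc)).re ∧ (w (realSchwartz f hf hfc)).im = 0 := by
  obtain ⟨θ, hθ, hθc, -, -, hθ1⟩ := exists_smooth_cutoff (E := E) hfc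
  have hθ2 := hw (realSchwartz θ hθ hθc) (realSchwartz (fun z => θ z * θ z) (hθ.mul hθ)
    (hθc.mul_left)) (fun z => by simp)
  set W := realSchwartz (fun z => θ z * θ z) (hθ.mul hθ) (hθc.mul_left) with hW
  have key : ∀ ε : ℝ, 0 < ε → 0 ≤ (w (realSchwartz f hf hfc)).re + ε * (w W).re ∧
      (w (realSchwartz f hf hfc)).im + ε * (w W).im = 0 := by
    intro ε hε
    -- Adding `ε` keeps the square root smooth where `f` vanishes; `√f` itself need not be. The
    -- cutoff restores compact support, and `f θ² = f` because `θ = 1` on the support of `f`.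
    have hs : ContDiff ℝ ∞ fun z => θ z * √(f z + ε) :=
      hθ.mul ((hf.add contDiff_const).sqrt fun z => by linarith [hf0 z])
    have h := hw (realSchwartz _ hs hθc.mul_right) (realSchwartz f hf hfc + (ε : ℂ) • W) ?_
    · rw [map_add, map_smul] at h
      simpa using h
    · intro z
      have h2 : √(f z + ε) * √(f z + ε) = f z + ε := Real.mul_self_sqrt (by linarith [hf0 z])
      have h3 : f z + ε * (θ z * θ z) = θ z * √(f z + ε) * (θ z * √(f z + ε)) := by
        have h4 : f z * (θ z * θ z) = f z := by
          by_cases hz : z ∈ tsupport f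
          · rw [hθ1 z hz]; ring
          · rw [image_eq_zero_of_notMem_tsupport hz]; ring
        calc _ = f z * (θ z * θ z) + ε * (θ z * θ z) := by rw [h4]
          _ = θ z * θ z * (√(f z + ε) * √(f z + ε)) := by rw [h2]; ring
          _ = _ := by ring
      have h5 := congrArg (fun t : ℝ => (t : ℂ)) h3
      simp only [add_apply, smul_apply, realSchwartz_apply, hW,
        Complex.conj_ofReal, smul_eq_mul]
      push_cast at h5 ⊢
      exact h5
  refine ⟨?_, by have := (key 1 one_pos).2; rw [hθ2.2] at this; simpa using this⟩
  have hlim : Tendsto (fun ε : ℝ => (w (realSchwartz f hf hfc)).re + ε * (w W).re) (𝓝[>] 0)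
      (𝓝 (w (realSchwartz f hf hfc)).re) := by
    have : Continuous fun ε : ℝ => (w (realSchwartz f hf hfc)).re + ε * (w W).re := by fun_prop
    have h := this.tendsto 0
    simp only [zero_mul, add_zero] at h
    exact h.mono_left nhdsWithin_le_nhds
  exact ge_of_tendsto hlim (eventually_nhdsWithin_of_forall fun ε hε => (key ε hε).1)

end Limit

end Semiclassical

/-! ### Velocity moments as Taylor coefficients of the correlation -/

namespace Semiclassical

open scoped FourierTransform LineDeriv

section FourierMoments

variable {d : ℕ}

lemma integral_fourier_eq_apply_zero (f : 𝓢(Space d, ℂ)) : ∫ η, 𝓕 f η = f 0 := by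
  conv_rhs => rw [← FourierTransform.fourierInv_fourier_eq (F := 𝓢(Space d, ℂ)) f]
  rw [SchwartzMap.fourierInv_coe, Real.fourierInv_eq']
  simp

/-- Fourier inversion at the origin: a first moment of `𝓕 f` is a first derivative of `f` at `0`.
Applied to `p χ`, it only sees `p`, as `χ = 1` near `0`. -/
lemma integral_inner_mul_fourier (f : 𝓢(Space d, ℂ)) (m : Space d) :
    (2 * Real.pi * Complex.I) * ∫ η, ((inner ℝ η m : ℝ) : ℂ) * 𝓕 f η = (∂_{m} f) 0 := by
  rw [← integral_fourier_eq_apply_zero, SchwartzMap.fourier_lineDerivOp_eq, ← integral_const_mul]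
  congr 1; ext η
  rw [smul_apply, SchwartzMap.smulLeftCLM_apply_apply
    (Function.hasTemperateGrowth_inner_left m), Complex.real_smul, smul_eq_mul]

lemma integral_inner_mul_inner_mul_fourier (f : 𝓢(Space d, ℂ)) (m m' : Space d) :
    (2 * Real.pi * Complex.I) ^ 2 *
      ∫ η, ((inner ℝ η m * inner ℝ η m' : ℝ) : ℂ) * 𝓕 f η = (∂_{m} (∂_{m'} f)) 0 := by
  rw [← integral_inner_mul_fourier, SchwartzMap.fourier_lineDerivOp_eq, ← integral_const_mul,
    ← integral_const_mul]
  congr 1; ext η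
  rw [smul_apply, SchwartzMap.smulLeftCLM_apply_apply
    (Function.hasTemperateGrowth_inner_left m'), Complex.real_smul, smul_eq_mul]
  push_cast
  ring

/-- A kernel integrated against a rescaled function with a Taylor expansion of order `r`. -/
lemma tendsto_integral_kernel_rescaled (K : 𝓢(Space d, ℂ)) (r : ℕ) {H Q : Space d → ℂ}
    (hH : Continuous H) {C : ℝ} (hC : ∀ s, ‖H s‖ ≤ C * ‖s‖ ^ r)
    (hQ : ∀ s, Tendsto (fun n : ℕ => (((n : ℝ) + 1 : ℝ) : ℂ) ^ r * H (((n : ℝ) + 1)⁻¹ • s)) atTop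
      (𝓝 (Q s))) (c : ℝ) :
    Tendsto (fun n : ℕ => (((n : ℝ) + 1 : ℝ) : ℂ) ^ r *
      ∫ η, K η * H (((n : ℝ) + 1)⁻¹ • c • η)) atTop (𝓝 (∫ η, K η * Q (c • η))) := by
  simp only [← integral_const_mul]
  refine tendsto_integral_of_dominated_convergence
    (fun η => (C * |c| ^ r) * (‖η‖ ^ r * ‖K η‖)) (fun n => ?_)
    ((K.integrable_pow_mul volume r).const_mul _) (fun n => Eventually.of_forall fun η => ?_)
    (Eventually.of_forall fun η => ?_)
  · have := K.continuous
    exact Continuous.aestronglyMeasurable (by fun_prop)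
  · have hn : (0 : ℝ) < (n : ℝ) + 1 := by positivity
    rw [norm_mul, norm_mul, norm_pow, Complex.norm_real, Real.norm_of_nonneg hn.le]
    have h := hC (((n : ℝ) + 1)⁻¹ • c • η)
    rw [norm_smul, norm_smul, Real.norm_of_nonneg (inv_nonneg.2 hn.le), Real.norm_eq_abs] at h
    calc ((n : ℝ) + 1) ^ r * (‖K η‖ * ‖H (((n : ℝ) + 1)⁻¹ • c • η)‖)
        ≤ ((n : ℝ) + 1) ^ r * (‖K η‖ * (C * (((n : ℝ) + 1)⁻¹ * (|c| * ‖η‖)) ^ r)) := by gcongr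
      _ = (((n : ℝ) + 1) * ((n : ℝ) + 1)⁻¹) ^ r * ((C * |c| ^ r) * (‖η‖ ^ r * ‖K η‖)) := by
        simp only [mul_pow]; ring
      _ = _ := by rw [mul_inv_cancel₀ hn.ne', one_pow, one_mul]
  · have h := (hQ (c • η)).const_mul (K η)
    refine h.congr fun n => ?_
    ring

/-- The profile `p χ` of the cutoff polynomial weights. -/
noncomputable def cutoffProfile {p χ : Space d → ℝ} (hp : ContDiff ℝ ∞ p) (hχ : ContDiff ℝ ∞ χ)
    (hχc : HasCompactSupport χ) : 𝓢(Space d, ℂ) :=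
  realSchwartz (fun v => p v * χ v) (hp.mul hχ) hχc.mul_left

lemma partialFourier_cutoffTest {p φ χ : Space d → ℝ} (hp : ContDiff ℝ ∞ p)
    (hφ : ContDiff ℝ ∞ φ) (hφc : HasCompactSupport φ)
    (hχ : ContDiff ℝ ∞ χ) (hχc : HasCompactSupport χ) {r : ℕ}
    (hr : ∀ (t : ℝ) v, p (t • v) = t ^ r * p v) (n : ℕ) (x η : Space d) :
    partialFourier (cutoffTest hp hφ hφc hχ hχc n) x η =
      (φ x : ℂ) * ((((n : ℝ) + 1 : ℝ) : ℂ) ^ r * (((n : ℝ) + 1 : ℝ) : ℂ) ^ d *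
        𝓕 (cutoffProfile hp hχ hχc) (((n : ℝ) + 1) • η)) := by
  set k : ℝ := (n : ℝ) + 1 with hk
  have hk0 : 0 < k := by positivity
  rw [partialFourier, SchwartzMap.fourier_coe, SchwartzMap.fourier_coe, Real.fourier_eq',
    Real.fourier_eq']
  let u : Space d → ℂ := fun v => Complex.exp (↑(-2 * Real.pi * inner ℝ v (k • η)) * Complex.I) •
    cutoffProfile hp hχ hχc v
  have h1 := Measure.integral_comp_smul volume u k⁻¹
  have h2 : |(k⁻¹ ^ Module.finrank ℝ (Space d))⁻¹| = k ^ d := by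
    rw [finrank_euclideanSpace, Fintype.card_fin, inv_pow, inv_inv, abs_of_pos (by positivity)]
  rw [h2] at h1
  change _ = (φ x : ℂ) * ((k : ℂ) ^ r * (k : ℂ) ^ d * ∫ v, u v)
  have h3 : (k : ℂ) ^ d * ∫ v, u v = ∫ v, u (k⁻¹ • v) := by
    rw [h1, Complex.real_smul]; push_cast; rfl
  rw [mul_assoc ((k : ℂ) ^ r), h3, ← mul_assoc, ← integral_const_mul]
  congr 1; ext v
  have h4 : p v = k ^ r * p (k⁻¹ • v) := by
    rw [hr, inv_pow, ← mul_assoc, mul_inv_cancel₀ (by positivity), one_mul]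
  have h5 : slice (cutoffTest hp hφ hφc hχ hχc n) x v =
      ((φ x * p v * χ (k⁻¹ • v) : ℝ) : ℂ) := rfl
  have h6 : (inner ℝ (k⁻¹ • v) (k • η) : ℝ) = inner ℝ v η := by
    rw [inner_smul_left, inner_smul_right]
    simp only [conj_trivial]
    field_simp
  simp only [u, h6, smul_eq_mul, cutoffProfile, realSchwartz_apply]
  rw [h5, h4]
  push_cast
  ring

/-- For `p` homogeneous of degree `r`, the change of variable `η ↦ (n + 1)η` moves the cutoff scale
into the shift and leaves a factor `(n + 1)^r`. Removing the cutoff thus extracts the order `r`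
behaviour of the correlation at zero shift. -/
lemma wignerAction_cutoffTest {ψ : Space d → ℂ} (hc : Continuous ψ) (hL : MemLp ψ 2 volume)
    {h : ℝ} (hh : 0 < h) {p φ χ : Space d → ℝ} (hp : ContDiff ℝ ∞ p)
    (hφ : ContDiff ℝ ∞ φ) (hφc : HasCompactSupport φ)
    (hχ : ContDiff ℝ ∞ χ) (hχc : HasCompactSupport χ) {r : ℕ}
    (hr : ∀ (t : ℝ) v, p (t • v) = t ^ r * p v) (n : ℕ) :
    wignerAction h ψ (cutoffTest hp hφ hφc hχ hχc n) =
      (((n : ℝ) + 1 : ℝ) : ℂ) ^ r * ∫ η, 𝓕 (cutoffProfile hp hχ hχc) η *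
        correlation ψ (fun x => (φ x : ℂ)) (((n : ℝ) + 1)⁻¹ • (Real.pi * h) • η) := by
  rw [wignerAction_eq_integral_correlation hc hL hh]
  simp only [partialFourier_cutoffTest hp hφ hφc hχ hχc hr]
  set k : ℝ := (n : ℝ) + 1 with hk
  have hk0 : 0 < k := by positivity
  let u : Space d → ℂ := fun η => 𝓕 (cutoffProfile hp hχ hχc) η *
        correlation ψ (fun x => (φ x : ℂ)) (k⁻¹ • (Real.pi * h) • η)
  have h1 := Measure.integral_comp_smul volume u k
  have h2 : |(k ^ Module.finrank ℝ (Space d))⁻¹| = (k ^ d)⁻¹ := by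
    rw [finrank_euclideanSpace, Fintype.card_fin, abs_of_pos (by positivity)]
  rw [h2] at h1
  have h3 : ∫ η, u η = (k : ℂ) ^ d * ∫ η, u (k • η) := by
    rw [h1, Complex.real_smul, ← mul_assoc]
    push_cast
    rw [mul_inv_cancel₀ (by exact_mod_cast (by positivity : k ^ d ≠ 0)), one_mul]
  change _ = (k : ℂ) ^ r * ∫ η, u η
  rw [h3, ← mul_assoc, ← integral_const_mul]
  congr 1; ext η
  have h4 : k⁻¹ • (Real.pi * h) • k • η = (Real.pi * h) • η := by
    rw [smul_smul, smul_smul]; congr 1; field_simp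
  simp only [u, h4, correlation]
  rw [← integral_const_mul, ← integral_const_mul]
  congr 1; ext x
  ring

end FourierMoments

/-! ### Difference quotients of `C¹` functions -/

section Expansion

variable {d : ℕ}

lemma exists_local_lipschitz {F : Type*} [NormedAddCommGroup F] [NormedSpace ℝ F]
    {f : Space d → F} (hf : ContDiff ℝ 1 f) (R S : ℝ) :
    ∃ L, 0 ≤ L ∧ ∀ x, ‖x‖ ≤ R → ∀ s, ‖s‖ ≤ S → ‖f (x + s) - f x‖ ≤ L * ‖s‖ := by
  have hcont : Continuous fun x => fderiv ℝ f x := hf.continuous_fderiv one_ne_zero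
  obtain ⟨L, hL⟩ := (isCompact_closedBall (0 : Space d) (R + S)).exists_bound_of_continuousOn
    hcont.continuousOn
  refine ⟨max L 0, le_max_right _ _, fun x hx s hs => ?_⟩
  have h := (convex_closedBall (0 : Space d) (R + S)).norm_image_sub_le_of_norm_fderiv_le
    (f := f) (C := max L 0) (𝕜 := ℝ) (x := x) (y := x + s)
    (fun z _ => hf.differentiable one_ne_zero z) (fun z hz => (hL z hz).trans (le_max_left _ _))
    (by rw [mem_closedBall_zero_iff]; linarith [norm_nonneg s])
    (by rw [mem_closedBall_zero_iff]; linarith [norm_add_le x s])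
  simpa using h

lemma exists_rescaled_difference_bound {F : Type*} [NormedAddCommGroup F] [NormedSpace ℝ F]
    {f : Space d → F} (hf : ContDiff ℝ 1 f) (R : ℝ) (s : Space d) :
    ∃ C, 0 ≤ C ∧ ∀ (n : ℕ) x, ‖x‖ ≤ R →
      ‖((n : ℝ) + 1) • (f (x + ((n : ℝ) + 1)⁻¹ • s) - f x)‖ ≤ C := by
  obtain ⟨L, hL0, hL⟩ := exists_local_lipschitz hf R ‖s‖
  refine ⟨L * ‖s‖, by positivity, fun n x hx => ?_⟩
  have hn : (0 : ℝ) < (n : ℝ) + 1 := by positivity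
  have h1 : ‖((n : ℝ) + 1)⁻¹ • s‖ = ((n : ℝ) + 1)⁻¹ * ‖s‖ := by
    rw [norm_smul, Real.norm_of_nonneg (inv_nonneg.2 hn.le)]
  have h2 : ((n : ℝ) + 1)⁻¹ ≤ 1 := inv_le_one_of_one_le₀ (by linarith [n.cast_nonneg (α := ℝ)])
  have h := hL x hx (((n : ℝ) + 1)⁻¹ • s)
    (by rw [h1]; exact mul_le_of_le_one_left (norm_nonneg s) h2)
  rw [norm_smul, Real.norm_of_nonneg hn.le]
  calc _ ≤ ((n : ℝ) + 1) * (L * ‖((n : ℝ) + 1)⁻¹ • s‖) := by gcongr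
    _ = L * ‖s‖ := by rw [h1]; field_simp

lemma norm_integral_le_of_bounded_support {F : Type*} [NormedAddCommGroup F] [NormedSpace ℝ F]
    {f : Space d → F} {R C : ℝ} (hC : ∀ x, ‖x‖ ≤ R → ‖f x‖ ≤ C) (h0 : ∀ x, R < ‖x‖ → f x = 0) :
    ‖∫ x, f x‖ ≤ C * volume.real (Metric.closedBall (0 : Space d) R) := by
  rw [← setIntegral_eq_integral_of_forall_compl_eq_zero (s := Metric.closedBall 0 R)
    (fun x hx => h0 x (by simpa using hx))]
  exact norm_setIntegral_le_of_norm_le_const (isCompact_closedBall _ _).measure_lt_top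
    (fun x hx => hC x (by simpa using hx))

lemma tendsto_rescaled_difference {F : Type*} [NormedAddCommGroup F] [NormedSpace ℝ F]
    {f : Space d → F} (hf : ContDiff ℝ 1 f) (x s : Space d) :
    Tendsto (fun n : ℕ => ((n : ℝ) + 1) • (f (x + ((n : ℝ) + 1)⁻¹ • s) - f x)) atTop
      (𝓝 (fderiv ℝ f x s)) := by
  have h := (hf.differentiable one_ne_zero x).hasFDerivAt
  refine h.lim s (c := fun n : ℕ => (n : ℝ) + 1) (l := atTop) ?_
  exact tendsto_norm_atTop_atTop.comp
    (tendsto_atTop_add_const_right _ 1 tendsto_natCast_atTop_atTop)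

lemma tendsto_integral_of_bounded_support {F : Type*} [NormedAddCommGroup F] [NormedSpace ℝ F]
    {f : ℕ → Space d → F} {g : Space d → F} (hf : ∀ n, Continuous (f n)) {R C : ℝ}
    (hC : ∀ n x, ‖x‖ ≤ R → ‖f n x‖ ≤ C) (h0 : ∀ n x, R < ‖x‖ → f n x = 0)
    (hlim : ∀ x, Tendsto (fun n => f n x) atTop (𝓝 (g x))) :
    Tendsto (fun n => ∫ x, f n x) atTop (𝓝 (∫ x, g x)) := by
  refine tendsto_integral_of_dominated_convergence
    ((Metric.closedBall (0 : Space d) R).indicator fun _ => C)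
    (fun n => (hf n).aestronglyMeasurable) ?_ (fun n => Eventually.of_forall fun x => ?_)
    (Eventually.of_forall hlim)
  · exact (integrable_indicator_iff measurableSet_closedBall).2
      (integrableOn_const (isCompact_closedBall _ _).measure_lt_top.ne)
  · by_cases hx : ‖x‖ ≤ R
    · rw [Set.indicator_of_mem (by simpa using hx)]
      exact hC n x hx
    · rw [h0 n x (not_le.1 hx), norm_zero, Set.indicator_of_notMem (by simpa using hx)]

end Expansion

end Semiclassical

/-! ### First-order expansion of the correlation -/

namespace Semiclassical

section CorrelationExpansion

variable {d : ℕ} {ψ : Space d → ℂ} {φ : Space d → ℝ}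

lemma exists_support_radius {F : Type*} [Zero F] {φ : Space d → F} (hφc : HasCompactSupport φ) :
    ∃ R, 0 ≤ R ∧ ∀ x, R < ‖x‖ → φ x = 0 := by
  obtain ⟨r, hr⟩ := hφc.isCompact.isBounded.subset_closedBall 0
  refine ⟨max r 0, le_max_right _ _, fun x hx => ?_⟩
  apply image_eq_zero_of_notMem_tsupport
  intro h
  have := hr h
  rw [mem_closedBall_zero_iff] at this
  exact absurd (this.trans (le_max_left _ _)) (not_le.2 hx)

lemma exists_bound_on_ball {F : Type*} [NormedAddCommGroup F] {f : Space d → F}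
    (hf : Continuous f) (R : ℝ) : ∃ B, 0 ≤ B ∧ ∀ x, ‖x‖ ≤ R → ‖f x‖ ≤ B := by
  obtain ⟨B, hB⟩ := (isCompact_closedBall (0 : Space d) R).exists_bound_of_continuousOn
    hf.continuousOn
  exact ⟨max B 0, le_max_right _ _, fun x hx => (hB x (by simpa using hx)).trans (le_max_left _ _)⟩

lemma exists_bound_of_compactSupport {F : Type*} [NormedAddCommGroup F] {f : Space d → F}
    (hf : Continuous f) (hfc : HasCompactSupport f) : ∃ B, 0 ≤ B ∧ ∀ x, ‖f x‖ ≤ B := by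
  obtain ⟨B, hB⟩ := hfc.exists_bound_of_continuous hf
  exact ⟨max B 0, le_max_right _ _, fun x => (hB x).trans (le_max_left _ _)⟩

lemma continuous_correlation (hc : Continuous ψ) (hφ : Continuous φ) (hφc : HasCompactSupport φ) :
    Continuous (correlation ψ fun x => (φ x : ℂ)) := by
  have h : correlation ψ (fun x => (φ x : ℂ)) = fun s => ∫ x in tsupport φ,
      (φ x : ℂ) * densityMatrix ψ (x + s) (x - s) := by
    ext s
    rw [correlation, setIntegral_eq_integral_of_forall_compl_eq_zero]
    intro x hx
    rw [image_eq_zero_of_notMem_tsupport hx]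
    simp
  rw [h]
  refine continuous_parametric_integral_of_continuous ?_ hφc
  exact (Complex.continuous_ofReal.comp (hφ.comp continuous_snd)).mul
    (continuous_densityMatrix_comp hc (by fun_prop) (by fun_prop))

lemma correlation_zero : correlation ψ (fun x => (φ x : ℂ)) 0 =
    ((∫ x, φ x * ‖ψ x‖ ^ 2 : ℝ) : ℂ) := by
  rw [correlation, ← integral_complex_ofReal]
  congr 1; ext x
  simp only [add_zero, sub_zero, densityMatrix, RCLike.mul_conj]
  push_cast
  rfl

lemma integrable_mul_densityMatrix (hc : Continuous ψ) (hL : MemLp ψ 2 volume)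
    (hφ : Continuous φ) (hφc : HasCompactSupport φ) (s t : Space d) :
    Integrable fun x => (φ x : ℂ) * densityMatrix ψ (x + s) (x + t) := by
  obtain ⟨B, -, hB⟩ := exists_bound_of_compactSupport hφ hφc
  exact integrable_mul_densityMatrix_shift hc hL (Complex.continuous_ofReal.comp hφ)
    (fun x => by simpa using hB x) s t

/-- The difference is telescoped so that each term contains one increment of `ψ`; one derivative of
`ψ` then suffices. -/
lemma correlation_sub_zero (hc : Continuous ψ) (hL : MemLp ψ 2 volume)
    (hφ : Continuous φ) (hφc : HasCompactSupport φ) (s : Space d) :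
    correlation ψ (fun x => (φ x : ℂ)) s - correlation ψ (fun x => (φ x : ℂ)) 0 =
      ∫ x, (φ x : ℂ) * ((ψ (x + s) - ψ x) * conj (ψ (x + -s)) +
        ψ x * conj (ψ (x + -s) - ψ x)) := by
  have h1 := integrable_mul_densityMatrix hc hL hφ hφc s (-s)
  have h2 := integrable_mul_densityMatrix hc hL hφ hφc 0 0
  simp only [correlation, sub_eq_add_neg (_ : Space d), neg_zero]
  rw [← integral_sub h1 h2]
  congr 1; ext x
  simp only [densityMatrix, add_zero, map_sub]
  ring

/-- The bound must hold for all `s`, since the Fourier kernel it is integrated against is not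
compactly supported. It is local Lipschitz continuity for `‖s‖ ≤ 1` and the global bound of the
correlation for `‖s‖ ≥ 1`. -/
lemma exists_correlation_sub_zero_le (hψ : ContDiff ℝ 1 ψ) (hL : MemLp ψ 2 volume)
    (hφ : Continuous φ) (hφc : HasCompactSupport φ) :
    ∃ C, 0 ≤ C ∧ ∀ s, ‖correlation ψ (fun x => (φ x : ℂ)) s -
      correlation ψ (fun x => (φ x : ℂ)) 0‖ ≤ C * ‖s‖ := by
  obtain ⟨R, hR0, hR⟩ := exists_support_radius hφc
  obtain ⟨B, hB0, hB⟩ := exists_bound_of_compactSupport hφ hφc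
  obtain ⟨L, hL0, hLip⟩ := exists_local_lipschitz hψ R 1
  obtain ⟨M, hM0, hM⟩ := exists_bound_on_ball hψ.continuous (R + 1)
  set N := ∫ x, ‖ψ x‖ ^ 2
  have hN : 0 ≤ N := integral_nonneg fun x => by positivity
  set V := volume.real (Metric.closedBall (0 : Space d) R)
  have hV : 0 ≤ V := measureReal_nonneg
  refine ⟨B * (L * M + M * L) * V + 2 * (B * N), by positivity, fun s => ?_⟩
  rcases le_total ‖s‖ 1 with hs | hs
  · rw [correlation_sub_zero hψ.continuous hL hφ hφc]
    have h := norm_integral_le_of_bounded_support (R := R) (C := B * (L * M + M * L) * ‖s‖)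
      (f := fun x => (φ x : ℂ) * ((ψ (x + s) - ψ x) * conj (ψ (x + -s)) +
        ψ x * conj (ψ (x + -s) - ψ x))) ?_ ?_
    · refine h.trans ?_
      have : 0 ≤ 2 * (B * N) * ‖s‖ := by positivity
      nlinarith
    · intro x hx
      have h1 := hLip x hx s hs
      have h2 := hLip x hx (-s) (by simpa using hs)
      rw [norm_neg] at h2
      have h3 := hM x (by linarith)
      have h4 := hM (x + -s) ((norm_add_le _ _).trans (by rw [norm_neg]; linarith))
      calc _ ≤ ‖(φ x : ℂ)‖ * (‖ψ (x + s) - ψ x‖ * ‖ψ (x + -s)‖ +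
            ‖ψ x‖ * ‖ψ (x + -s) - ψ x‖) := by
            rw [norm_mul]
            gcongr
            refine (norm_add_le _ _).trans ?_
            rw [norm_mul, norm_mul, RCLike.norm_conj, RCLike.norm_conj]
        _ ≤ B * (L * ‖s‖ * M + M * (L * ‖s‖)) := by
            have h5 : ‖(φ x : ℂ)‖ ≤ B := by simpa using hB x
            gcongr
        _ = _ := by ring
    · intro x hx
      simp [hR x hx]
  · have h1 : ∀ t, ‖correlation ψ (fun x => (φ x : ℂ)) t‖ ≤ B * N := fun t =>
      norm_correlation_le hψ.continuous hL hB0 (fun x => by simpa using hB x) t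
    calc _ ≤ B * N + B * N := (norm_sub_le _ _).trans (add_le_add (h1 s) (h1 0))
      _ = 2 * (B * N) * 1 := by ring
      _ ≤ 2 * (B * N) * ‖s‖ := by gcongr
      _ ≤ _ := by
        gcongr
        have : 0 ≤ B * (L * M + M * L) * V := by positivity
        linarith

lemma norm_inv_smul_le (n : ℕ) (s : Space d) : ‖((n : ℝ) + 1)⁻¹ • s‖ ≤ ‖s‖ := by
  have hn : (0 : ℝ) < (n : ℝ) + 1 := by positivity
  rw [norm_smul, Real.norm_of_nonneg (inv_nonneg.2 hn.le)]
  exact mul_le_of_le_one_left (norm_nonneg s)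
    (inv_le_one_of_one_le₀ (by linarith [n.cast_nonneg (α := ℝ)]))

lemma tendsto_inv_smul (s : Space d) :
    Tendsto (fun n : ℕ => ((n : ℝ) + 1)⁻¹ • s) atTop (𝓝 0) := by
  have h : Tendsto (fun n : ℕ => ((n : ℝ) + 1)⁻¹) atTop (𝓝 0) :=
    tendsto_inv_atTop_zero.comp (tendsto_atTop_add_const_right _ 1 tendsto_natCast_atTop_atTop)
  simpa using h.smul_const s

/-- First-order expansion of the correlation function. -/
lemma tendsto_rescaled_correlation (hψ : ContDiff ℝ 1 ψ) (hL : MemLp ψ 2 volume)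
    (hφ : Continuous φ) (hφc : HasCompactSupport φ) (s : Space d) :
    Tendsto (fun n : ℕ => (((n : ℝ) + 1 : ℝ) : ℂ) ^ 1 *
      (correlation ψ (fun x => (φ x : ℂ)) (((n : ℝ) + 1)⁻¹ • s) -
        correlation ψ (fun x => (φ x : ℂ)) 0)) atTop
      (𝓝 (∫ x, (φ x : ℂ) * (fderiv ℝ ψ x s * conj (ψ x) - ψ x * conj (fderiv ℝ ψ x s)))) := by
  obtain ⟨R, hR0, hR⟩ := exists_support_radius hφc
  obtain ⟨B, hB0, hB⟩ := exists_bound_of_compactSupport hφ hφc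
  obtain ⟨C1, hC10, hC1⟩ := exists_rescaled_difference_bound hψ R s
  obtain ⟨C2, hC20, hC2⟩ := exists_rescaled_difference_bound hψ R (-s)
  obtain ⟨M, hM0, hM⟩ := exists_bound_on_ball hψ.continuous (R + ‖s‖)
  have hc := hψ.continuous
  let D : ℕ → Space d → Space d → ℂ := fun n t x =>
    ((n : ℝ) + 1) • (ψ (x + ((n : ℝ) + 1)⁻¹ • t) - ψ x)
  have heq : ∀ n : ℕ, (((n : ℝ) + 1 : ℝ) : ℂ) ^ 1 *
      (correlation ψ (fun x => (φ x : ℂ)) (((n : ℝ) + 1)⁻¹ • s) -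
        correlation ψ (fun x => (φ x : ℂ)) 0) =
      ∫ x, (φ x : ℂ) * (D n s x * conj (ψ (x + ((n : ℝ) + 1)⁻¹ • -s)) +
        ψ x * conj (D n (-s) x)) := by
    intro n
    rw [correlation_sub_zero hc hL hφ hφc, ← integral_const_mul]
    congr 1; ext x
    simp only [D, Complex.real_smul, map_mul, Complex.conj_ofReal, smul_neg]
    ring
  simp only [heq]
  refine tendsto_integral_of_bounded_support (R := R) (C := B * (C1 * M + M * C2)) (fun n => ?_)
    (fun n x hx => ?_) (fun n x hx => by simp [hR x hx]) (fun x => ?_)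
  · have h1 : Continuous fun z : ℂ => conj z := Complex.continuous_conj
    simp only [D]
    fun_prop
  · have h4 := hM (x + ((n : ℝ) + 1)⁻¹ • -s) ((norm_add_le _ _).trans
      (add_le_add hx ((norm_inv_smul_le n (-s)).trans (norm_neg s).le)))
    have h3 := hM x (by linarith [norm_nonneg s])
    have h5 : ‖(φ x : ℂ)‖ ≤ B := by simpa using hB x
    have h6 := hC1 n x hx
    have h7 := hC2 n x hx
    rw [norm_mul]
    refine mul_le_mul h5 ((norm_add_le _ _).trans ?_) (norm_nonneg _) hB0
    rw [norm_mul, norm_mul, RCLike.norm_conj, RCLike.norm_conj]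
    gcongr
  · have h1 := tendsto_rescaled_difference hψ x s
    have h2 := tendsto_rescaled_difference hψ x (-s)
    have h3 : Tendsto (fun n : ℕ => ψ (x + ((n : ℝ) + 1)⁻¹ • -s)) atTop (𝓝 (ψ x)) := by
      have := (hc.tendsto (x + 0)).comp ((tendsto_inv_smul (-s)).const_add x)
      simpa [Function.comp_def] using this
    have h4 := (h1.mul ((Complex.continuous_conj.tendsto _).comp h3)).add
      (((Complex.continuous_conj.tendsto _).comp h2).const_mul (ψ x))
    have h5 := h4.const_mul (φ x : ℂ)
    rw [map_neg, map_neg, mul_neg, ← sub_eq_add_neg] at h5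
    exact h5

end CorrelationExpansion

end Semiclassical

/-! ### Second-order expansion of the even part -/

namespace Semiclassical

section SecondOrder

variable {d : ℕ} {ψ : Space d → ℂ} {φ : Space d → ℝ}

lemma continuous_compactSupport_mul_integrable {f g : Space d → ℝ} (hf : Continuous f)
    (hfc : HasCompactSupport f) (hg : Continuous g) : Integrable fun x => f x * g x :=
  (hf.mul hg).integrable_of_hasCompactSupport hfc.mul_right

/-- Discrete integration by parts for second differences. -/
lemma integral_second_difference {f g : Space d → ℝ} (hf : Continuous f)
    (hfc : HasCompactSupport f) (hg : Continuous g) (s : Space d) :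
    ∫ x, f x * (g (x + s) + g (x - s) - 2 * g x) =
      -∫ x, (f (x + s) - f x) * (g (x + s) - g x) := by
  have i1 : Integrable fun x => f x * g (x + s) :=
    continuous_compactSupport_mul_integrable hf hfc (by fun_prop)
  have i2 : Integrable fun x => f x * g (x - s) :=
    continuous_compactSupport_mul_integrable hf hfc (by fun_prop)
  have i3 : Integrable fun x => f x * g x :=
    continuous_compactSupport_mul_integrable hf hfc (by fun_prop)
  have i4 : Integrable fun x => f (x + s) * g (x + s) := i3.comp_add_right s
  have i5 : Integrable fun x => f (x + s) * g x := by
    simpa using i2.comp_add_right s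
  have e4 : ∫ x, f (x + s) * g (x + s) = ∫ x, f x * g x :=
    integral_add_right_eq_self (fun x => f x * g x) s
  have e5 : ∫ x, f (x + s) * g x = ∫ x, f x * g (x - s) := by
    rw [← integral_add_right_eq_self (fun x => f x * g (x - s)) s]
    simp
  have h1 : ∫ x, f x * (g (x + s) + g (x - s) - 2 * g x) =
      ((∫ x, f x * g (x + s)) + ∫ x, f x * g (x - s)) - 2 * ∫ x, f x * g x := by
    have i12 : Integrable fun x => f x * g (x + s) + f x * g (x - s) := i1.add i2
    rw [← integral_add i1 i2, ← integral_const_mul, ← integral_sub i12 (i3.const_mul 2)]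
    congr 1; ext x; ring
  have h2 : ∫ x, (f (x + s) - f x) * (g (x + s) - g x) =
      ((∫ x, f (x + s) * g (x + s)) - ∫ x, f (x + s) * g x) -
        ((∫ x, f x * g (x + s)) - ∫ x, f x * g x) := by
    have i45 : Integrable fun x => f (x + s) * g (x + s) - f (x + s) * g x := i4.sub i5
    have i13 : Integrable fun x => f x * g (x + s) - f x * g x := i1.sub i3
    rw [← integral_sub i4 i5, ← integral_sub i1 i3, ← integral_sub i45 i13]
    congr 1; ext x; ring
  rw [h1, h2, e4, e5]
  ring

/-- The even part of the correlation function, minus its value at the origin. -/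
lemma correlation_even_part (hc : Continuous ψ) (hL : MemLp ψ 2 volume)
    (hφ : Continuous φ) (hφc : HasCompactSupport φ) (s : Space d) :
    (correlation ψ (fun x => (φ x : ℂ)) s + correlation ψ (fun x => (φ x : ℂ)) (-s)) / 2 -
      correlation ψ (fun x => (φ x : ℂ)) 0 =
      (((-(∫ x, (φ (x + s) - φ x) * (‖ψ (x + s)‖ ^ 2 - ‖ψ x‖ ^ 2)) -
        ∫ x, φ x * ‖ψ (x + s) - ψ (x - s)‖ ^ 2) / 2 : ℝ) : ℂ) := by
  have hpt : ∀ a b : ℂ, a * conj b + b * conj a =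
      ((‖a‖ ^ 2 + ‖b‖ ^ 2 - ‖a - b‖ ^ 2 : ℝ) : ℂ) := by
    intro a b
    have h1 : ∀ z : ℂ, ((‖z‖ ^ 2 : ℝ) : ℂ) = z * conj z := fun z => by
      rw [RCLike.mul_conj]; push_cast; rfl
    rw [Complex.ofReal_sub, Complex.ofReal_add, h1, h1, h1, map_sub]
    ring
  have i1 := integrable_mul_densityMatrix hc hL hφ hφc s (-s)
  have i2 := integrable_mul_densityMatrix hc hL hφ hφc (-s) s
  have h1 : correlation ψ (fun x => (φ x : ℂ)) s + correlation ψ (fun x => (φ x : ℂ)) (-s) =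
      ((∫ x, φ x * (‖ψ (x + s)‖ ^ 2 + ‖ψ (x - s)‖ ^ 2 - ‖ψ (x + s) - ψ (x - s)‖ ^ 2) : ℝ) : ℂ) := by
    simp only [correlation, sub_eq_add_neg (_ : Space d), neg_neg]
    rw [← integral_add i1 i2, ← integral_complex_ofReal]
    congr 1; ext x
    rw [← mul_add, densityMatrix, densityMatrix, hpt]
    push_cast
    ring
  have j1 : Integrable fun x => φ x * (‖ψ (x + s)‖ ^ 2 + ‖ψ (x - s)‖ ^ 2 - 2 * ‖ψ x‖ ^ 2) :=
    continuous_compactSupport_mul_integrable hφ hφc (by fun_prop)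
  have j2 : Integrable fun x => φ x * ‖ψ (x + s) - ψ (x - s)‖ ^ 2 :=
    continuous_compactSupport_mul_integrable hφ hφc (by fun_prop)
  have j3 : Integrable fun x => φ x * ‖ψ x‖ ^ 2 :=
    continuous_compactSupport_mul_integrable hφ hφc (by fun_prop)
  have h2 : ∫ x, φ x * (‖ψ (x + s)‖ ^ 2 + ‖ψ (x - s)‖ ^ 2 - ‖ψ (x + s) - ψ (x - s)‖ ^ 2) =
      (∫ x, φ x * (‖ψ (x + s)‖ ^ 2 + ‖ψ (x - s)‖ ^ 2 - 2 * ‖ψ x‖ ^ 2)) -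
        (∫ x, φ x * ‖ψ (x + s) - ψ (x - s)‖ ^ 2) + 2 * ∫ x, φ x * ‖ψ x‖ ^ 2 := by
    have j12 : Integrable fun x => φ x * (‖ψ (x + s)‖ ^ 2 + ‖ψ (x - s)‖ ^ 2 - 2 * ‖ψ x‖ ^ 2) -
      φ x * ‖ψ (x + s) - ψ (x - s)‖ ^ 2 := j1.sub j2
    rw [← integral_const_mul, ← integral_sub j1 j2, ← integral_add j12 (j3.const_mul 2)]
    congr 1; ext x; ring
  rw [h1, correlation_zero, h2,
    integral_second_difference hφ hφc (g := fun x => ‖ψ x‖ ^ 2) (by fun_prop)]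
  push_cast
  ring

lemma contDiff_norm_sq (hψ : ContDiff ℝ 1 ψ) : ContDiff ℝ 1 fun x => ‖ψ x‖ ^ 2 := hψ.norm_sq ℝ

/-- After discrete integration by parts every term is a product of two first differences, so `C¹`
regularity gives a quadratic bound near `0`. For `‖s‖ ≥ 1` boundedness of the correlation is enough.
-/
lemma exists_correlation_even_part_le (hψ : ContDiff ℝ 1 ψ) (hL : MemLp ψ 2 volume)
    (hφ : ContDiff ℝ 1 φ) (hφc : HasCompactSupport φ) :
    ∃ C, ∀ s, ‖(correlation ψ (fun x => (φ x : ℂ)) s +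
      correlation ψ (fun x => (φ x : ℂ)) (-s)) / 2 -
      correlation ψ (fun x => (φ x : ℂ)) 0‖ ≤ C * ‖s‖ ^ 2 := by
  obtain ⟨R, hR0, hR⟩ := exists_support_radius hφc
  obtain ⟨B, hB0, hB⟩ := exists_bound_of_compactSupport hφ.continuous hφc
  obtain ⟨L, hL0, hLip⟩ := exists_local_lipschitz hψ R 1
  -- The radius `R + 1` is needed because `φ(x + s) - φ(x)` can be nonzero up to distance `‖s‖ ≤ 1`
  -- outside the support ball of `φ`.
  obtain ⟨L1, hL10, hLip1⟩ := exists_local_lipschitz hφ (R + 1) 1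
  obtain ⟨L2, hL20, hLip2⟩ := exists_local_lipschitz (contDiff_norm_sq hψ) (R + 1) 1
  set N := ∫ x, ‖ψ x‖ ^ 2
  have hN : 0 ≤ N := integral_nonneg fun x => by positivity
  set V1 := volume.real (Metric.closedBall (0 : Space d) (R + 1))
  have hV1 : 0 ≤ V1 := measureReal_nonneg
  set V := volume.real (Metric.closedBall (0 : Space d) R)
  have hV : 0 ≤ V := measureReal_nonneg
  refine ⟨L1 * L2 * V1 + B * (2 * L) ^ 2 * V + 2 * (B * N), fun s => ?_⟩
  rcases le_total ‖s‖ 1 with hs | hs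
  · rw [correlation_even_part hψ.continuous hL hφ.continuous hφc, Complex.norm_real]
    have h1 := norm_integral_le_of_bounded_support (R := R + 1) (C := L1 * L2 * ‖s‖ ^ 2)
      (f := fun x => (φ (x + s) - φ x) * (‖ψ (x + s)‖ ^ 2 - ‖ψ x‖ ^ 2)) ?_ ?_
    · have h2 := norm_integral_le_of_bounded_support (R := R) (C := B * (2 * L) ^ 2 * ‖s‖ ^ 2)
        (f := fun x => φ x * ‖ψ (x + s) - ψ (x - s)‖ ^ 2) ?_ ?_
      · set a := ∫ x, (φ (x + s) - φ x) * (‖ψ (x + s)‖ ^ 2 - ‖ψ x‖ ^ 2)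
        set b := ∫ x, φ x * ‖ψ (x + s) - ψ (x - s)‖ ^ 2
        have h3 : 0 ≤ 2 * (B * N) * ‖s‖ ^ 2 := by positivity
        rw [Real.norm_eq_abs] at h1 h2 ⊢
        have h4 : |(-a - b) / 2| ≤ |a| + |b| := by
          rw [abs_div, abs_two]
          have := abs_sub (-a) b
          rw [abs_neg] at this
          have := abs_nonneg a
          have := abs_nonneg b
          linarith
        nlinarith
      · intro x hx
        have e1 := hLip x hx s hs
        have e2 := hLip x hx (-s) (by simpa using hs)
        rw [norm_neg, ← sub_eq_add_neg] at e2
        have e3 : ‖ψ (x + s) - ψ (x - s)‖ ≤ 2 * L * ‖s‖ := by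
          have : ψ (x + s) - ψ (x - s) = (ψ (x + s) - ψ x) - (ψ (x - s) - ψ x) := by ring
          rw [this]
          refine (norm_sub_le _ _).trans ?_
          linarith
        rw [norm_mul, norm_pow, norm_norm]
        calc _ ≤ B * (2 * L * ‖s‖) ^ 2 := by
              gcongr
              exact hB x
          _ = _ := by ring
      · intro x hx
        simp [hR x hx]
    · intro x hx
      rw [norm_mul]
      calc _ ≤ (L1 * ‖s‖) * (L2 * ‖s‖) :=
            mul_le_mul (hLip1 x hx s hs) (hLip2 x hx s hs) (norm_nonneg _) (by positivity)
        _ = _ := by ring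
    · intro x hx
      have h3 : R < ‖x + s‖ := by
        have := norm_sub_norm_le x (-s)
        rw [norm_neg, sub_neg_eq_add] at this
        linarith
      simp [hR x (by linarith), hR _ h3]
  · have h1 : ∀ t, ‖correlation ψ (fun x => (φ x : ℂ)) t‖ ≤ B * N := fun t =>
      norm_correlation_le hψ.continuous hL hB0 (fun x => by simpa using hB x) t
    have h2 : 1 ≤ ‖s‖ ^ 2 := one_le_pow₀ hs
    calc _ ≤ (B * N + B * N) / 2 + B * N := by
          refine (norm_sub_le _ _).trans (add_le_add ?_ (h1 0))
          rw [norm_div, Complex.norm_two]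
          gcongr
          exact (norm_add_le _ _).trans (add_le_add (h1 s) (h1 (-s)))
      _ = 2 * (B * N) * 1 := by ring
      _ ≤ 2 * (B * N) * ‖s‖ ^ 2 := by gcongr
      _ ≤ _ := by
        gcongr
        have : 0 ≤ L1 * L2 * V1 + B * (2 * L) ^ 2 * V := by positivity
        linarith

/-- Second-order expansion of the even part of the correlation function. -/
lemma tendsto_rescaled_correlation_even_part (hψ : ContDiff ℝ 1 ψ) (hL : MemLp ψ 2 volume)
    (hφ : ContDiff ℝ 1 φ) (hφc : HasCompactSupport φ) (s : Space d) :
    Tendsto (fun n : ℕ => (((n : ℝ) + 1 : ℝ) : ℂ) ^ 2 *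
      ((correlation ψ (fun x => (φ x : ℂ)) (((n : ℝ) + 1)⁻¹ • s) +
        correlation ψ (fun x => (φ x : ℂ)) (-(((n : ℝ) + 1)⁻¹ • s))) / 2 -
        correlation ψ (fun x => (φ x : ℂ)) 0)) atTop
      (𝓝 (((-(∫ x, fderiv ℝ φ x s * fderiv ℝ (fun x => ‖ψ x‖ ^ 2) x s) -
        ∫ x, φ x * ‖2 * fderiv ℝ ψ x s‖ ^ 2) / 2 : ℝ) : ℂ)) := by
  obtain ⟨R, hR0, hR⟩ := exists_support_radius hφc
  obtain ⟨B, hB0, hB⟩ := exists_bound_of_compactSupport hφ.continuous hφc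
  have hρ := contDiff_norm_sq hψ
  have hc := hψ.continuous
  have hφ' := hφ.continuous
  obtain ⟨C1, hC10, hC1⟩ := exists_rescaled_difference_bound hφ (R + ‖s‖) s
  obtain ⟨C2, hC20, hC2⟩ := exists_rescaled_difference_bound hρ (R + ‖s‖) s
  obtain ⟨C3, hC30, hC3⟩ := exists_rescaled_difference_bound hψ R s
  obtain ⟨C4, hC40, hC4⟩ := exists_rescaled_difference_bound hψ R (-s)
  have hA : Tendsto (fun n : ℕ => ((n : ℝ) + 1) ^ 2 *
      ∫ x, (φ (x + ((n : ℝ) + 1)⁻¹ • s) - φ x) *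
        (‖ψ (x + ((n : ℝ) + 1)⁻¹ • s)‖ ^ 2 - ‖ψ x‖ ^ 2)) atTop
      (𝓝 (∫ x, fderiv ℝ φ x s * fderiv ℝ (fun x => ‖ψ x‖ ^ 2) x s)) := by
    have heq : ∀ n : ℕ, ((n : ℝ) + 1) ^ 2 * ∫ x, (φ (x + ((n : ℝ) + 1)⁻¹ • s) - φ x) *
        (‖ψ (x + ((n : ℝ) + 1)⁻¹ • s)‖ ^ 2 - ‖ψ x‖ ^ 2) =
        ∫ x, (((n : ℝ) + 1) • (φ (x + ((n : ℝ) + 1)⁻¹ • s) - φ x)) *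
          (((n : ℝ) + 1) • (‖ψ (x + ((n : ℝ) + 1)⁻¹ • s)‖ ^ 2 - ‖ψ x‖ ^ 2)) := by
      intro n
      rw [← integral_const_mul]
      congr 1; ext x
      simp only [smul_eq_mul]
      ring
    simp only [heq]
    refine tendsto_integral_of_bounded_support (R := R + ‖s‖) (C := C1 * C2) (fun n => by fun_prop)
      (fun n x hx => ?_) (fun n x hx => ?_) (fun x => ?_)
    · rw [norm_mul]
      exact mul_le_mul (hC1 n x hx) (hC2 n x hx) (norm_nonneg _) hC10
    · have h3 : R < ‖x + ((n : ℝ) + 1)⁻¹ • s‖ := by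
        have := norm_sub_norm_le x (-(((n : ℝ) + 1)⁻¹ • s))
        rw [norm_neg, sub_neg_eq_add] at this
        linarith [norm_inv_smul_le n s]
      simp [hR x (by linarith [norm_nonneg s]), hR _ h3]
    · exact (tendsto_rescaled_difference hφ x s).mul (tendsto_rescaled_difference hρ x s)
  have hB' : Tendsto (fun n : ℕ => ((n : ℝ) + 1) ^ 2 *
      ∫ x, φ x * ‖ψ (x + ((n : ℝ) + 1)⁻¹ • s) - ψ (x - ((n : ℝ) + 1)⁻¹ • s)‖ ^ 2) atTop
      (𝓝 (∫ x, φ x * ‖2 * fderiv ℝ ψ x s‖ ^ 2)) := by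
    have heq : ∀ n : ℕ, ((n : ℝ) + 1) ^ 2 *
        ∫ x, φ x * ‖ψ (x + ((n : ℝ) + 1)⁻¹ • s) - ψ (x - ((n : ℝ) + 1)⁻¹ • s)‖ ^ 2 =
        ∫ x, φ x * ‖((n : ℝ) + 1) • (ψ (x + ((n : ℝ) + 1)⁻¹ • s) - ψ x) -
          ((n : ℝ) + 1) • (ψ (x + ((n : ℝ) + 1)⁻¹ • -s) - ψ x)‖ ^ 2 := by
      intro n
      rw [← integral_const_mul]
      congr 1; ext x
      have hn : (0 : ℝ) ≤ (n : ℝ) + 1 := by positivity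
      rw [← smul_sub, norm_smul, Real.norm_of_nonneg hn, smul_neg, ← sub_eq_add_neg]
      rw [sub_sub_sub_cancel_right]
      ring
    simp only [heq]
    refine tendsto_integral_of_bounded_support (R := R) (C := B * (C3 + C4) ^ 2)
      (fun n => by fun_prop)
      (fun n x hx => ?_) (fun n x hx => by simp [hR x hx]) (fun x => ?_)
    · rw [norm_mul, norm_pow, norm_norm]
      have := (norm_sub_le _ _).trans (add_le_add (hC3 n x hx) (hC4 n x hx))
      gcongr
      exact hB x
    · have h := ((((tendsto_rescaled_difference hψ x s).sub
        (tendsto_rescaled_difference hψ x (-s))).norm.pow 2).const_mul (φ x))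
      have h2 : fderiv ℝ ψ x s - fderiv ℝ ψ x (-s) = 2 * fderiv ℝ ψ x s := by
        rw [map_neg]; ring
      rw [h2] at h
      exact h
  have h := ((hA.neg.sub hB').div_const 2)
  have h2 := (Complex.continuous_ofReal.tendsto _).comp h
  refine h2.congr fun n => ?_
  rw [correlation_even_part hc hL hφ' hφc]
  simp only [Function.comp_apply]
  push_cast
  ring

end SecondOrder

end Semiclassical

/-! ### Density and current of a pure state -/

namespace Semiclassical

open scoped FourierTransform LineDeriv

section Moments

variable {d : ℕ} {ψ : Space d → ℂ}

/-- The partial derivative of `f` in the `l`-th coordinate direction. -/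
noncomputable def partialDeriv {F : Type*} [NormedAddCommGroup F] [NormedSpace ℝ F] (l : Fin d)
    (f : Space d → F) (x : Space d) : F := fderiv ℝ f x (EuclideanSpace.single l 1)

lemma continuous_partialDeriv {F : Type*} [NormedAddCommGroup F] [NormedSpace ℝ F]
    {f : Space d → F} (hf : ContDiff ℝ 1 f) (l : Fin d) : Continuous (partialDeriv l f) :=
  (hf.continuous_fderiv one_ne_zero).clm_apply continuous_const

lemma fderiv_apply_eq_sum {F : Type*} [NormedAddCommGroup F] [NormedSpace ℝ F]
    (f : Space d → F) (x s : Space d) : fderiv ℝ f x s = ∑ l, s l • partialDeriv l f x := by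
  have h : s = ∑ l, s l • (EuclideanSpace.single l (1 : ℝ) : Space d) := by
    conv_lhs => rw [← (EuclideanSpace.basisFun (Fin d) ℝ).sum_repr s]
    simp
  conv_lhs => rw [h]
  rw [map_sum]
  simp only [map_smul, partialDeriv]

lemma partialDeriv_eq_zero_of_notMem {F : Type*} [NormedAddCommGroup F] [NormedSpace ℝ F]
    {f : Space d → F} {l : Fin d} {x : Space d} (hx : x ∉ tsupport f) : partialDeriv l f x = 0 := by
  have h : fderiv ℝ f x = 0 := by
    by_contra h
    exact hx (tsupport_fderiv_subset ℝ (subset_tsupport _ h))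
  rw [partialDeriv, h, zero_apply]

lemma hasCompactSupport_partialDeriv {F : Type*} [NormedAddCommGroup F] [NormedSpace ℝ F]
    {f : Space d → F} (hf : HasCompactSupport f) (l : Fin d) :
    HasCompactSupport (partialDeriv l f) :=
  HasCompactSupport.intro hf fun _ hx => partialDeriv_eq_zero_of_notMem hx

lemma inner_single_eq (η : Space d) (l : Fin d) :
    (inner ℝ η (EuclideanSpace.single l (1 : ℝ)) : ℝ) = η l := by
  simp [EuclideanSpace.inner_single_right]

/-- An even smooth cutoff, equal to `1` near the origin. -/
lemma exists_even_cutoff : ∃ χ : Space d → ℝ, ContDiff ℝ ∞ χ ∧ HasCompactSupport χ ∧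
    (∀ᶠ v in 𝓝 0, χ v = 1) ∧ ∀ v, χ (-v) = χ v := by
  let b : ContDiffBump (0 : Space d) := ⟨1, 2, by norm_num, by norm_num⟩
  exact ⟨b, b.contDiff, b.hasCompactSupport, b.eventuallyEq_one, fun v => b.neg v⟩

lemma coordinate_homogeneous (m : ℝ) (j : Fin d) (t : ℝ) (v : Space d) :
    1 / m * (t • v) j = t ^ 1 * (1 / m * v j) := by
  simp only [PiLp.smul_apply, smul_eq_mul]; ring

lemma normSq_homogeneous (m t : ℝ) (v : Space d) :
    1 / (2 * m) * ‖t • v‖ ^ 2 = t ^ 2 * (1 / (2 * m) * ‖v‖ ^ 2) := by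
  rw [norm_smul, mul_pow, Real.norm_eq_abs, sq_abs]; ring

/-- For moments of positive degree the profile vanishes at `0`, so its Fourier transform has zero
integral. The constant term of the expansion may be subtracted before multiplication by `(n + 1)^r`.
-/
lemma integral_kernel_sub_const (K : 𝓢(Space d, ℂ)) {H : Space d → ℂ} (hH : Continuous H) {B : ℝ}
    (hB : ∀ s, ‖H s‖ ≤ B) (hK : ∫ η, K η = 0) (a : ℂ) :
    ∫ η, K η * H η = ∫ η, K η * (H η - a) := by
  have i1 : Integrable fun η => K η * H η :=
    K.integrable.mul_bdd hH.aestronglyMeasurable (Eventually.of_forall hB)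
  have i2 : Integrable fun η => K η * a := K.integrable.mul_const a
  simp only [mul_sub]
  rw [integral_sub i1 i2, integral_mul_const, hK, zero_mul, sub_zero]

/-- The density of the Wigner function of `ψ` is `|ψ|²`. -/
theorem density_wigner_eq (hc : Continuous ψ) (hL : MemLp ψ 2 volume) {h : ℝ} (hh : 0 < h)
    {ρ : Space d → ℝ} (hρc : Continuous ρ) (hρ : IsDensity (wignerAction h ψ) ρ) (x : Space d) :
    ρ x = ‖ψ x‖ ^ 2 := by
  obtain ⟨hloc, hp, hmom⟩ := hρ
  obtain ⟨χ, hχ, hχc, hχ1, -⟩ := exists_even_cutoff (d := d)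
  have hc2 : Continuous fun x => ‖ψ x‖ ^ 2 := by fun_prop
  have key : ∀ᵐ x, ρ x = ‖ψ x‖ ^ 2 := by
    refine ae_eq_of_integral_contDiff_smul_eq hloc hc2.locallyIntegrable fun φ hφ hφc => ?_
    have h1 := hmom φ χ hφ hφc hχ hχc hχ1
    simp only [wignerAction_cutoffTest hc hL hh hp hφ hφc hχ hχc (r := 0)
      (fun t v => by simp)] at h1
    obtain ⟨B, hB0, hB⟩ := exists_bound_of_compactSupport hφ.continuous hφc
    have h2 := tendsto_integral_kernel_rescaled (𝓕 (cutoffProfile hp hχ hχc)) 0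
      (H := correlation ψ fun x => (φ x : ℂ))
      (Q := fun _ => correlation ψ (fun x => (φ x : ℂ)) 0)
      (continuous_correlation hc hφ.continuous hφc) (C := B * ∫ x, ‖ψ x‖ ^ 2)
      (fun s => by
        rw [pow_zero, mul_one]
        exact norm_correlation_le hc hL hB0 (fun x => by simpa using hB x) s)
      (fun s => by
        simp only [pow_zero, one_mul]
        exact ((continuous_correlation hc hφ.continuous hφc).tendsto 0).comp (tendsto_inv_smul s))
      (Real.pi * h)
    -- The limit is the profile at `0`, which is `1`, times the correlation at zero shift, which is
    -- `∫ φ|ψ|²`.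
    have h3 := tendsto_nhds_unique h1 h2
    rw [integral_mul_const, integral_fourier_eq_apply_zero, correlation_zero] at h3
    simp only [cutoffProfile, realSchwartz_apply, hχ1.self_of_nhds] at h3
    norm_num at h3
    have h4 : ∫ x, ρ x * φ x = ∫ x, φ x * ‖ψ x‖ ^ 2 := by exact_mod_cast h3
    simp only [smul_eq_mul]
    rw [← h4]
    congr 1; ext x; ring
  -- Continuity upgrades the a.e. identity to all points, which makes `ρ` differentiable and its
  -- pointwise gradient meaningful.
  exact congrFun ((Continuous.ae_eq_iff_eq volume hρc hc2).1 key) x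

lemma cutoffProfile_eventuallyEq {p χ : Space d → ℝ} (hp : ContDiff ℝ ∞ p) (hχ : ContDiff ℝ ∞ χ)
    (hχc : HasCompactSupport χ) (hχ1 : ∀ᶠ v in 𝓝 0, χ v = 1) :
    (cutoffProfile hp hχ hχc : Space d → ℂ) =ᶠ[𝓝 0] fun v => ((p v : ℝ) : ℂ) := by
  filter_upwards [hχ1] with v hv
  simp [cutoffProfile, hv]

lemma integral_coord_mul_fourier_profile {m : ℝ} {j : Fin d} {χ : Space d → ℝ}
    (hp : ContDiff ℝ ∞ fun v : Space d => 1 / m * v j) (hχ : ContDiff ℝ ∞ χ)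
    (hχc : HasCompactSupport χ) (hχ1 : ∀ᶠ v in 𝓝 0, χ v = 1) (l : Fin d) :
    (2 * Real.pi * Complex.I) * ∫ η, ((η l : ℝ) : ℂ) * 𝓕 (cutoffProfile hp hχ hχc) η =
      if l = j then (1 / m : ℂ) else 0 := by
  have h := integral_inner_mul_fourier (cutoffProfile hp hχ hχc) (EuclideanSpace.single l 1)
  simp only [inner_single_eq] at h
  rw [h, SchwartzMap.lineDerivOp_apply_eq_fderiv,
    (cutoffProfile_eventuallyEq hp hχ hχc hχ1).fderiv_eq]
  let T : Space d →L[ℝ] ℂ := Complex.ofRealCLM ∘L ((1 / m) • (EuclideanSpace.proj j))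
  have hT : (fun v : Space d => ((1 / m * v j : ℝ) : ℂ)) = T := by
    ext v; simp [T]
  rw [hT, T.fderiv, ← congrFun hT]
  dsimp only
  rw [PiLp.single_apply]
  by_cases hl : l = j
  · simp [hl]
  · simp [hl, Ne.symm hl]

/-- The current of the Wigner function of `ψ` is `(ℏ / m) Im (conj ψ ∇ψ)`. -/
theorem current_wigner_eq (hψ : ContDiff ℝ 1 ψ) (hL : MemLp ψ 2 volume) {h : ℝ} (hh : 0 < h)
    {m : ℝ} (hm : 0 < m) {J : Space d → Space d} (hJ : IsCurrent m (wignerAction h ψ) J)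
    (j : Fin d) :
    ∀ᵐ x, J x j = h / m * (partialDeriv j ψ x * conj (ψ x)).im := by
  obtain ⟨hloc, hp, hmom⟩ := hJ j
  have hc := hψ.continuous
  obtain ⟨χ, hχ, hχc, hχ1, -⟩ := exists_even_cutoff (d := d)
  have hD : ∀ l, Continuous (partialDeriv l ψ) := continuous_partialDeriv hψ
  have hconj : Continuous fun z : ℂ => conj z := Complex.continuous_conj
  have hc2 : Continuous fun x => h / m * (partialDeriv j ψ x * conj (ψ x)).im := by
    have := hD j
    have := Complex.continuous_im
    fun_prop
  refine ae_eq_of_integral_contDiff_smul_eq hloc hc2.locallyIntegrable fun φ hφ hφc => ?_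
  have h1 := hmom φ χ hφ hφc hχ hχc hχ1
  simp only [wignerAction_cutoffTest hc hL hh hp hφ hφc hχ hχc
    (coordinate_homogeneous m j)] at h1
  obtain ⟨B, hB0, hB⟩ := exists_bound_of_compactSupport hφ.continuous hφc
  obtain ⟨C, hC0, hC⟩ := exists_correlation_sub_zero_le hψ hL hφ.continuous hφc
  set K := 𝓕 (cutoffProfile hp hχ hχc) with hK
  set G := correlation ψ fun x => (φ x : ℂ) with hG
  have hGc : Continuous G := continuous_correlation hc hφ.continuous hφc
  let q : Space d → Space d → ℂ := fun s x =>
    (φ x : ℂ) * (fderiv ℝ ψ x s * conj (ψ x) - ψ x * conj (fderiv ℝ ψ x s))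
  have h2 := tendsto_integral_kernel_rescaled K 1 (H := fun s => G s - G 0)
    (Q := fun s => ∫ x, q s x) (hGc.sub continuous_const) (C := C)
    (fun s => by rw [pow_one]; exact hC s)
    (tendsto_rescaled_correlation hψ hL hφ.continuous hφc) (Real.pi * h)
  have hK0 : ∫ η, K η = 0 := by
    rw [hK, integral_fourier_eq_apply_zero]
    simp [cutoffProfile]
  have h3 := tendsto_nhds_unique h1 (h2.congr fun n => by
    rw [← integral_kernel_sub_const K (H := fun η => G (((n : ℝ) + 1)⁻¹ • (Real.pi * h) • η))
      (by fun_prop) (fun s => norm_correlation_le hc hL hB0 (fun x => by simpa using hB x) _) hK0])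
  let Q1 : Fin d → ℂ := fun l => ∫ x, (φ x : ℂ) *
    (partialDeriv l ψ x * conj (ψ x) - ψ x * conj (partialDeriv l ψ x))
  have i1 : ∀ l, Integrable fun x => (φ x : ℂ) *
      (partialDeriv l ψ x * conj (ψ x) - ψ x * conj (partialDeriv l ψ x)) := by
    intro l
    have := hD l
    have := hφ.continuous
    refine Continuous.integrable_of_hasCompactSupport (by fun_prop) ?_
    exact HasCompactSupport.mul_right
      (hφc.comp_left (g := fun t : ℝ => (t : ℂ)) Complex.ofReal_zero)
  have hQ : ∀ s : Space d, ∫ x, q s x = ∑ l, ((s l : ℝ) : ℂ) * Q1 l := by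
    intro s
    simp only [Q1, ← integral_const_mul]
    rw [← integral_finsetSum _ fun l _ => (i1 l).const_mul _]
    congr 1; ext x
    simp only [q, fderiv_apply_eq_sum, map_sum, Finset.sum_mul, Finset.mul_sum,
      ← Finset.sum_sub_distrib, Complex.real_smul, map_mul, Complex.conj_ofReal]
    refine Finset.sum_congr rfl fun l _ => ?_
    ring
  have hKint : ∀ l : Fin d, Integrable fun η : Space d => ((η l : ℝ) : ℂ) * K η := by
    intro l
    refine Integrable.mono' (K.integrable_pow_mul volume 1) ?_ (Eventually.of_forall fun η => ?_)
    · have := K.continuous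
      exact Continuous.aestronglyMeasurable (by fun_prop)
    · rw [norm_mul, pow_one, Complex.norm_real]
      exact mul_le_mul_of_nonneg_right (PiLp.norm_apply_le η l) (norm_nonneg _)
  have h4 : ∫ η, K η * ∫ x, q ((Real.pi * h) • η) x =
      ∑ l, (Real.pi * h) * Q1 l * ∫ η : Space d, ((η l : ℝ) : ℂ) * K η := by
    simp only [hQ, ← integral_const_mul]
    rw [← integral_finsetSum _ fun l _ => (hKint l).const_mul _]
    congr 1; ext η
    rw [Finset.mul_sum]
    refine Finset.sum_congr rfl fun l _ => ?_
    simp only [PiLp.smul_apply, smul_eq_mul]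
    push_cast
    ring
  have hpi : (2 * Real.pi * Complex.I : ℂ) ≠ 0 := by
    simp [Real.pi_ne_zero]
  have h5 : ∀ l, ∫ η : Space d, ((η l : ℝ) : ℂ) * K η =
      if l = j then (1 / m : ℂ) / (2 * Real.pi * Complex.I) else 0 := by
    intro l
    have := integral_coord_mul_fourier_profile hp hχ hχc hχ1 l
    rw [← hK] at this
    rw [mul_comm] at this
    rw [eq_div_of_mul_eq hpi this]
    split_ifs <;> simp
  rw [h4] at h3
  -- Only `l = j` survives. The constants combine as `πℏ · 2i · (1/m) / (2πi) = ℏ/m`.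
  simp only [h5, mul_ite, mul_zero, Finset.sum_ite_eq', Finset.mem_univ, if_true] at h3
  have h6 : Q1 j = 2 * Complex.I *
      ((∫ x, φ x * (partialDeriv j ψ x * conj (ψ x)).im : ℝ) : ℂ) := by
    simp only [Q1]
    rw [← integral_complex_ofReal, ← integral_const_mul]
    congr 1; ext x
    have h7 : ∀ a b : ℂ, a * conj b - b * conj a = 2 * Complex.I * ((a * conj b).im : ℂ) := by
      intro a b
      apply Complex.ext <;> simp <;> ring
    rw [h7]
    push_cast
    ring
  rw [h6] at h3
  have h8 : ((∫ x, J x j * φ x : ℝ) : ℂ) =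
      ((h / m * ∫ x, φ x * (partialDeriv j ψ x * conj (ψ x)).im : ℝ) : ℂ) := by
    rw [h3]
    have hpi' : (Real.pi : ℂ) ≠ 0 := by exact_mod_cast Real.pi_ne_zero
    have hm' : (m : ℂ) ≠ 0 := by exact_mod_cast hm.ne'
    push_cast
    field_simp
  have h9 : ∫ x, J x j * φ x =
      h / m * ∫ x, φ x * (partialDeriv j ψ x * conj (ψ x)).im := by exact_mod_cast h8
  simp only [smul_eq_mul]
  calc ∫ x, φ x * J x j = ∫ x, J x j * φ x := by congr 1; ext x; ring
    _ = _ := by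
      rw [h9, ← integral_const_mul]
      congr 1; ext x; ring

end Moments

end Semiclassical

/-! ### Kinetic energy of a pure state -/

namespace Semiclassical

open scoped FourierTransform LineDeriv

section Energy

variable {d : ℕ} {ψ : Space d → ℂ}

/-- Near `0` the profile is `|v|²/(2m)`, whose Hessian is the identity divided by `m`; the
off-diagonal second-order coefficients therefore disappear from the energy. -/
lemma integral_coord_mul_coord_mul_fourier_profile {m : ℝ} {χ : Space d → ℝ}
    (hp : ContDiff ℝ ∞ fun v : Space d => 1 / (2 * m) * ‖v‖ ^ 2) (hχ : ContDiff ℝ ∞ χ)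
    (hχc : HasCompactSupport χ) (hχ1 : ∀ᶠ v in 𝓝 0, χ v = 1) (l l' : Fin d) :
    (2 * Real.pi * Complex.I) ^ 2 *
      ∫ η, ((η l * η l' : ℝ) : ℂ) * 𝓕 (cutoffProfile hp hχ hχc) η =
      if l = l' then (1 / m : ℂ) else 0 := by
  set f := cutoffProfile hp hχ hχc with hf
  have h := integral_inner_mul_inner_mul_fourier f (EuclideanSpace.single l 1)
    (EuclideanSpace.single l' 1)
  simp only [inner_single_eq] at h
  rw [h, SchwartzMap.lineDerivOp_apply_eq_fderiv]
  let T : Space d →L[ℝ] ℂ := Complex.ofRealCLM ∘L ((1 / m) • (EuclideanSpace.proj l'))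
  have hT : (fun v : Space d => ((1 / m * v l' : ℝ) : ℂ)) = T := by
    ext v; simp [T]
  have h1 : ((∂_{(EuclideanSpace.single l' (1 : ℝ) : Space d)} f : 𝓢(Space d, ℂ)) : Space d → ℂ) =ᶠ[𝓝 0]
      fun v => ((1 / m * v l' : ℝ) : ℂ) := by
    filter_upwards [(cutoffProfile_eventuallyEq hp hχ hχc hχ1).eventuallyEq_nhds] with v hv
    rw [SchwartzMap.lineDerivOp_apply_eq_fderiv, hv.fderiv_eq]
    have h2 : HasFDerivAt (fun v : Space d => 1 / (2 * m) * ‖v‖ ^ 2)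
        ((1 / (2 * m)) • ((2 : ℝ) • innerSL ℝ v)) v := by
      have := (hasStrictFDerivAt_norm_sq v).hasFDerivAt.const_mul (1 / (2 * m))
      refine this.congr_fderiv ?_
      ext u
      simp
    have h3 := (Complex.ofRealCLM.hasFDerivAt (x := 1 / (2 * m) * ‖v‖ ^ 2)).comp v h2
    have h4 : fderiv ℝ (fun v : Space d => ((1 / (2 * m) * ‖v‖ ^ 2 : ℝ) : ℂ)) v = _ := h3.fderiv
    rw [h4]
    simp only [ContinuousLinearMap.comp_apply, smul_apply, innerSL_apply_apply, inner_single_eq,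
      Complex.ofRealCLM_apply, smul_eq_mul]
    push_cast
    by_cases hm : m = 0
    · simp [hm]
    · have hm' : (m : ℂ) ≠ 0 := by exact_mod_cast hm
      field_simp
  rw [h1.fderiv_eq, hT, T.fderiv, ← congrFun hT]
  dsimp only
  rw [PiLp.single_apply]
  by_cases hl : l = l'
  · simp [hl]
  · simp [hl, Ne.symm hl]

lemma fourier_cutoffProfile_neg {p χ : Space d → ℝ} (hp : ContDiff ℝ ∞ p) (hχ : ContDiff ℝ ∞ χ)
    (hχc : HasCompactSupport χ) (hpe : ∀ v, p (-v) = p v) (hχe : ∀ v, χ (-v) = χ v)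
    (η : Space d) :
    𝓕 (cutoffProfile hp hχ hχc) (-η) = 𝓕 (cutoffProfile hp hχ hχc) η := by
  rw [SchwartzMap.fourier_coe, Real.fourier_eq', Real.fourier_eq', ← integral_neg_eq_self]
  congr 1; ext v
  simp [cutoffProfile, hpe, hχe]

/-- An even kernel only sees the even part of the correlation. This removes the first-order term,
which would diverge under the factor `(n + 1)²`, and leaves the part that has a second-order
expansion for `ψ` of class `C¹`. -/
lemma integral_even_kernel {K : Space d → ℂ} (hK : ∀ η, K (-η) = K η) {H : Space d → ℂ}
    (hint : Integrable fun η => K η * H η) :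
    ∫ η, K η * H η = ∫ η, K η * ((H η + H (-η)) / 2) := by
  have h1 : ∫ η, K η * H (-η) = ∫ η, K η * H η := by
    rw [← integral_neg_eq_self]
    simp [hK]
  have h2 : Integrable fun η => K η * H (-η) := by
    refine hint.comp_neg.congr (Eventually.of_forall fun η => ?_)
    simp [hK]
  have h3 : ∀ η, K η * ((H η + H (-η)) / 2) = (K η * H η + K η * H (-η)) * (1 / 2) := fun η => by
    ring
  simp only [h3]
  rw [integral_mul_const, integral_add hint h2, h1]
  ring

/-- The quadratic form governing the second-order expansion of the correlation function. -/
lemma second_order_form_eq_sum (hψ : ContDiff ℝ 1 ψ) {φ : Space d → ℝ} (hφ : ContDiff ℝ 1 φ)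
    (hφc : HasCompactSupport φ) (s : Space d) :
    (-(∫ x, fderiv ℝ φ x s * fderiv ℝ (fun x => ‖ψ x‖ ^ 2) x s) -
        ∫ x, φ x * ‖2 * fderiv ℝ ψ x s‖ ^ 2) / 2 =
      ∑ l, ∑ l', (s l * s l') *
        ((-(∫ x, partialDeriv l φ x * partialDeriv l' (fun x => ‖ψ x‖ ^ 2) x) -
          4 * ∫ x, φ x * inner ℝ (partialDeriv l ψ x) (partialDeriv l' ψ x)) / 2) := by
  have hφ' := hφ.continuous
  have hDφ := continuous_partialDeriv hφ
  have hDψ := continuous_partialDeriv hψ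
  have hDρ := continuous_partialDeriv (contDiff_norm_sq hψ)
  have i1 : ∀ l l', Integrable fun x =>
      partialDeriv l φ x * partialDeriv l' (fun x => ‖ψ x‖ ^ 2) x := fun l l' =>
    continuous_compactSupport_mul_integrable (hDφ l) (hasCompactSupport_partialDeriv hφc l) (hDρ l')
  have i2 : ∀ l l', Integrable fun x =>
      φ x * inner ℝ (partialDeriv l ψ x) (partialDeriv l' ψ x) := fun l l' =>
    continuous_compactSupport_mul_integrable hφ' hφc ((hDψ l).inner (hDψ l'))
  have h1 : ∫ x, fderiv ℝ φ x s * fderiv ℝ (fun x => ‖ψ x‖ ^ 2) x s =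
      ∑ l, ∑ l', (s l * s l') *
        ∫ x, partialDeriv l φ x * partialDeriv l' (fun x => ‖ψ x‖ ^ 2) x := by
    simp only [← integral_const_mul]
    simp only [← integral_finsetSum _ fun l' _ => (i1 _ l').const_mul _]
    rw [← integral_finsetSum _ fun l _ => integrable_finsetSum _ fun l' _ =>
      (i1 l l').const_mul _]
    congr 1; ext x
    rw [fderiv_apply_eq_sum, fderiv_apply_eq_sum, Finset.sum_mul_sum]
    refine Finset.sum_congr rfl fun l _ => Finset.sum_congr rfl fun l' _ => ?_
    simp only [smul_eq_mul]
    ring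
  have h2 : ∫ x, φ x * ‖2 * fderiv ℝ ψ x s‖ ^ 2 =
      ∑ l, ∑ l', (s l * s l') *
        (4 * ∫ x, φ x * inner ℝ (partialDeriv l ψ x) (partialDeriv l' ψ x)) := by
    simp only [← integral_const_mul]
    simp only [← integral_finsetSum _ fun l' _ => ((i2 _ l').const_mul 4).const_mul _]
    rw [← integral_finsetSum _ fun l _ => integrable_finsetSum _ fun l' _ =>
      ((i2 l l').const_mul 4).const_mul _]
    congr 1; ext x
    have h3 : ‖fderiv ℝ ψ x s‖ ^ 2 =
        ∑ l, ∑ l', (s l * s l') * inner ℝ (partialDeriv l ψ x) (partialDeriv l' ψ x) := by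
      rw [← real_inner_self_eq_norm_sq, fderiv_apply_eq_sum, sum_inner]
      simp only [inner_sum, real_inner_smul_left, real_inner_smul_right]
      refine Finset.sum_congr rfl fun l _ => Finset.sum_congr rfl fun l' _ => ?_
      ring
    rw [norm_mul, mul_pow, h3, Complex.norm_two, Finset.mul_sum, Finset.mul_sum]
    refine Finset.sum_congr rfl fun l _ => ?_
    rw [Finset.mul_sum, Finset.mul_sum]
    refine Finset.sum_congr rfl fun l' _ => ?_
    ring
  rw [h1, h2, ← Finset.sum_neg_distrib, ← Finset.sum_sub_distrib, Finset.sum_div]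
  refine Finset.sum_congr rfl fun l _ => ?_
  rw [← Finset.sum_neg_distrib, ← Finset.sum_sub_distrib, Finset.sum_div]
  refine Finset.sum_congr rfl fun l' _ => ?_
  ring

/-- The kinetic energy density of the Wigner function of `ψ`, in weak form:
`2m E = ℏ² |∇ψ|² - (ℏ²/4) Δ|ψ|²`. -/
theorem energy_wigner_eq (hψ : ContDiff ℝ 1 ψ) (hL : MemLp ψ 2 volume) {h : ℝ} (hh : 0 < h)
    {m : ℝ} (hm : 0 < m) {E : Space d → ℝ} (hE : IsKineticEnergy m (wignerAction h ψ) E)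
    {φ : Space d → ℝ} (hφ : ContDiff ℝ ∞ φ) (hφc : HasCompactSupport φ) :
    2 * m * ∫ x, E x * φ x = ∑ l, (h ^ 2 * (∫ x, φ x * ‖partialDeriv l ψ x‖ ^ 2) +
      h ^ 2 / 4 * ∫ x, partialDeriv l φ x * partialDeriv l (fun x => ‖ψ x‖ ^ 2) x) := by
  obtain ⟨hloc, hp, hmom⟩ := hE
  have hc := hψ.continuous
  obtain ⟨χ, hχ, hχc, hχ1, hχe⟩ := exists_even_cutoff (d := d)
  have hφ1 : ContDiff ℝ 1 φ := hφ.of_le (by simp)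
  have h1 := hmom φ χ hφ hφc hχ hχc hχ1
  simp only [wignerAction_cutoffTest hc hL hh hp hφ hφc hχ hχc (normSq_homogeneous m)] at h1
  obtain ⟨B, hB0, hB⟩ := exists_bound_of_compactSupport hφ.continuous hφc
  obtain ⟨C, hC⟩ := exists_correlation_even_part_le hψ hL hφ1 hφc
  have hKe : ∀ η, 𝓕 (cutoffProfile hp hχ hχc) (-η) = 𝓕 (cutoffProfile hp hχ hχc) η :=
    fourier_cutoffProfile_neg hp hχ hχc (fun v => by simp) hχe
  have hquad := second_order_form_eq_sum hψ hφ1 hφc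
  have hlim := tendsto_rescaled_correlation_even_part hψ hL hφ1 hφc
  simp only [hquad] at hlim
  set A : Fin d → Fin d → ℝ := fun l l' =>
    (-(∫ x, partialDeriv l φ x * partialDeriv l' (fun x => ‖ψ x‖ ^ 2) x) -
          4 * ∫ x, φ x * inner ℝ (partialDeriv l ψ x) (partialDeriv l' ψ x)) / 2 with hA
  have hmoment := integral_coord_mul_coord_mul_fourier_profile hp hχ hχc hχ1
  have hK0 : ∫ η, 𝓕 (cutoffProfile hp hχ hχc) η = 0 := by
    rw [integral_fourier_eq_apply_zero]
    simp [cutoffProfile]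
  set K := 𝓕 (cutoffProfile hp hχ hχc) with hK
  set G := correlation ψ fun x => (φ x : ℂ) with hG
  have hGc : Continuous G := continuous_correlation hc hφ.continuous hφc
  have hGb : ∀ s, ‖G s‖ ≤ B * ∫ x, ‖ψ x‖ ^ 2 := fun s =>
    norm_correlation_le hc hL hB0 (fun x => by simpa using hB x) s
  have h2 := tendsto_integral_kernel_rescaled K 2 (H := fun s => (G s + G (-s)) / 2 - G 0)
    (Q := fun s => ((∑ l, ∑ l', (s l * s l') * A l l' : ℝ) : ℂ)) (by fun_prop) (C := C)
    hC hlim (Real.pi * h)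
  -- Evenness of the kernel replaces the correlation by its even part; zero mean of the kernel then
  -- removes the value at zero shift.
  have h3 := tendsto_nhds_unique h1 (h2.congr fun n => by
    rw [integral_even_kernel hKe (H := fun η => G (((n : ℝ) + 1)⁻¹ • (Real.pi * h) • η))
      (K.integrable.mul_bdd (Continuous.aestronglyMeasurable (by fun_prop))
        (Eventually.of_forall fun η => hGb _)),
      integral_kernel_sub_const K (H := fun η => (G (((n : ℝ) + 1)⁻¹ • (Real.pi * h) • η) +
        G (((n : ℝ) + 1)⁻¹ • (Real.pi * h) • -η)) / 2) (B := B * ∫ x, ‖ψ x‖ ^ 2)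
      (by fun_prop) (fun s => ?_) hK0 (G 0)]
    · simp only [smul_neg]
    · rw [norm_div, Complex.norm_two]
      have := (norm_add_le _ _).trans (add_le_add (hGb (((n : ℝ) + 1)⁻¹ • (Real.pi * h) • s))
        (hGb (((n : ℝ) + 1)⁻¹ • (Real.pi * h) • -s)))
      linarith)
  have hKint : ∀ l l' : Fin d, Integrable fun η : Space d => ((η l * η l' : ℝ) : ℂ) * K η := by
    intro l l'
    refine Integrable.mono' (K.integrable_pow_mul volume 2) ?_ (Eventually.of_forall fun η => ?_)
    · have := K.continuous
      exact Continuous.aestronglyMeasurable (by fun_prop)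
    · rw [norm_mul, Complex.norm_real, norm_mul, sq]
      exact mul_le_mul_of_nonneg_right (mul_le_mul (PiLp.norm_apply_le η l)
        (PiLp.norm_apply_le η l') (norm_nonneg _) (norm_nonneg _)) (norm_nonneg _)
  have hpi : ((2 * Real.pi * Complex.I) ^ 2 : ℂ) ≠ 0 := by
    simp [Real.pi_ne_zero]
  have h5 : ∀ l l' : Fin d, ∫ η : Space d, ((η l * η l' : ℝ) : ℂ) * K η =
      if l = l' then (1 / m : ℂ) / (2 * Real.pi * Complex.I) ^ 2 else 0 := by
    intro l l'
    have := hmoment l l'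
    rw [mul_comm] at this
    rw [eq_div_of_mul_eq hpi this]
    split_ifs <;> simp
  have h4 : ∫ η, K η * ((∑ l, ∑ l', (((Real.pi * h) • η) l * ((Real.pi * h) • η) l') *
      A l l' : ℝ) : ℂ) = ∑ l, ∑ l', ((Real.pi * h) ^ 2 * A l l' : ℂ) *
        ∫ η : Space d, ((η l * η l' : ℝ) : ℂ) * K η := by
    simp only [← integral_const_mul]
    simp only [← integral_finsetSum _ fun l' _ => (hKint _ l').const_mul _]
    rw [← integral_finsetSum _ fun l _ => integrable_finsetSum _ fun l' _ =>
      (hKint l l').const_mul _]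
    congr 1; ext η
    rw [Complex.ofReal_sum, Finset.mul_sum]
    refine Finset.sum_congr rfl fun l _ => ?_
    rw [Complex.ofReal_sum, Finset.mul_sum]
    refine Finset.sum_congr rfl fun l' _ => ?_
    simp only [PiLp.smul_apply, smul_eq_mul]
    push_cast
    ring
  rw [h4] at h3
  simp only [h5, mul_ite, mul_zero, Finset.sum_ite_eq, Finset.mem_univ, if_true] at h3
  -- The sign comes from `i²`: `(πℏ)² / (2πi)² = -ℏ²/4`.
  have h6 : ((∫ x, E x * φ x : ℝ) : ℂ) = ((∑ l, -(h ^ 2 / (4 * m)) * A l l : ℝ) : ℂ) := by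
    rw [h3, Complex.ofReal_sum]
    refine Finset.sum_congr rfl fun l _ => ?_
    have hpi' : (Real.pi : ℂ) ≠ 0 := by exact_mod_cast Real.pi_ne_zero
    have hm' : (m : ℂ) ≠ 0 := by exact_mod_cast hm.ne'
    have hI : (2 * Real.pi * Complex.I : ℂ) ^ 2 = -(4 * Real.pi ^ 2) := by
      rw [mul_pow, mul_pow, Complex.I_sq]; ring
    rw [hI]
    push_cast
    field_simp
  have h7 : ∫ x, E x * φ x = ∑ l, -(h ^ 2 / (4 * m)) * A l l := by exact_mod_cast h6
  rw [h7, Finset.mul_sum]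
  refine Finset.sum_congr rfl fun l _ => ?_
  simp only [hA, real_inner_self_eq_norm_sq]
  field_simp
  ring

end Energy

end Semiclassical

/-! ### Mollification of test functions -/

namespace Semiclassical

section Mollifier

variable {d : ℕ}

/-- Bump functions shrinking to the origin. -/
noncomputable def shrinkingBump (d n : ℕ) : ContDiffBump (0 : Space d) :=
  ⟨((n : ℝ) + 1)⁻¹ / 2, ((n : ℝ) + 1)⁻¹, by positivity, half_lt_self (by positivity)⟩

lemma tendsto_shrinkingBump_rOut (d : ℕ) :
    Tendsto (fun n => (shrinkingBump d n).rOut) atTop (𝓝 0) :=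
  tendsto_inv_atTop_zero.comp (tendsto_atTop_add_const_right _ 1 tendsto_natCast_atTop_atTop)

/-- Convolution with a shrinking bump function. -/
noncomputable def mollify (n : ℕ) (g : Space d → ℝ) : Space d → ℝ :=
  convolution ((shrinkingBump d n).normed volume) g (ContinuousLinearMap.lsmul ℝ ℝ) volume

lemma mollify_apply (n : ℕ) (g : Space d → ℝ) (x : Space d) :
    mollify n g x = ∫ t, (shrinkingBump d n).normed volume t * g (x - t) := rfl

lemma contDiff_mollify (n : ℕ) {g : Space d → ℝ} (hg : LocallyIntegrable g volume) :
    ContDiff ℝ ∞ (mollify n g) :=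
  (shrinkingBump d n).hasCompactSupport_normed.contDiff_convolution_left _
    ((shrinkingBump d n).contDiff_normed) hg

lemma abs_mollify_le (n : ℕ) {g : Space d → ℝ} {B : ℝ} (hB : ∀ x, |g x| ≤ B) (x : Space d) :
    |mollify n g x| ≤ B := by
  rw [mollify_apply, ← Real.norm_eq_abs]
  refine (norm_integral_le_of_norm_le
    ((shrinkingBump d n).integrable_normed.mul_const B) (Eventually.of_forall fun t => ?_)).trans ?_
  · rw [norm_mul, Real.norm_of_nonneg ((shrinkingBump d n).nonneg_normed t)]
    exact mul_le_mul_of_nonneg_left (hB _) ((shrinkingBump d n).nonneg_normed t)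
  · rw [integral_mul_const, ContDiffBump.integral_normed, one_mul]

lemma mollify_nonneg (n : ℕ) {g : Space d → ℝ} (hg : ∀ x, 0 ≤ g x) (x : Space d) :
    0 ≤ mollify n g x := by
  rw [mollify_apply]
  exact integral_nonneg fun t => mul_nonneg ((shrinkingBump d n).nonneg_normed t) (hg _)

lemma mollify_eq_zero (n : ℕ) {g : Space d → ℝ} {R : ℝ} (hR : ∀ x, R < ‖x‖ → g x = 0)
    {x : Space d} (hx : R + 1 < ‖x‖) : mollify n g x = 0 := by
  rw [mollify_apply]
  refine integral_eq_zero_of_ae (Eventually.of_forall fun t => ?_)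
  by_cases ht : ‖t‖ < ((n : ℝ) + 1)⁻¹
  · have h1 : ((n : ℝ) + 1)⁻¹ ≤ 1 :=
      inv_le_one_of_one_le₀ (by linarith [n.cast_nonneg (α := ℝ)])
    have h2 : R < ‖x - t‖ := by linarith [norm_sub_norm_le x t]
    simp [hR _ h2]
  · have h1 : t ∉ Function.support ((shrinkingBump d n).normed volume) := by
      rw [ContDiffBump.support_normed_eq, mem_ball_zero_iff]
      exact ht
    simp [Function.notMem_support.1 h1]

lemma hasCompactSupport_of_radius {F : Type*} [Zero F] {g : Space d → F} {R : ℝ}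
    (hR : ∀ x, R < ‖x‖ → g x = 0) : HasCompactSupport g :=
  HasCompactSupport.intro (isCompact_closedBall (0 : Space d) R)
    fun x hx => hR x (by simpa using hx)

lemma partialDeriv_mollify (n : ℕ) {g : Space d → ℝ} (hg : ContDiff ℝ 1 g)
    (hgc : HasCompactSupport g) (l : Fin d) :
    partialDeriv l (mollify n g) = mollify n (partialDeriv l g) := by
  ext x
  have hloc : LocallyIntegrable ((shrinkingBump d n).normed volume) (volume : Measure (Space d)) :=
    (shrinkingBump d n).integrable_normed.locallyIntegrable
  have h := hgc.hasFDerivAt_convolution_right (ContinuousLinearMap.lsmul ℝ ℝ) hloc hg x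
  rw [partialDeriv, mollify, h.fderiv, convolution_precompR_apply _ hloc (hgc.fderiv ℝ)
    (hg.continuous_fderiv one_ne_zero)]
  rfl

lemma tendsto_mollify {g : Space d → ℝ} (hg : Continuous g) (x : Space d) :
    Tendsto (fun n => mollify n g x) atTop (𝓝 (g x)) :=
  ContDiffBump.convolution_tendsto_right_of_continuous (tendsto_shrinkingBump_rOut d) hg x

lemma ae_tendsto_mollify {g : Space d → ℝ} (hg : LocallyIntegrable g volume) :
    ∀ᵐ x, Tendsto (fun n => mollify n g x) atTop (𝓝 (g x)) :=
  ContDiffBump.ae_convolution_tendsto_right_of_locallyIntegrable (K := 2)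
    (tendsto_shrinkingBump_rOut d) (Eventually.of_forall fun n => by
      change ((n : ℝ) + 1)⁻¹ ≤ 2 * (((n : ℝ) + 1)⁻¹ / 2)
      linarith) hg

/-- Only a.e. convergence is required, so the lemma also covers mollified indicators of measurable
sets. -/
lemma tendsto_integral_mul_of_bounded_support {E : Space d → ℝ} (hE : LocallyIntegrable E volume)
    {f : ℕ → Space d → ℝ} {g : Space d → ℝ} (hf : ∀ n, Continuous (f n)) {R B : ℝ}
    (hB : ∀ n x, |f n x| ≤ B) (h0 : ∀ n x, R < ‖x‖ → f n x = 0)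
    (hlim : ∀ᵐ x, Tendsto (fun n => f n x) atTop (𝓝 (g x))) :
    Tendsto (fun n => ∫ x, E x * f n x) atTop (𝓝 (∫ x, E x * g x)) := by
  have hEball : IntegrableOn E (Metric.closedBall 0 R) :=
    hE.integrableOn_isCompact (isCompact_closedBall _ _)
  refine tendsto_integral_of_dominated_convergence
    ((Metric.closedBall (0 : Space d) R).indicator fun x => ‖E x‖ * B) (fun n => ?_) ?_
    (fun n => Eventually.of_forall fun x => ?_) ?_
  · exact hE.aestronglyMeasurable.mul (hf n).aestronglyMeasurable
  · exact (integrable_indicator_iff measurableSet_closedBall).2 (hEball.norm.mul_const B)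
  · by_cases hx : ‖x‖ ≤ R
    · rw [Set.indicator_of_mem (by simpa using hx), norm_mul]
      exact mul_le_mul_of_nonneg_left (hB n x) (norm_nonneg _)
    · rw [h0 n x (not_le.1 hx), mul_zero, norm_zero, Set.indicator_of_notMem (by simpa using hx)]
  · filter_upwards [hlim] with x hx
    exact hx.const_mul (E x)

end Mollifier

/-! ### Energy balance tested against the density -/

section EnergyBalance

variable {d : ℕ} {ψ : Space d → ℂ}

/-- The weak form of the kinetic energy density, tested against `C¹` functions. -/
lemma energy_wigner_eq_of_contDiff_one (hψ : ContDiff ℝ 1 ψ) (hL : MemLp ψ 2 volume) {h : ℝ}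
    (hh : 0 < h) {m : ℝ} (hm : 0 < m) {E : Space d → ℝ}
    (hE : IsKineticEnergy m (wignerAction h ψ) E) {φ : Space d → ℝ} (hφ : ContDiff ℝ 1 φ)
    (hφc : HasCompactSupport φ) :
    2 * m * ∫ x, E x * φ x = ∑ l, (h ^ 2 * (∫ x, φ x * ‖partialDeriv l ψ x‖ ^ 2) +
      h ^ 2 / 4 * ∫ x, partialDeriv l φ x * partialDeriv l (fun x => ‖ψ x‖ ^ 2) x) := by
  obtain ⟨R, hR0, hR⟩ := exists_support_radius hφc
  have hDφ := continuous_partialDeriv hφ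
  have hDφR : ∀ l x, R < ‖x‖ → partialDeriv l φ x = 0 := by
    intro l x hx
    have : φ =ᶠ[𝓝 x] fun _ => 0 := by
      filter_upwards [(isOpen_lt continuous_const continuous_norm).mem_nhds hx] with y hy
      exact hR y hy
    rw [partialDeriv, this.fderiv_eq]
    simp
  have lim : ∀ {F g : Space d → ℝ}, LocallyIntegrable F volume → Continuous g →
      (∀ x, R < ‖x‖ → g x = 0) →
      Tendsto (fun n => ∫ x, F x * mollify n g x) atTop (𝓝 (∫ x, F x * g x)) := by
    intro F g hF hg hg0
    obtain ⟨B, -, hB⟩ := exists_bound_of_compactSupport hg (hasCompactSupport_of_radius hg0)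
    exact tendsto_integral_mul_of_bounded_support hF
      (fun n => (contDiff_mollify n hg.locallyIntegrable).continuous)
      (fun n x => abs_mollify_le n hB x) (fun n x hx => mollify_eq_zero n hg0 hx)
      (Eventually.of_forall fun x => tendsto_mollify hg x)
  have hDψ := continuous_partialDeriv hψ
  have hDρ := continuous_partialDeriv (contDiff_norm_sq hψ)
  have h1 := (lim hE.1 hφ.continuous hR).const_mul (2 * m)
  have h2 : ∀ l, Tendsto (fun n => h ^ 2 * (∫ x, ‖partialDeriv l ψ x‖ ^ 2 * mollify n φ x) +
      h ^ 2 / 4 * ∫ x, partialDeriv l (fun x => ‖ψ x‖ ^ 2) x * mollify n (partialDeriv l φ) x)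
      atTop (𝓝 (h ^ 2 * (∫ x, ‖partialDeriv l ψ x‖ ^ 2 * φ x) +
      h ^ 2 / 4 * ∫ x, partialDeriv l (fun x => ‖ψ x‖ ^ 2) x * partialDeriv l φ x)) := by
    intro l
    have c1 : Continuous fun x => ‖partialDeriv l ψ x‖ ^ 2 := (hDψ l).norm.pow 2
    exact ((lim c1.locallyIntegrable hφ.continuous hR).const_mul _).add
      ((lim (hDρ l).locallyIntegrable (hDφ l) (hDφR l)).const_mul _)
  have h3 := tendsto_finsetSum Finset.univ fun l _ => h2 l
  have h4 := tendsto_nhds_unique h1 (h3.congr fun n => ?_)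
  · rw [h4]
    simp only [mul_comm]
  · rw [energy_wigner_eq hψ hL hh hm hE (contDiff_mollify n hφ.continuous.locallyIntegrable)
      (hasCompactSupport_of_radius fun x hx => mollify_eq_zero n hR hx)]
    simp only [partialDeriv_mollify n hφ hφc]
    refine Finset.sum_congr rfl fun l _ => ?_
    congr 2 <;> (congr 1; ext x; ring)

lemma partialDeriv_norm_sq (hψ : ContDiff ℝ 1 ψ) (l : Fin d) (x : Space d) :
    partialDeriv l (fun x => ‖ψ x‖ ^ 2) x = 2 * (partialDeriv l ψ x * conj (ψ x)).re := by
  have h := ((hψ.differentiable one_ne_zero x).hasFDerivAt).norm_sq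
  rw [partialDeriv, h.fderiv]
  simp [partialDeriv]
  ring

/-- The kinetic energy density splits into convective and quantum parts. -/
lemma norm_sq_mul_norm_partialDeriv_sq (hψ : ContDiff ℝ 1 ψ) (l : Fin d) (x : Space d) :
    ‖ψ x‖ ^ 2 * ‖partialDeriv l ψ x‖ ^ 2 = (partialDeriv l ψ x * conj (ψ x)).im ^ 2 +
      partialDeriv l (fun x => ‖ψ x‖ ^ 2) x ^ 2 / 4 := by
  rw [partialDeriv_norm_sq hψ]
  have h : ‖ψ x‖ ^ 2 * ‖partialDeriv l ψ x‖ ^ 2 = ‖partialDeriv l ψ x * conj (ψ x)‖ ^ 2 := by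
    rw [norm_mul, RCLike.norm_conj]; ring
  rw [h, ← Complex.normSq_eq_norm_sq, Complex.normSq_apply]
  ring

lemma gradient_apply {f : Space d → ℝ} (l : Fin d) (x : Space d) :
    gradient f x l = partialDeriv l f x := by
  have h : inner ℝ (gradient f x) (EuclideanSpace.single l (1 : ℝ)) = partialDeriv l f x := by
    rw [gradient, InnerProductSpace.toDual_symm_apply]
    rfl
  rw [← h, inner_single_eq]

lemma partialDeriv_mul {f g : Space d → ℝ} (hf : ContDiff ℝ 1 f) (hg : ContDiff ℝ 1 g)
    (l : Fin d) (x : Space d) : partialDeriv l (fun x => f x * g x) x =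
      partialDeriv l f x * g x + f x * partialDeriv l g x := by
  rw [partialDeriv, fderiv_fun_mul (hf.differentiable one_ne_zero x)
    (hg.differentiable one_ne_zero x)]
  simp only [add_apply, smul_apply, smul_eq_mul, partialDeriv]
  ring

/-- The energy balance of a single wave function, tested against the density. -/
theorem energy_density_identity (hψ : ContDiff ℝ 1 ψ) (hL : MemLp ψ 2 volume) {h : ℝ}
    (hh : 0 < h) {m : ℝ} (hm : 0 < m) {ρ E : Space d → ℝ} {J : Space d → Space d}
    (hρc : Continuous ρ) (hρ : IsDensity (wignerAction h ψ) ρ)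
    (hJ : IsCurrent m (wignerAction h ψ) J)
    (hE : IsKineticEnergy m (wignerAction h ψ) E) {φ : Space d → ℝ} (hφ : ContDiff ℝ ∞ φ)
    (hφc : HasCompactSupport φ) :
    2 * m * ∫ x, E x * (φ x * ρ x) = m ^ 2 * (∫ x, φ x * ‖J x‖ ^ 2) +
      (h ^ 2 / 2 * (∫ x, φ x * ‖gradient ρ x‖ ^ 2) +
      h ^ 2 / 4 * ∫ x, ρ x * inner ℝ (gradient φ x) (gradient ρ x)) := by
  have hρeq : ρ = fun x => ‖ψ x‖ ^ 2 :=
    funext (density_wigner_eq hψ.continuous hL hh hρc hρ)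
  have hρ1 : ContDiff ℝ 1 ρ := by rw [hρeq]; exact contDiff_norm_sq hψ
  have hφ1 : ContDiff ℝ 1 φ := hφ.of_le (by simp)
  have hφ' := hφ.continuous
  have hDψ := continuous_partialDeriv hψ
  have hDρ := continuous_partialDeriv hρ1
  have hDφ := continuous_partialDeriv hφ1
  have hψ' := hψ.continuous
  have him := Complex.continuous_im
  have hconj : Continuous fun z : ℂ => conj z := Complex.continuous_conj
  -- The test function is `φρ`, only `C¹`; this is the reason for extending the energy identity
  -- beyond smooth test functions.
  have key := energy_wigner_eq_of_contDiff_one hψ hL hh hm hE (hφ1.mul hρ1) hφc.mul_right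
  rw [← hρeq] at key
  rw [key]
  have iJ : ∀ l, Integrable fun x => φ x * (h * (partialDeriv l ψ x * conj (ψ x)).im) ^ 2 := by
    intro l
    have := hDψ l
    exact continuous_compactSupport_mul_integrable hφ' hφc (by fun_prop)
  have iG : ∀ l, Integrable fun x => φ x * partialDeriv l ρ x ^ 2 := fun l =>
    continuous_compactSupport_mul_integrable hφ' hφc ((hDρ l).pow 2)
  have iM : ∀ l, Integrable fun x => partialDeriv l φ x * (ρ x * partialDeriv l ρ x) := fun l =>
    continuous_compactSupport_mul_integrable (hDφ l) (hasCompactSupport_partialDeriv hφc l)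
      (hρc.mul (hDρ l))
  have e1 : m ^ 2 * (∫ x, φ x * ‖J x‖ ^ 2) =
      ∑ l, ∫ x, φ x * (h * (partialDeriv l ψ x * conj (ψ x)).im) ^ 2 := by
    rw [← integral_finsetSum _ fun l _ => iJ l, ← integral_const_mul]
    refine integral_congr_ae ?_
    filter_upwards [ae_all_iff.2 fun l => current_wigner_eq hψ hL hh hm hJ l] with x hx
    rw [EuclideanSpace.norm_sq_eq, Finset.mul_sum, Finset.mul_sum]
    refine Finset.sum_congr rfl fun l _ => ?_
    rw [hx l, Real.norm_eq_abs, sq_abs]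
    field_simp
  have e2 : ∫ x, φ x * ‖gradient ρ x‖ ^ 2 = ∑ l, ∫ x, φ x * partialDeriv l ρ x ^ 2 := by
    rw [← integral_finsetSum _ fun l _ => iG l]
    congr 1; ext x
    rw [EuclideanSpace.norm_sq_eq, Finset.mul_sum]
    refine Finset.sum_congr rfl fun l _ => ?_
    rw [gradient_apply, Real.norm_eq_abs, sq_abs]
  have e3 : ∫ x, ρ x * inner ℝ (gradient φ x) (gradient ρ x) =
      ∑ l, ∫ x, partialDeriv l φ x * (ρ x * partialDeriv l ρ x) := by
    rw [← integral_finsetSum _ fun l _ => iM l]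
    congr 1; ext x
    rw [PiLp.inner_apply, Finset.mul_sum]
    refine Finset.sum_congr rfl fun l _ => ?_
    rw [gradient_apply, gradient_apply]
    simp only [RCLike.inner_apply, conj_trivial]
    ring
  rw [e1, e2, e3, Finset.mul_sum, Finset.mul_sum, ← Finset.sum_add_distrib,
    ← Finset.sum_add_distrib]
  refine Finset.sum_congr rfl fun l _ => ?_
  -- The factor `ρ` splits `ρ|∂ψ|²` into current and density gradient without dividing by `ρ`. The
  -- term `(ℏ²/4)φ|∂ρ|²` found here adds to the one from differentiating `φρ`, whence the
  -- coefficient `ℏ²/2`.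
  have e4 : h ^ 2 * ∫ x, φ x * ρ x * ‖partialDeriv l ψ x‖ ^ 2 =
      (∫ x, φ x * (h * (partialDeriv l ψ x * conj (ψ x)).im) ^ 2) +
        h ^ 2 / 4 * ∫ x, φ x * partialDeriv l ρ x ^ 2 := by
    rw [← integral_const_mul, ← integral_const_mul, ← integral_add (iJ l) ((iG l).const_mul _)]
    congr 1; ext x
    have := norm_sq_mul_norm_partialDeriv_sq hψ l x
    rw [mul_assoc, hρeq, this]
    ring
  have e5 : ∫ x, partialDeriv l (fun x => φ x * ρ x) x * partialDeriv l ρ x =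
      (∫ x, partialDeriv l φ x * (ρ x * partialDeriv l ρ x)) +
        ∫ x, φ x * partialDeriv l ρ x ^ 2 := by
    rw [← integral_add (iM l) (iG l)]
    congr 1; ext x
    rw [partialDeriv_mul hφ1 hρ1]
    ring
  rw [e4, e5]
  ring

end EnergyBalance

end Semiclassical

/-! ### Limits of products in `L²` -/

namespace Semiclassical

section L2Limits

lemma tendsto_integral_inner_of_tendsto_L2 {α F : Type*} [MeasurableSpace α]
    [NormedAddCommGroup F] [InnerProductSpace ℝ F] {μ : Measure α} {f g : ℕ → α → F} {f' g' : α → F}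
    (hf : ∀ n, MemLp (f n) 2 μ) (hf' : MemLp f' 2 μ) (hg : ∀ n, MemLp (g n) 2 μ)
    (hg' : MemLp g' 2 μ) (hfl : Tendsto (fun n => eLpNorm (f n - f') 2 μ) atTop (𝓝 0))
    (hgl : Tendsto (fun n => eLpNorm (g n - g') 2 μ) atTop (𝓝 0)) :
    Tendsto (fun n => ∫ x, inner ℝ (f n x) (g n x) ∂μ) atTop (𝓝 (∫ x, inner ℝ (f' x) (g' x) ∂μ)) := by
  have h1 := (Lp.tendsto_Lp_iff_tendsto_eLpNorm'' f hf f' hf').2 hfl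
  have h2 := (Lp.tendsto_Lp_iff_tendsto_eLpNorm'' g hg g' hg').2 hgl
  have h3 := h1.inner (𝕜 := ℝ) h2
  have h4 : ∀ (a b : α → F) (ha : MemLp a 2 μ) (hb : MemLp b 2 μ),
      inner ℝ (ha.toLp a) (hb.toLp b) = ∫ x, inner ℝ (a x) (b x) ∂μ := by
    intro a b ha hb
    rw [L2.inner_def]
    refine integral_congr_ae ?_
    filter_upwards [ha.coeFn_toLp, hb.coeFn_toLp] with x h5 h6
    rw [h5, h6]
  simpa only [h4] using h3

/-- Banach–Steinhaus bounds the weakly convergent sequence in norm. The error from replacing the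
strong sequence by its limit is then at most a constant times its `L²` distance to that limit. -/
lemma tendsto_integral_mul_weak_strong {d : ℕ} {f g : ℕ → Space d → ℝ} {f' g' : Space d → ℝ}
    (hf : TendstoWeaklyL2 f f') (hg : ∀ n, MemLp (g n) 2 volume) (hg' : MemLp g' 2 volume)
    (hgl : Tendsto (fun n => eLpNorm (g n - g') 2 volume) atTop (𝓝 0)) :
    Tendsto (fun n => ∫ x, f n x * g n x) atTop (𝓝 (∫ x, f' x * g' x)) := by
  obtain ⟨hfL, hf'L, hweak⟩ := hf
  have h4 : ∀ (a b : Space d → ℝ) (ha : MemLp a 2 volume) (hb : MemLp b 2 volume),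
      inner ℝ (ha.toLp a) (hb.toLp b) = ∫ x, a x * b x := by
    intro a b ha hb
    rw [L2.inner_def]
    refine integral_congr_ae ?_
    filter_upwards [ha.coeFn_toLp, hb.coeFn_toLp] with x h5 h6
    rw [h5, h6]
    simp [mul_comm]
  let F : ℕ → Lp ℝ 2 (volume : Measure (Space d)) := fun n => (hfL n).toLp (f n)
  have hw : ∀ u : Lp ℝ 2 (volume : Measure (Space d)),
      Tendsto (fun n => inner ℝ (F n) u) atTop (𝓝 (inner ℝ (hf'L.toLp f') u)) := by
    intro u
    have hu := Lp.memLp u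
    have h5 := hweak u hu
    have h7 : ∀ (a : Space d → ℝ) (ha : MemLp a 2 volume),
        ∫ x, a x * u x = inner ℝ (ha.toLp a) u := fun a ha => by
      rw [← h4 a u ha hu, Lp.toLp_coeFn]
    rw [h7 f' hf'L] at h5
    exact h5.congr fun n => h7 (f n) (hfL n)
  have hbd : ∃ C, ∀ n, ‖innerSL ℝ (F n)‖ ≤ C := by
    refine banach_steinhaus fun u => ?_
    obtain ⟨C, hC⟩ := (hw u).norm.bddAbove_range
    exact ⟨C, fun n => hC ⟨n, rfl⟩⟩
  obtain ⟨C, hC⟩ := hbd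
  have hG := (Lp.tendsto_Lp_iff_tendsto_eLpNorm'' g hg g' hg').2 hgl
  have h5 : Tendsto (fun n => inner ℝ (F n) ((hg n).toLp (g n) - hg'.toLp g')) atTop (𝓝 0) := by
    refine squeeze_zero_norm (a := fun n => C * ‖(hg n).toLp (g n) - hg'.toLp g'‖) (fun n => ?_) ?_
    · refine (norm_inner_le_norm _ _).trans ?_
      gcongr
      rw [← innerSL_apply_norm ℝ (F n)]
      exact hC n
    · have := (tendsto_iff_norm_sub_tendsto_zero.1 hG).const_mul C
      simpa using this
  have h6 := h5.add (hw (hg'.toLp g'))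
  rw [zero_add, h4 f' g' hf'L hg'] at h6
  refine h6.congr fun n => ?_
  rw [← inner_add_right, sub_add_cancel]
  exact h4 _ _ _ _

lemma memLp_mul_of_support {d : ℕ} {φ f : Space d → ℝ} {R B : ℝ} (hφ : Continuous φ)
    (hB : ∀ x, |φ x| ≤ B) (hR : ∀ x, R ≤ ‖x‖ → φ x = 0)
    (hf : MemLp f 2 (volume.restrict (Metric.ball 0 R))) :
    MemLp (fun x => φ x * f x) 2 volume ∧ eLpNorm (fun x => φ x * f x) 2 volume ≤
      ENNReal.ofReal B * eLpNorm f 2 (volume.restrict (Metric.ball 0 R)) := by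
  have h1 : (fun x => φ x * f x) = fun x => φ x * (Metric.ball (0 : Space d) R).indicator f x := by
    ext x
    by_cases hx : x ∈ Metric.ball (0 : Space d) R
    · rw [Set.indicator_of_mem hx]
    · rw [hR x (by simpa using hx), zero_mul, zero_mul]
  have h2 : MemLp ((Metric.ball (0 : Space d) R).indicator f) 2 volume :=
    (memLp_indicator_iff_restrict measurableSet_ball).2 hf
  have h3 : ∀ x, ‖φ x * (Metric.ball (0 : Space d) R).indicator f x‖ ≤
      B * ‖(Metric.ball (0 : Space d) R).indicator f x‖ := fun x => by
    rw [norm_mul]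
    exact mul_le_mul_of_nonneg_right (hB x) (norm_nonneg _)
  rw [h1]
  refine ⟨h2.of_le_mul (hφ.aestronglyMeasurable.mul h2.1) (Eventually.of_forall h3), ?_⟩
  rw [← eLpNorm_indicator_eq_eLpNorm_restrict measurableSet_ball]
  exact eLpNorm_le_mul_eLpNorm_of_ae_le_mul (Eventually.of_forall h3) 2

lemma exists_ball_support {d : ℕ} {F : Type*} [Zero F] {φ : Space d → F}
    (hφc : HasCompactSupport φ) : ∃ R, 0 < R ∧ ∀ x, R ≤ ‖x‖ → φ x = 0 := by
  obtain ⟨R, hR0, hR⟩ := exists_support_radius hφc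
  exact ⟨R + 1, by linarith, fun x hx => hR x (by linarith)⟩

lemma integral_eq_setIntegral_ball {d : ℕ} {f : Space d → ℝ} {R : ℝ}
    (hR : ∀ x, R ≤ ‖x‖ → f x = 0) : ∫ x in Metric.ball (0 : Space d) R, f x = ∫ x, f x :=
  setIntegral_eq_integral_of_forall_compl_eq_zero fun x hx => hR x (by simpa using hx)

lemma integral_norm_sq_eq_toReal {α F : Type*} [MeasurableSpace α] [NormedAddCommGroup F]
    {μ : Measure α} {f : α → F} (hf : MemLp f 2 μ) :
    ∫ x, ‖f x‖ ^ 2 ∂μ = (eLpNorm f 2 μ).toReal ^ 2 := by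
  have h := hf.eLpNorm_eq_integral_rpow_norm (by norm_num) (by norm_num)
  have h0 : 0 ≤ ∫ x, ‖f x‖ ^ 2 ∂μ := integral_nonneg fun x => by positivity
  have h3 : ∫ x, ‖f x‖ ^ (2 : ENNReal).toReal ∂μ = ∫ x, ‖f x‖ ^ 2 ∂μ := by
    congr 1; ext x; norm_num
  rw [h, h3, ENNReal.toReal_ofReal (by positivity), ← Real.rpow_natCast, ← Real.rpow_mul h0]
  norm_num

lemma locallyIntegrable_of_integrableOn_ball {d : ℕ} {F : Type*} [NormedAddCommGroup F]
    {f : Space d → F} (hf : ∀ r : ℝ, 0 < r → IntegrableOn f (Metric.ball 0 r)) :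
    LocallyIntegrable f volume := by
  rw [locallyIntegrable_iff]
  intro k hk
  obtain ⟨r, hr⟩ := hk.isBounded.subset_ball 0
  exact (hf (max r 1) (by positivity)).mono_set
    (hr.trans (Metric.ball_subset_ball (le_max_left _ _)))

end L2Limits

end Semiclassical

/-! ### Passing to the limit in the energy balance -/

namespace Semiclassical

section SemiclassicalLimit

variable {d : ℕ}

lemma ae_of_forall_ball {P : Space d → Prop}
    (h : ∀ r : ℝ, 0 < r → ∀ᵐ x ∂(volume.restrict (Metric.ball (0 : Space d) r)), P x) :
    ∀ᵐ x : Space d, P x := by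
  have h1 : ∀ᵐ x : Space d, ∀ n : ℕ, x ∈ Metric.ball (0 : Space d) ((n : ℝ) + 1) → P x :=
    ae_all_iff.2 fun n => (ae_restrict_iff' measurableSet_ball).1 (h _ (by positivity))
  filter_upwards [h1] with x hx
  obtain ⟨n, hn⟩ := exists_nat_gt ‖x‖
  exact hx n (by simp; linarith)

lemma TendstoL2Loc.ae_nonneg {f : ℕ → Space d → ℝ} {g : Space d → ℝ} (h : TendstoL2Loc f g)
    (hf : ∀ n x, 0 ≤ f n x) : ∀ᵐ x, 0 ≤ g x := by
  refine ae_of_forall_ball fun r hr => ?_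
  obtain ⟨h1, h2, h3⟩ := h r hr
  obtain ⟨ns, -, hns⟩ := (tendstoInMeasure_of_tendsto_eLpNorm two_ne_zero
    (fun n => (h1 n).1) h2.1 h3).exists_seq_tendsto_ae
  filter_upwards [hns] with x hx
  exact ge_of_tendsto' hx fun n => hf _ _

lemma TendstoL2Loc.locallyIntegrable {F : Type*} [NormedAddCommGroup F]
    {f : ℕ → Space d → F} {g : Space d → F} (h : TendstoL2Loc f g) :
    LocallyIntegrable g volume := by
  refine locallyIntegrable_of_integrableOn_ball fun r hr => ?_
  have : IsFiniteMeasure (volume.restrict (Metric.ball (0 : Space d) r)) :=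
    ⟨by simpa using measure_ball_lt_top⟩
  exact (h r hr).2.1.integrable one_le_two

/-- On each ball `L²` convergence can be tested against `1`, so the limit has mass at most `M`
there. Exhausting the space by balls gives integrability, although the convergence is only local. -/
lemma TendstoL2Loc.integrable_of_integral_le {f : ℕ → Space d → ℝ} {g : Space d → ℝ}
    (h : TendstoL2Loc f g) (hf : ∀ n x, 0 ≤ f n x) (hfi : ∀ n, Integrable (f n) volume) {M : ℝ}
    (hM : ∀ n, ∫ x, f n x ≤ M) : Integrable g volume := by
  have hcov : AECover (volume : Measure (Space d)) atTop
      (fun n : ℕ => Metric.ball (0 : Space d) ((n : ℝ) + 1)) :=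
    aecover_ball (tendsto_atTop_add_const_right _ _ tendsto_natCast_atTop_atTop)
  refine hcov.integrable_of_integral_norm_bounded M (fun n => ?_) (Eventually.of_forall fun n => ?_)
  · have : IsFiniteMeasure (volume.restrict (Metric.ball (0 : Space d) ((n : ℝ) + 1))) :=
      ⟨by simpa using measure_ball_lt_top⟩
    exact (h _ (by positivity)).2.1.integrable one_le_two
  · have : IsFiniteMeasure (volume.restrict (Metric.ball (0 : Space d) ((n : ℝ) + 1))) :=
      ⟨by simpa using measure_ball_lt_top⟩
    obtain ⟨h1, h2, h3⟩ := h ((n : ℝ) + 1) (by positivity)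
    have h4 := tendsto_integral_inner_of_tendsto_L2 h1 h2
      (g := fun _ _ => (1 : ℝ)) (g' := fun _ => 1) (fun _ => memLp_const 1) (memLp_const 1) h3
      (by simp)
    have h5 : ∀ᵐ x ∂(volume.restrict (Metric.ball (0 : Space d) ((n : ℝ) + 1))), ‖g x‖ = g x :=
      ae_restrict_of_ae ((h.ae_nonneg hf).mono fun x hx => Real.norm_of_nonneg hx)
    rw [integral_congr_ae h5]
    simp only [RCLike.inner_apply, one_mul, conj_trivial] at h4
    refine le_of_tendsto' h4 fun k => ?_
    refine (setIntegral_le_integral (hfi k) (Eventually.of_forall (hf k))).trans (hM k)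

lemma tendsto_sq_mul_integral_norm_sq {F : Type*} [NormedAddCommGroup F] {μ : Measure (Space d)}
    {h : ℕ → ℝ} (hh : ∀ n, 0 < h n) {G : ℕ → Space d → F} (hG : ∀ n, MemLp (G n) 2 μ)
    (hlim : Tendsto (fun n => ENNReal.ofReal (h n) * eLpNorm (G n) 2 μ) atTop (𝓝 0)) :
    Tendsto (fun n => h n ^ 2 * ∫ x, ‖G n x‖ ^ 2 ∂μ) atTop (𝓝 0) := by
  have h1 := ((ENNReal.tendsto_toReal ENNReal.zero_ne_top).comp hlim).pow 2
  simp only [ENNReal.toReal_zero, ne_eq, OfNat.ofNat_ne_zero, not_false_eq_true, zero_pow] at h1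
  refine h1.congr fun n => ?_
  rw [integral_norm_sq_eq_toReal (hG n), Function.comp_apply, ENNReal.toReal_mul,
    ENNReal.toReal_ofReal (hh n).le]
  ring

lemma memLp_ball_of_continuous {F : Type*} [NormedAddCommGroup F] {f : Space d → F}
    (hf : Continuous f) (r : ℝ) (p : ℝ≥0∞) :
    MemLp f p (volume.restrict (Metric.ball (0 : Space d) r)) := by
  have : IsFiniteMeasure (volume.restrict (Metric.ball (0 : Space d) r)) :=
    ⟨by simpa using measure_ball_lt_top⟩
  obtain ⟨B, -, hB⟩ := exists_bound_on_ball hf r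
  refine MemLp.of_bound hf.aestronglyMeasurable B ?_
  refine (ae_restrict_iff' measurableSet_ball).2 (Eventually.of_forall fun x hx => hB x ?_)
  exact (mem_ball_zero_iff.1 hx).le

lemma continuous_gradient {f : Space d → ℝ} (hf : ContDiff ℝ 1 f) : Continuous (gradient f) :=
  (InnerProductSpace.toDual ℝ (Space d)).symm.continuous.comp (hf.continuous_fderiv one_ne_zero)

/-- The quadratic term is `O(‖ℏ∇f‖²)` on a ball. By Young's inequality the cross term is bounded by
the same quantity plus `ℏ²‖f‖²`, and the latter vanishes because `f n` converges in `L²` on that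
ball. -/
lemma tendsto_gradient_terms {h : ℕ → ℝ} (hh : ∀ n, 0 < h n) (hlim : Tendsto h atTop (𝓝 0))
    {f : ℕ → Space d → ℝ} {g : Space d → ℝ} (hf : ∀ n, ContDiff ℝ 1 (f n))
    (hgrad : ∀ r : ℝ, 0 < r → Tendsto (fun n => ENNReal.ofReal (h n) *
      eLpNorm (gradient (f n)) 2 (volume.restrict (Metric.ball 0 r))) atTop (𝓝 0))
    (hfg : TendstoL2Loc f g) {φ : Space d → ℝ} (hφ : ContDiff ℝ ∞ φ)
    (hφc : HasCompactSupport φ) :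
    Tendsto (fun n => h n ^ 2 / 2 * (∫ x, φ x * ‖gradient (f n) x‖ ^ 2) +
      h n ^ 2 / 4 * ∫ x, f n x * inner ℝ (gradient φ x) (gradient (f n) x)) atTop (𝓝 0) := by
  obtain ⟨R₁, hR₁, hφ0⟩ := exists_ball_support hφc
  obtain ⟨R₂, -, hdφ0⟩ := exists_ball_support (hφc.fderiv ℝ)
  set R := max R₁ R₂
  have hR0 : 0 < R := hR₁.trans_le (le_max_left _ _)
  have hφR : ∀ x, R ≤ ‖x‖ → φ x = 0 := fun x hx => hφ0 x ((le_max_left _ _).trans hx)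
  have hgR : ∀ x, R ≤ ‖x‖ → gradient φ x = 0 := fun x hx => by
    rw [gradient, hdφ0 x ((le_max_right _ _).trans hx), map_zero]
  obtain ⟨B, hB0, hB⟩ := exists_bound_on_ball hφ.continuous R
  obtain ⟨C, hC0, hC⟩ := exists_bound_on_ball (continuous_gradient (hφ.of_le (by simp))) R
  have hball : ∀ᵐ x ∂(volume.restrict (Metric.ball (0 : Space d) R)), ‖x‖ ≤ R :=
    (ae_restrict_iff' measurableSet_ball).2
      (Eventually.of_forall fun x hx => (mem_ball_zero_iff.1 hx).le)
  have hGL := fun n => memLp_ball_of_continuous (continuous_gradient (hf n)) R 2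
  have hfL := fun n => memLp_ball_of_continuous (hf n).continuous R 2
  have hGi : ∀ n, Integrable (fun x => ‖gradient (f n) x‖ ^ 2)
      (volume.restrict (Metric.ball 0 R)) := fun n => (hGL n).integrable_norm_pow two_ne_zero
  have hfi : ∀ n, Integrable (fun x => ‖f n x‖ ^ 2)
      (volume.restrict (Metric.ball 0 R)) := fun n => (hfL n).integrable_norm_pow two_ne_zero
  have hG := tendsto_sq_mul_integral_norm_sq hh hGL (hgrad R hR0)
  obtain ⟨-, hg, hl⟩ := hfg R hR0
  have hf2 := (hlim.pow 2).mul (tendsto_integral_inner_of_tendsto_L2 hfL hg hfL hg hl hl)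
  simp only [ne_eq, OfNat.ofNat_ne_zero, not_false_eq_true, zero_pow, zero_mul,
    real_inner_self_eq_norm_sq] at hf2
  refine squeeze_zero_norm (a := fun n => (B / 2 + C / 4) *
    (h n ^ 2 * ∫ x in Metric.ball 0 R, ‖gradient (f n) x‖ ^ 2) + C / 4 *
      (h n ^ 2 * ∫ x in Metric.ball 0 R, ‖f n x‖ ^ 2)) (fun n => ?_) ?_
  · have h1 : ‖∫ x, φ x * ‖gradient (f n) x‖ ^ 2‖ ≤
        B * ∫ x in Metric.ball 0 R, ‖gradient (f n) x‖ ^ 2 := by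
      rw [← integral_eq_setIntegral_ball (R := R) (fun x hx => by rw [hφR x hx, zero_mul]),
        ← integral_const_mul]
      refine norm_integral_le_of_norm_le ((hGi n).const_mul B) ?_
      filter_upwards [hball] with x hx
      rw [norm_mul, norm_pow, norm_norm]
      exact mul_le_mul_of_nonneg_right (hB x hx) (by positivity)
    have h2 : ‖∫ x, f n x * inner ℝ (gradient φ x) (gradient (f n) x)‖ ≤
        C * ((∫ x in Metric.ball 0 R, ‖f n x‖ ^ 2) +
          ∫ x in Metric.ball 0 R, ‖gradient (f n) x‖ ^ 2) := by
      rw [← integral_eq_setIntegral_ball (R := R)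
        (fun x hx => by rw [hgR x hx, inner_zero_left, mul_zero]),
        ← integral_add (hfi n) (hGi n), ← integral_const_mul]
      refine norm_integral_le_of_norm_le (((hfi n).add (hGi n)).const_mul C) ?_
      filter_upwards [hball] with x hx
      rw [norm_mul]
      calc ‖f n x‖ * ‖inner ℝ (gradient φ x) (gradient (f n) x)‖
          ≤ ‖f n x‖ * (C * ‖gradient (f n) x‖) := by
            gcongr
            exact (norm_inner_le_norm _ _).trans
              (mul_le_mul_of_nonneg_right (hC x hx) (norm_nonneg _))
        _ = C * (‖f n x‖ * ‖gradient (f n) x‖) := by ring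
        _ ≤ C * (‖f n x‖ ^ 2 + ‖gradient (f n) x‖ ^ 2) := by
            gcongr
            nlinarith [sq_nonneg (‖f n x‖ - ‖gradient (f n) x‖), sq_nonneg (‖f n x‖),
              sq_nonneg (‖gradient (f n) x‖)]
    refine (norm_add_le _ _).trans ?_
    rw [norm_mul, norm_mul, Real.norm_of_nonneg (by positivity : 0 ≤ h n ^ 2 / 2),
      Real.norm_of_nonneg (by positivity : 0 ≤ h n ^ 2 / 4)]
    have h3 := mul_le_mul_of_nonneg_left h1 (by positivity : 0 ≤ h n ^ 2 / 2)
    have h4 := mul_le_mul_of_nonneg_left h2 (by positivity : 0 ≤ h n ^ 2 / 4)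
    linarith
  · simpa using (hG.const_mul (B / 2 + C / 4)).add (hf2.const_mul (C / 4))

/-- The relation between density, current and energy of the Wigner functions passes to the limit. -/
theorem energy_density_limit {m : ℝ} (hm : 0 < m) {h : ℕ → ℝ} (hh : ∀ n, 0 < h n)
    (hlim : Tendsto h atTop (𝓝 0)) {ψ : ℕ → Space d → ℂ} (hψ : ∀ n, ContDiff ℝ 1 (ψ n))
    (hL : ∀ n, MemLp (ψ n) 2 volume)
    {ρn : ℕ → Space d → ℝ} {Jn : ℕ → Space d → Space d} {En : ℕ → Space d → ℝ}
    (hρc : ∀ n, Continuous (ρn n)) (hρn : ∀ n, IsDensity (wignerAction (h n) (ψ n)) (ρn n))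
    (hJn : ∀ n, IsCurrent m (wignerAction (h n) (ψ n)) (Jn n))
    (hEn : ∀ n, IsKineticEnergy m (wignerAction (h n) (ψ n)) (En n))
    {ρ : Space d → ℝ} {J : Space d → Space d} {E : Space d → ℝ}
    (hgrad : ∀ r : ℝ, 0 < r → Tendsto (fun n => ENNReal.ofReal (h n) *
      eLpNorm (gradient (ρn n)) 2 (volume.restrict (Metric.ball 0 r))) atTop (𝓝 0))
    (hE : TendstoWeaklyL2 En E) (hρ : TendstoL2Loc ρn ρ) (hJ : TendstoL2Loc Jn J) :
    ∀ᵐ x, 2 * m * (E x * ρ x) = m ^ 2 * ‖J x‖ ^ 2 := by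
  have hsq : ∀ n, ρn n = fun x => ‖ψ n x‖ ^ 2 := fun n =>
    funext (density_wigner_eq (hψ n).continuous (hL n) (hh n) (hρc n) (hρn n))
  have hρ1 : ∀ n, ContDiff ℝ 1 (ρn n) := fun n => by
    rw [hsq n]
    exact contDiff_norm_sq (hψ n)
  have hEρ : LocallyIntegrable (fun x => E x * ρ x) volume :=
    locallyIntegrable_of_integrableOn_ball fun r hr =>
      (hE.2.1.restrict _).integrable_mul (hρ r hr).2.1
  have hJ2 : LocallyIntegrable (fun x => ‖J x‖ ^ 2) volume :=
    locallyIntegrable_of_integrableOn_ball fun r hr =>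
      (hJ r hr).2.1.integrable_norm_pow two_ne_zero
  refine ae_eq_of_integral_contDiff_smul_eq (hEρ.smul (2 * m)) (hJ2.smul (m ^ 2))
    fun φ hφ hφc => ?_
  obtain ⟨R, hR0, hR⟩ := exists_ball_support hφc
  obtain ⟨B, hB0, hB⟩ := exists_bound_of_compactSupport hφ.continuous hφc
  obtain ⟨hρnR, hρR, hρl⟩ := hρ R hR0
  obtain ⟨hJnR, hJR, hJl⟩ := hJ R hR0
  have hmul : ∀ {f : Space d → ℝ}, MemLp f 2 (volume.restrict (Metric.ball 0 R)) →
      MemLp (fun x => φ x * f x) 2 volume ∧ eLpNorm (fun x => φ x * f x) 2 volume ≤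
        ENNReal.ofReal B * eLpNorm f 2 (volume.restrict (Metric.ball 0 R)) :=
    fun hf => memLp_mul_of_support hφ.continuous hB hR hf
  have hzero : Tendsto (fun n => ENNReal.ofReal B *
      eLpNorm (ρn n - ρ) 2 (volume.restrict (Metric.ball 0 R))) atTop (𝓝 0) := by
    simpa using ENNReal.Tendsto.const_mul hρl (Or.inr ENNReal.ofReal_ne_top)
  have hT1 : Tendsto (fun n => ∫ x, En n x * (φ x * ρn n x)) atTop
      (𝓝 (∫ x, E x * (φ x * ρ x))) := by
    -- Multiplication by `φ` upgrades the local strong convergence of the densities to convergence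
    -- in `L²(ℝ^d)`, as required for pairing with the weakly convergent energies.
    refine tendsto_integral_mul_weak_strong hE (fun n => (hmul (hρnR n)).1) (hmul hρR).1 ?_
    refine tendsto_of_tendsto_of_tendsto_of_le_of_le tendsto_const_nhds hzero (fun n => zero_le)
      fun n => ?_
    refine le_trans (le_of_eq ?_) (hmul ((hρnR n).sub hρR)).2
    congr 1
    ext x
    simp only [Pi.sub_apply]
    ring
  have hT2 : Tendsto (fun n => ∫ x, φ x * ‖Jn n x‖ ^ 2) atTop (𝓝 (∫ x, φ x * ‖J x‖ ^ 2)) := by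
    have hmulJ : ∀ {f : Space d → Space d}, MemLp f 2 (volume.restrict (Metric.ball 0 R)) →
        MemLp (fun x => φ x • f x) 2 (volume.restrict (Metric.ball 0 R)) := fun hf =>
      hf.of_le_mul (hφ.continuous.aestronglyMeasurable.smul hf.1)
        (Eventually.of_forall fun x => by
          rw [norm_smul]; exact mul_le_mul_of_nonneg_right (hB x) (norm_nonneg _))
    have hzeroJ : Tendsto (fun n => ENNReal.ofReal B *
        eLpNorm (Jn n - J) 2 (volume.restrict (Metric.ball 0 R))) atTop (𝓝 0) := by
      simpa using ENNReal.Tendsto.const_mul hJl (Or.inr ENNReal.ofReal_ne_top)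
    have := tendsto_integral_inner_of_tendsto_L2 (f := fun n x => φ x • Jn n x)
      (f' := fun x => φ x • J x) (fun n => hmulJ (hJnR n)) (hmulJ hJR) hJnR hJR
      (tendsto_of_tendsto_of_tendsto_of_le_of_le tendsto_const_nhds hzeroJ (fun n => zero_le)
        fun n => eLpNorm_le_mul_eLpNorm_of_ae_le_mul (Eventually.of_forall fun x => by
          rw [Pi.sub_apply, Pi.sub_apply, ← smul_sub, norm_smul]
          exact mul_le_mul_of_nonneg_right (hB x) (norm_nonneg _)) 2) hJl
    simp only [real_inner_smul_left, real_inner_self_eq_norm_sq] at this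
    rw [integral_eq_setIntegral_ball (fun x hx => by rw [hR x hx, zero_mul])] at this
    refine this.congr fun n => ?_
    exact integral_eq_setIntegral_ball (fun x hx => by rw [hR x hx, zero_mul])
  have hT3 := tendsto_gradient_terms hh hlim hρ1 hgrad hρ hφ hφc
  have hT4 : Tendsto (fun n => 2 * m * ∫ x, En n x * (φ x * ρn n x)) atTop
      (𝓝 (m ^ 2 * (∫ x, φ x * ‖J x‖ ^ 2))) := by
    have := (hT2.const_mul (m ^ 2)).add hT3
    rw [add_zero] at this
    exact this.congr fun n => (energy_density_identity (hψ n) (hL n) (hh n) hm (hρc n) (hρn n)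
      (hJn n) (hEn n) hφ hφc).symm
  have hfin := tendsto_nhds_unique (hT1.const_mul (2 * m)) hT4
  rw [← integral_const_mul, ← integral_const_mul] at hfin
  calc _ = ∫ x, 2 * m * (E x * (φ x * ρ x)) := by
        congr 1; ext x; simp only [smul_eq_mul]; ring
    _ = _ := hfin
    _ = _ := by congr 1; ext x; simp only [smul_eq_mul]; ring

end SemiclassicalLimit

end Semiclassical

/-! ### Comparison of a nonnegative distribution with a graph -/

namespace Semiclassical

section Monokinetic

variable {d : ℕ}

/-- A Schwartz function is determined by its values. This applies positivity to linear combinations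
of cutoff tests once their pointwise sum is seen to be nonnegative. -/
lemma nonneg_of_apply_eq {E : Type*} [NormedAddCommGroup E] [NormedSpace ℝ E]
    {w : 𝓢(E, ℂ) →ₗ[ℂ] ℂ}
    (hw : ∀ (f : E → ℝ) (hf : ContDiff ℝ ∞ f) (hfc : HasCompactSupport f), (∀ z, 0 ≤ f z) →
      0 ≤ (w (realSchwartz f hf hfc)).re ∧ (w (realSchwartz f hf hfc)).im = 0)
    (S : 𝓢(E, ℂ)) {F : E → ℝ} (hS : ∀ z, S z = (F z : ℂ)) (hFc : HasCompactSupport F)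
    (hF : ∀ z, 0 ≤ F z) : 0 ≤ (w S).re ∧ (w S).im = 0 := by
  have hFS : F = fun z => (S z).re := by
    ext z
    rw [hS, Complex.ofReal_re]
  have hFd : ContDiff ℝ ∞ F := by
    rw [hFS]
    exact Complex.reCLM.contDiff.comp (S.smooth _)
  have h : S = realSchwartz F hFd hFc := by
    ext z
    rw [hS, realSchwartz_apply]
  rw [h]
  exact hw F hFd hFc hF

lemma cutoffTest_eq {p φ χ : Space d → ℝ} (hp : ContDiff ℝ ∞ p)
    (hφ : ContDiff ℝ ∞ φ) (hφc : HasCompactSupport φ)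
    (hχ : ContDiff ℝ ∞ χ) (hχc : HasCompactSupport χ) (n : ℕ) (z : Space d × Space d) :
    cutoffTest hp hφ hφc hχ hχc n z =
      ((φ z.1 * p z.2 * χ (((n : ℝ) + 1)⁻¹ • z.2) : ℝ) : ℂ) := rfl

/-- A smooth cutoff that equals `1` on the unit ball. -/
lemma exists_cutoff_unit_ball (d : ℕ) : ∃ χ : Space d → ℝ, ContDiff ℝ ∞ χ ∧ HasCompactSupport χ ∧
    (∀ v, 0 ≤ χ v) ∧ (∀ v, χ v ≤ 1) ∧ (∀ v, ‖v‖ ≤ 1 → χ v = 1) ∧ ∀ᶠ v in 𝓝 0, χ v = 1 := by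
  obtain ⟨χ, h1, h2, h3, h4, h5⟩ := exists_smooth_cutoff (isCompact_closedBall (0 : Space d) 1)
  refine ⟨χ, h1, h2, h3, h4, fun v hv => h5 v (by simpa using hv), ?_⟩
  filter_upwards [Metric.closedBall_mem_nhds (0 : Space d) one_pos] with v hv using h5 v hv

lemma cutoff_rescaled_eq_one {χ : Space d → ℝ} (h : ∀ v, ‖v‖ ≤ 1 → χ v = 1) (n : ℕ) {v : Space d}
    (hv : ‖v‖ ≤ (n : ℝ) + 1) : χ (((n : ℝ) + 1)⁻¹ • v) = 1 := by
  apply h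
  have hn : 0 < (n : ℝ) + 1 := by positivity
  rw [norm_smul, norm_inv, Real.norm_of_nonneg hn.le, inv_mul_le_iff₀ hn, mul_one]
  exact hv

lemma hasCompactSupport_of_cutoff {χ : Space d → ℝ} (hχc : HasCompactSupport χ) (n : ℕ)
    {φ : Space d → ℝ} (hφc : HasCompactSupport φ) {F : Space d × Space d → ℝ}
    (h1 : ∀ z, φ z.1 = 0 → F z = 0) (h2 : ∀ z, χ (((n : ℝ) + 1)⁻¹ • z.2) = 0 → F z = 0) :
    HasCompactSupport F := by
  have hn : ((n : ℝ) + 1)⁻¹ ≠ 0 := by positivity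
  have hχn : HasCompactSupport fun v : Space d => χ (((n : ℝ) + 1)⁻¹ • v) :=
    hχc.comp_homeomorph (Homeomorph.smulOfNeZero _ hn)
  refine HasCompactSupport.intro (hφc.isCompact.prod hχn.isCompact) fun z hz => ?_
  rw [Set.mem_prod, not_and_or] at hz
  rcases hz with h | h
  · exact h1 z (image_eq_zero_of_notMem_tsupport h)
  · exact h2 z (image_eq_zero_of_notMem_tsupport
      (f := fun v : Space d => χ (((n : ℝ) + 1)⁻¹ • v)) h)

variable {w : 𝓢(Space d × Space d, ℂ) →ₗ[ℂ] ℂ} {m : ℝ} {ρ E : Space d → ℝ}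
  {J : Space d → Space d}

/-- Formally, `|Φ(x, v) - Φ(x, b(x))| ≤ φ(δ + c|v - b|²)` is integrated against `w ≥ 0`. Expanding
the square expresses the right side through density, current and energy tested against `φ|b|²`, `φb`
and `φ`. The cutoff in `v` makes this legitimate for a distribution known only through moments. -/
lemma abs_sub_le_of_moments
    (hw : ∀ (f : Space d × Space d → ℝ) (hf : ContDiff ℝ ∞ f) (hfc : HasCompactSupport f),
      (∀ z, 0 ≤ f z) → 0 ≤ (w (realSchwartz f hf hfc)).re ∧ (w (realSchwartz f hf hfc)).im = 0)
    (hm : 0 < m) (hρ : IsDensity w ρ) (hJ : IsCurrent m w J) (hE : IsKineticEnergy m w E)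
    {Φ : Space d × Space d → ℝ} (hΦ : ContDiff ℝ ∞ Φ) (hΦc : HasCompactSupport Φ)
    {φ : Space d → ℝ} (hφ : ContDiff ℝ ∞ φ) (hφc : HasCompactSupport φ) (hφ0 : ∀ x, 0 ≤ φ x)
    (hφ1 : ∀ x, φ x = 1 ∨ ∀ v, Φ (x, v) = 0)
    {b : Space d → Space d} (hb : ContDiff ℝ ∞ b) {δ c : ℝ} (hδ : 0 ≤ δ) (hc : 0 ≤ c)
    (hΦb : ∀ x v v', |Φ (x, v) - Φ (x, v')| ≤ δ + c * ‖v - v'‖ ^ 2) :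
    |(w (realSchwartz Φ hΦ hΦc)).re - ∫ x, ρ x * Φ (x, b x)| ≤
      δ * (∫ x, ρ x * φ x) + c * (2 * m * (∫ x, E x * φ x) -
        2 * m * (∑ j, ∫ x, J x j * (φ x * b x j)) + ∫ x, ρ x * (φ x * ‖b x‖ ^ 2)) := by
  obtain ⟨χ, hχ, hχc, hχ0, hχ1, hχ2, hχ3⟩ := exists_cutoff_unit_ball d
  obtain ⟨-, hp1, hρ'⟩ := hρ
  obtain ⟨-, hpE, hE'⟩ := hE
  choose hJL hpJ hJ' using hJ
  have hbj : ∀ j, ContDiff ℝ ∞ fun x => φ x * b x j := fun j =>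
    hφ.mul (contDiff_euclidean.1 hb j)
  have hbn : ContDiff ℝ ∞ fun x => φ x * ‖b x‖ ^ 2 := hφ.mul (hb.norm_sq ℝ)
  have hΦbd : ContDiff ℝ ∞ fun x => Φ (x, b x) := hΦ.comp (contDiff_id.prodMk hb)
  have hφΦ : ∀ x, φ x = 0 → ∀ v, Φ (x, v) = 0 := fun x hx =>
    (hφ1 x).resolve_left (by rw [hx]; exact zero_ne_one)
  have hΦbc : HasCompactSupport fun x => Φ (x, b x) :=
    HasCompactSupport.intro hφc.isCompact fun x hx =>
      hφΦ x (image_eq_zero_of_notMem_tsupport hx) _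
  obtain ⟨N, hN⟩ : ∃ N : ℕ, ∀ z : Space d × Space d, (N : ℝ) < ‖z.2‖ → Φ z = 0 := by
    obtain ⟨r, hr⟩ := hΦc.isCompact.isBounded.subset_closedBall 0
    obtain ⟨N, hN⟩ := exists_nat_ge r
    refine ⟨N, fun z hz => image_eq_zero_of_notMem_tsupport fun h => ?_⟩
    have h2 := hr h
    rw [mem_closedBall_zero_iff] at h2
    linarith [norm_snd_le z]
  -- The values `s = 1` and `s = -1` give the two sides of the absolute value from one computation.
  have key : ∀ s : ℝ, |s| ≤ 1 → 0 ≤ δ * (∫ x, ρ x * φ x) + c * (2 * m * (∫ x, E x * φ x) -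
        2 * m * (∑ j, ∫ x, J x j * (φ x * b x j)) + ∫ x, ρ x * (φ x * ‖b x‖ ^ 2)) +
        s * ((w (realSchwartz Φ hΦ hΦc)).re - ∫ x, ρ x * Φ (x, b x)) := by
    intro s hs
    let S : ℕ → 𝓢(Space d × Space d, ℂ) := fun n =>
      (δ : ℂ) • cutoffTest hp1 hφ hφc hχ hχc n +
      (c : ℂ) • (((2 * m : ℝ) : ℂ) • cutoffTest hpE hφ hφc hχ hχc n -
        ((2 * m : ℝ) : ℂ) • (∑ j, cutoffTest (hpJ j) (hbj j) hφc.mul_right hχ hχc n) +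
        cutoffTest hp1 hbn hφc.mul_right hχ hχc n) +
      (s : ℂ) • (realSchwartz Φ hΦ hΦc - cutoffTest hp1 hΦbd hΦbc hχ hχc n)
    have hlim : Tendsto (fun n => (w (S n)).re) atTop
        (𝓝 (δ * (∫ x, ρ x * φ x) + c * (2 * m * (∫ x, E x * φ x) -
        2 * m * (∑ j, ∫ x, J x j * (φ x * b x j)) + ∫ x, ρ x * (φ x * ‖b x‖ ^ 2)) +
        s * ((w (realSchwartz Φ hΦ hΦc)).re - ∫ x, ρ x * Φ (x, b x)))) := by
      have h1 := (hρ' φ χ hφ hφc hχ hχc hχ3).const_mul (δ : ℂ)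
      have h2 := (hE' φ χ hφ hφc hχ hχc hχ3).const_mul ((2 * m : ℝ) : ℂ)
      have h3 := (tendsto_finsetSum Finset.univ fun j _ =>
        hJ' j _ χ (hbj j) hφc.mul_right hχ hχc hχ3).const_mul ((2 * m : ℝ) : ℂ)
      have h4 := hρ' _ χ hbn hφc.mul_right hχ hχc hχ3
      have h5 := ((hρ' _ χ hΦbd hΦbc hχ hχc hχ3).const_sub
        (w (realSchwartz Φ hΦ hΦc))).const_mul (s : ℂ)
      have h6 := (Complex.continuous_re.tendsto _).comp
        ((h1.add (((h2.sub h3).add h4).const_mul (c : ℂ))).add h5)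
      convert h6 using 1
      · ext n
        simp only [S, map_add, map_sub, map_smul, map_sum, smul_eq_mul, Function.comp_apply]
      · congr 1
        rw [← Complex.ofReal_sum]
        simp only [Complex.add_re, Complex.sub_re, Complex.re_ofReal_mul, Complex.ofReal_re]
    -- For `n ≥ N` the cutoff is `1` on the support of `Φ`, so the uncut `Φ` may be inserted into
    -- the cut expression.
    refine ge_of_tendsto hlim (eventually_atTop.2 ⟨N, fun n hn => ?_⟩)
    have hχΦ : ∀ z, Φ z * χ (((n : ℝ) + 1)⁻¹ • z.2) = Φ z := fun z => by
      by_cases hz : ‖z.2‖ ≤ n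
      · rw [cutoff_rescaled_eq_one hχ2 n (by linarith), mul_one]
      · rw [hN z (by
          have : (N : ℝ) ≤ n := by exact_mod_cast hn
          linarith), zero_mul]
    let F : Space d × Space d → ℝ := fun z => χ (((n : ℝ) + 1)⁻¹ • z.2) *
      (φ z.1 * (δ + c * ‖z.2 - b z.1‖ ^ 2) + s * (Φ z - Φ (z.1, b z.1)))
    refine (nonneg_of_apply_eq hw (S n) (F := F) (fun z => ?_) ?_ fun z => ?_).1
    · have hreal : F z = δ * (φ z.1 * 1 * χ (((n : ℝ) + 1)⁻¹ • z.2)) +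
          c * (2 * m * (φ z.1 * ((1 / (2 * m)) * ‖z.2‖ ^ 2) * χ (((n : ℝ) + 1)⁻¹ • z.2)) -
            2 * m * (∑ j, φ z.1 * b z.1 j * ((1 / m) * z.2 j) * χ (((n : ℝ) + 1)⁻¹ • z.2)) +
            φ z.1 * ‖b z.1‖ ^ 2 * 1 * χ (((n : ℝ) + 1)⁻¹ • z.2)) +
          s * (Φ z - Φ (z.1, b z.1) * 1 * χ (((n : ℝ) + 1)⁻¹ • z.2)) := by
        have h1 : (∑ j, φ z.1 * b z.1 j * ((1 / m) * z.2 j) * χ (((n : ℝ) + 1)⁻¹ • z.2)) =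
            φ z.1 * (1 / m) * χ (((n : ℝ) + 1)⁻¹ • z.2) * inner ℝ z.2 (b z.1) := by
          rw [PiLp.inner_apply, Finset.mul_sum]
          refine Finset.sum_congr rfl fun j _ => ?_
          simp only [RCLike.inner_apply, conj_trivial]
          ring
        have h2 : 2 * m * (1 / (2 * m)) = 1 := by field_simp
        have h3 : m * (1 / m) = 1 := by field_simp
        rw [h1]
        simp only [F]
        rw [norm_sub_sq_real]
        linear_combination s * hχΦ z - c * φ z.1 * ‖z.2‖ ^ 2 * χ (((n : ℝ) + 1)⁻¹ • z.2) * h2 +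
          2 * c * φ z.1 * χ (((n : ℝ) + 1)⁻¹ • z.2) * inner ℝ z.2 (b z.1) * h3
      rw [hreal]
      simp only [S, add_apply, smul_apply, sub_apply, sum_apply, cutoffTest_eq,
        realSchwartz_apply, smul_eq_mul]
      push_cast
      rfl
    · refine hasCompactSupport_of_cutoff hχc n hφc (fun z hz => ?_) fun z hz => ?_
      · simp only [F]
        rw [hz, show Φ z = 0 from hφΦ _ hz z.2, hφΦ _ hz (b z.1)]
        ring
      · simp only [F]
        rw [hz, zero_mul]
    · refine mul_nonneg (hχ0 _) ?_
      rcases hφ1 z.1 with h | h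
      · rw [h, one_mul]
        have h1 := hΦb z.1 z.2 (b z.1)
        have h2 : |s * (Φ z - Φ (z.1, b z.1))| ≤ |Φ (z.1, z.2) - Φ (z.1, b z.1)| := by
          rw [abs_mul]
          exact mul_le_of_le_one_left (abs_nonneg _) hs
        linarith [neg_abs_le (s * (Φ z - Φ (z.1, b z.1)))]
      · rw [show Φ z = 0 from h z.2, h (b z.1), sub_zero, mul_zero, add_zero]
        have := hφ0 z.1
        positivity
  rw [abs_le]
  have h1 := key 1 (by simp)
  have h2 := key (-1) (by simp)
  constructor <;> linarith

end Monokinetic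

end Semiclassical

/-! ### Absence of energy where the density vanishes -/

namespace Semiclassical

section EnergyVanishing

variable {d : ℕ} {w : 𝓢(Space d × Space d, ℂ) →ₗ[ℂ] ℂ} {m : ℝ} {ρ E : Space d → ℝ}
  {J : Space d → Space d}

/-- Velocities with `‖v‖ ≤ R(n + 1)` contribute at most `K n` times the mass. The remaining energy
is at most the tail `∫ Eφ₀ - a n`, the same for every `φ ≤ φ₀` and tending to zero because `E` is
the full second moment of `w`. -/
lemma exists_energy_truncation
    (hw : ∀ (f : Space d × Space d → ℝ) (hf : ContDiff ℝ ∞ f) (hfc : HasCompactSupport f),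
      (∀ z, 0 ≤ f z) → 0 ≤ (w (realSchwartz f hf hfc)).re ∧ (w (realSchwartz f hf hfc)).im = 0)
    (hm : 0 < m) (hρ : IsDensity w ρ) (hE : IsKineticEnergy m w E)
    {φ₀ : Space d → ℝ} (hφ₀ : ContDiff ℝ ∞ φ₀) (hφ₀c : HasCompactSupport φ₀) :
    ∃ a K : ℕ → ℝ, Tendsto a atTop (𝓝 (∫ x, E x * φ₀ x)) ∧
      ∀ (φ : Space d → ℝ), ContDiff ℝ ∞ φ → HasCompactSupport φ → (∀ x, 0 ≤ φ x) →
        (∀ x, φ x ≤ φ₀ x) → ∀ n, 0 ≤ ∫ x, E x * φ x ∧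
          ∫ x, E x * φ x ≤ K n * (∫ x, ρ x * φ x) + (∫ x, E x * φ₀ x) - a n := by
  obtain ⟨χ, hχ, hχc, hχ0, hχ1, hχ2, hχ3⟩ := exists_cutoff_unit_ball d
  obtain ⟨-, hp1, hρ'⟩ := hρ
  obtain ⟨-, hpE, hE'⟩ := hE
  obtain ⟨R, hR0, hR⟩ := exists_support_radius hχc
  refine ⟨fun n => (w (cutoffTest hpE hφ₀ hφ₀c hχ hχc n)).re,
    fun n => 1 / (2 * m) * (R * ((n : ℝ) + 1)) ^ 2, ?_, ?_⟩
  · have := (Complex.continuous_re.tendsto _).comp (hE' φ₀ χ hφ₀ hφ₀c hχ hχc hχ3)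
    rwa [Complex.ofReal_re] at this
  intro φ hφ hφc hφ0 hφle n
  have hn : 0 < (n : ℝ) + 1 := by positivity
  have hl1 := (Complex.continuous_re.tendsto _).comp (hρ' φ χ hφ hφc hχ hχc hχ3)
  have hl2 := (Complex.continuous_re.tendsto _).comp (hE' φ χ hφ hφc hχ hχc hχ3)
  have hl3 := (Complex.continuous_re.tendsto _).comp (hE' φ₀ χ hφ₀ hφ₀c hχ hχc hχ3)
  simp only [Complex.ofReal_re, Function.comp_def] at hl1 hl2 hl3
  constructor
  · refine ge_of_tendsto' hl2 fun k => (nonneg_of_apply_eq hw _ (fun z => rfl) ?_ fun z => ?_).1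
    · refine hasCompactSupport_of_cutoff hχc k hφc (fun z hz => ?_) fun z hz => ?_ <;>
        simp only [hz] <;> ring
    · have := hφ0 z.1
      have := hχ0 (((k : ℝ) + 1)⁻¹ • z.2)
      positivity
  have hlim := ((hl1.const_mul (1 / (2 * m) * (R * ((n : ℝ) + 1)) ^ 2)).add hl3).sub
    (hl2.const_add (w (cutoffTest hpE hφ₀ hφ₀c hχ hχc n)).re)
  -- Two scales are involved: `n` truncates the energy and stays fixed, while `k` removes the
  -- auxiliary cutoff. For `k ≥ N` the latter equals `1` wherever the former is nonzero.
  obtain ⟨N, hN⟩ := exists_nat_ge (R * ((n : ℝ) + 1))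
  suffices h : 0 ≤ 1 / (2 * m) * (R * ((n : ℝ) + 1)) ^ 2 * (∫ x, ρ x * φ x) +
      (∫ x, E x * φ₀ x) - ((w (cutoffTest hpE hφ₀ hφ₀c hχ hχc n)).re + ∫ x, E x * φ x) by linarith
  refine ge_of_tendsto hlim (eventually_atTop.2 ⟨N, fun k hk => ?_⟩)
  let F : Space d × Space d → ℝ := fun z =>
    1 / (2 * m) * (R * ((n : ℝ) + 1)) ^ 2 * (φ z.1 * 1 * χ (((k : ℝ) + 1)⁻¹ • z.2)) +
      φ₀ z.1 * (1 / (2 * m) * ‖z.2‖ ^ 2) * χ (((k : ℝ) + 1)⁻¹ • z.2) -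
      (φ₀ z.1 * (1 / (2 * m) * ‖z.2‖ ^ 2) * χ (((n : ℝ) + 1)⁻¹ • z.2) +
        φ z.1 * (1 / (2 * m) * ‖z.2‖ ^ 2) * χ (((k : ℝ) + 1)⁻¹ • z.2))
  have hNk : (N : ℝ) ≤ k := by exact_mod_cast hk
  have hχle : ∀ v : Space d, χ (((n : ℝ) + 1)⁻¹ • v) ≠ 0 → ‖v‖ ≤ R * ((n : ℝ) + 1) ∧
      χ (((k : ℝ) + 1)⁻¹ • v) = 1 := by
    intro v hv
    have h1 : ‖v‖ ≤ R * ((n : ℝ) + 1) := by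
      by_contra! h
      refine hv (hR _ ?_)
      rw [norm_smul, norm_inv, Real.norm_of_nonneg hn.le, lt_inv_mul_iff₀ hn]
      linarith
    exact ⟨h1, cutoff_rescaled_eq_one hχ2 k (by linarith)⟩
  have hφ0c : ∀ x, φ₀ x = 0 → φ x = 0 := fun x hx => le_antisymm (hx ▸ hφle x) (hφ0 x)
  have := nonneg_of_apply_eq hw (((1 / (2 * m) * (R * ((n : ℝ) + 1)) ^ 2 : ℝ) : ℂ) •
    cutoffTest hp1 hφ hφc hχ hχc k + cutoffTest hpE hφ₀ hφ₀c hχ hχc k -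
      (cutoffTest hpE hφ₀ hφ₀c hχ hχc n + cutoffTest hpE hφ hφc hχ hχc k)) (F := F)
    (fun z => ?_) ?_ fun z => ?_
  · simpa only [map_add, map_sub, map_smul, smul_eq_mul, Complex.add_re, Complex.sub_re,
      Complex.re_ofReal_mul] using this.1
  · simp only [F, add_apply, smul_apply, sub_apply, cutoffTest_eq, smul_eq_mul]
    push_cast
    rfl
  · refine hasCompactSupport_of_cutoff hχc k hφ₀c (fun z hz => ?_) fun z hz => ?_
    · simp only [F, hz, hφ0c _ hz]
      ring
    · have h0 : χ (((n : ℝ) + 1)⁻¹ • z.2) = 0 := by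
        by_contra h
        exact one_ne_zero ((hχle _ h).2.symm.trans hz)
      simp only [F, hz, h0]
      ring
  · have h1 : 0 < 1 / (2 * m) := by positivity
    have h2 := hφ0 z.1
    have h3 := hφle z.1
    have h4 := hχ0 (((k : ℝ) + 1)⁻¹ • z.2)
    have h5 : F z = 1 / (2 * m) * (φ z.1 * (χ (((k : ℝ) + 1)⁻¹ • z.2) *
        ((R * ((n : ℝ) + 1)) ^ 2 - ‖z.2‖ ^ 2)) + φ₀ z.1 * ‖z.2‖ ^ 2 *
          (χ (((k : ℝ) + 1)⁻¹ • z.2) - χ (((n : ℝ) + 1)⁻¹ • z.2))) := by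
      simp only [F]
      ring
    rw [h5]
    refine mul_nonneg h1.le ?_
    have h6 := h2.trans h3
    -- Outside the truncation, `φ ≤ φ₀` lets the tail pay for the energy. Inside it, `‖v‖²` is at
    -- most `(R(n + 1))²` and the mass term pays.
    by_cases h7 : χ (((n : ℝ) + 1)⁻¹ • z.2) = 0
    · rw [h7]
      have h8 : 0 ≤ χ (((k : ℝ) + 1)⁻¹ • z.2) * (φ z.1 * (R * ((n : ℝ) + 1)) ^ 2 +
          (φ₀ z.1 - φ z.1) * ‖z.2‖ ^ 2) := by
        have := sub_nonneg.2 h3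
        positivity
      linarith
    · obtain ⟨h8, h9⟩ := hχle _ h7
      have h10 := hχ1 (((n : ℝ) + 1)⁻¹ • z.2)
      have h11 : 0 ≤ (R * ((n : ℝ) + 1)) ^ 2 - ‖z.2‖ ^ 2 :=
        sub_nonneg.2 (pow_le_pow_left₀ (norm_nonneg _) h8 2)
      have h12 := sub_nonneg.2 h10
      rw [h9]
      positivity

/-- The relation `2mEρ = m²|J|²` says nothing about `E` where `ρ = 0`. There the truncation bound is
used: the mass term vanishes, leaving only the high-velocity tail. -/
lemma energy_eq_zero_of_density_eq_zero
    (hw : ∀ (f : Space d × Space d → ℝ) (hf : ContDiff ℝ ∞ f) (hfc : HasCompactSupport f),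
      (∀ z, 0 ≤ f z) → 0 ≤ (w (realSchwartz f hf hfc)).re ∧ (w (realSchwartz f hf hfc)).im = 0)
    (hm : 0 < m) (hρ : IsDensity w ρ) (hE : IsKineticEnergy m w E) :
    ∀ᵐ x, ρ x = 0 → E x = 0 := by
  have hρL : LocallyIntegrable ρ volume := hρ.1
  have hEL : LocallyIntegrable E volume := hE.1
  have hρm : NullMeasurableSet {x | ρ x = 0} volume :=
    hρL.aestronglyMeasurable.aemeasurable.nullMeasurable (measurableSet_singleton 0)
  obtain ⟨A, -, hA, hAρ⟩ := hρm.exists_measurable_superset_ae_eq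
  refine ae_of_forall_ball fun r hr => ?_
  obtain ⟨φ₀, hφ₀, hφ₀c, hφ₀0, hφ₀1, hφ₀r⟩ :=
    exists_smooth_cutoff (isCompact_closedBall (0 : Space d) r)
  obtain ⟨R, -, hR⟩ := exists_support_radius hφ₀c
  obtain ⟨a, K, ha, hK⟩ := exists_energy_truncation hw hm hρ hE hφ₀ hφ₀c
  -- The truncation bound needs smooth test functions, so the indicator of the vacuum within `s` is
  -- mollified; mollification keeps it between `0` and `1`, hence below `φ₀` after multiplication.
  have key : ∀ s, MeasurableSet s → ∫ x, E x * (φ₀ x * (A ∩ s).indicator 1 x) = 0 := by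
    intro s hs
    set g : Space d → ℝ := (A ∩ s).indicator 1
    have hg0 : ∀ x, 0 ≤ g x := fun x => Set.indicator_nonneg (fun _ _ => zero_le_one) x
    have hg1 : ∀ x, g x ≤ 1 := fun x => Set.indicator_le_self' (fun _ _ => zero_le_one) x
    have hgL : LocallyIntegrable g volume :=
      (locallyIntegrable_const (1 : ℝ)).indicator (hA.inter hs)
    have hmol1 : ∀ n x, |mollify n g x| ≤ 1 := fun n x =>
      abs_mollify_le n (fun x => by rw [abs_of_nonneg (hg0 x)]; exact hg1 x) x
    have hmol0 : ∀ n x, 0 ≤ mollify n g x := fun n x => mollify_nonneg n hg0 x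
    have hsm : ∀ n, ContDiff ℝ ∞ fun x => φ₀ x * mollify n g x := fun n =>
      hφ₀.mul (contDiff_mollify n hgL)
    have hlim : ∀ᵐ x, Tendsto (fun n => φ₀ x * mollify n g x) atTop (𝓝 (φ₀ x * g x)) :=
      (ae_tendsto_mollify hgL).mono fun x hx => hx.const_mul _
    have hbd : ∀ n x, |φ₀ x * mollify n g x| ≤ 1 := fun n x => by
      rw [abs_mul, abs_of_nonneg (hφ₀0 x)]
      exact mul_le_one₀ (hφ₀1 x) (abs_nonneg _) (hmol1 n x)
    have hz : ∀ n x, R < ‖x‖ → φ₀ x * mollify n g x = 0 := fun n x hx => by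
      rw [hR x hx, zero_mul]
    have hlE := tendsto_integral_mul_of_bounded_support hEL (fun n => (hsm n).continuous) hbd hz hlim
    have hlρ := tendsto_integral_mul_of_bounded_support hρL (fun n => (hsm n).continuous) hbd hz hlim
    have hρ0 : ∫ x, ρ x * (φ₀ x * g x) = 0 := by
      refine integral_eq_zero_of_ae ?_
      filter_upwards [hAρ.mem_iff] with x hx
      by_cases h : x ∈ A ∩ s
      · have : ρ x = 0 := hx.1 h.1
        simp [this]
      · simp [g, Set.indicator_of_notMem h]
    rw [hρ0] at hlρ
    have hb := fun k n => hK (fun x => φ₀ x * mollify k g x) (hsm k) hφ₀c.mul_right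
      (fun x => mul_nonneg (hφ₀0 x) (hmol0 k x))
      (fun x => mul_le_of_le_one_right (hφ₀0 x) ((le_abs_self _).trans (hmol1 k x))) n
    refine le_antisymm ?_ (ge_of_tendsto' hlE fun k => (hb k 0).1)
    -- The mollification parameter goes to its limit first, at fixed `n`, which kills `K n` times
    -- the mass although `K n` grows. Only afterwards does `n` tend to infinity.
    have h1 : ∀ n, ∫ x, E x * (φ₀ x * g x) ≤ (∫ x, E x * φ₀ x) - a n := fun n => by
      have := ((hlρ.const_mul (K n)).add_const (∫ x, E x * φ₀ x)).sub_const (a n)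
      rw [mul_zero, zero_add] at this
      exact le_of_tendsto_of_tendsto' hlE this fun k => (hb k n).2
    have h2 := ha.const_sub (∫ x, E x * φ₀ x)
    rw [sub_self] at h2
    exact ge_of_tendsto' h2 h1
  have hint : Integrable (fun x => E x * (φ₀ x * A.indicator 1 x)) volume := by
    have h1 : Integrable (fun x => φ₀ x * E x) volume := by
      simpa using hEL.integrable_smul_left_of_hasCompactSupport hφ₀.continuous hφ₀c
    have h2 := h1.indicator hA
    refine h2.congr (Eventually.of_forall fun x => ?_)
    by_cases h : x ∈ A <;> simp [h, mul_comm]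
  have hae := hint.ae_eq_zero_of_forall_setIntegral_eq_zero fun s hs _ => by
    rw [← integral_indicator hs, ← key s hs]
    congr 1
    ext x
    by_cases h : x ∈ A <;> by_cases h' : x ∈ s <;> simp [h, h']
  rw [ae_restrict_iff' measurableSet_ball]
  filter_upwards [hae, hAρ.mem_iff] with x hx hxA hxr hx0
  have hxA' : x ∈ A := hxA.2 hx0
  have h1 : φ₀ x = 1 := hφ₀r x (by simpa using (mem_ball_zero_iff.1 hxr).le)
  simpa [h1, hxA'] using hx

end EnergyVanishing

end Semiclassical

/-! ### Measures with an a.e. nonnegative real density -/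

namespace Semiclassical

section WithDensity

variable {α F : Type*} [MeasurableSpace α] [NormedAddCommGroup F] [NormedSpace ℝ F]
  {μ : Measure α} {σ : α → ℝ}

lemma integral_withDensity_ofReal (hσ : AEMeasurable σ μ) (h0 : ∀ᵐ x ∂μ, 0 ≤ σ x) (f : α → F) :
    ∫ x, f x ∂(μ.withDensity fun x => ENNReal.ofReal (σ x)) = ∫ x, σ x • f x ∂μ := by
  refine (integral_withDensity_eq_integral_smul₀ hσ.real_toNNReal f).trans ?_
  refine integral_congr_ae ?_
  filter_upwards [h0] with x hx
  rw [NNReal.smul_def, Real.coe_toNNReal _ hx]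

lemma integrable_withDensity_ofReal_iff (hσ : AEMeasurable σ μ) (h0 : ∀ᵐ x ∂μ, 0 ≤ σ x)
    (f : α → F) : Integrable f (μ.withDensity fun x => ENNReal.ofReal (σ x)) ↔
      Integrable (fun x => σ x • f x) μ := by
  refine (integrable_withDensity_iff_integrable_smul₀ hσ.real_toNNReal).trans ?_
  refine integrable_congr ?_
  filter_upwards [h0] with x hx
  rw [NNReal.smul_def, Real.coe_toNNReal _ hx]

end WithDensity

/-! ### Identification of the limit on compactly supported test functions -/

section MonokineticLimit

variable {d : ℕ} {w : 𝓢(Space d × Space d, ℂ) →ₗ[ℂ] ℂ} {m : ℝ} {ρ E : Space d → ℝ}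
  {J V : Space d → Space d}

lemma aemeasurable_velocity (hρ : AEMeasurable ρ volume) (hJ : AEMeasurable J volume) :
    AEMeasurable (velocity ρ J) volume := by
  have h : NullMeasurableSet {y | 0 < ρ y} volume := nullMeasurableSet_lt aemeasurable_const hρ
  exact (hρ.inv.smul hJ).indicator₀ h

/-- Where `ρ > 0` this is division of `2mEρ = m²|J|²` by `ρ`. Where `ρ = 0` the same identity forces
`J = 0`, while `E = 0` has to be supplied separately. -/
lemma ae_velocity_relations (hρ0 : ∀ᵐ x, 0 ≤ ρ x)
    (hEρ : ∀ᵐ x, 2 * m * (E x * ρ x) = m ^ 2 * ‖J x‖ ^ 2) (hm : 0 < m)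
    (hE0 : ∀ᵐ x, ρ x = 0 → E x = 0) :
    ∀ᵐ x, 2 * m * E x = ρ x * ‖m • velocity ρ J x‖ ^ 2 ∧
      m • J x = ρ x • (m • velocity ρ J x) := by
  filter_upwards [hρ0, hEρ, hE0] with x h0 h1 h2
  rcases h0.eq_or_lt with h | h
  · have hJ : J x = 0 := by
      rw [← h, mul_zero, mul_zero] at h1
      have h3 : ‖J x‖ ^ 2 = 0 := (mul_eq_zero.1 h1.symm).resolve_left (by positivity)
      simpa using h3
    rw [h2 h.symm, ← h, hJ]
    simp
  · have hv : velocity ρ J x = (ρ x)⁻¹ • J x := Set.indicator_of_mem (s := {y | 0 < ρ y}) h _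
    rw [hv]
    constructor
    · rw [norm_smul, norm_smul, norm_inv, Real.norm_of_nonneg hm.le, Real.norm_of_nonneg h.le]
      field_simp
      exact mul_left_cancel₀ hm.ne' (by linear_combination h1)
    · rw [smul_comm, smul_smul, smul_smul]
      congr 1
      field_simp

/-- The moment of `|v - b|²` under `w` is the one that the graph of `V` would give; it measures how
far `b` is from `V` and contains no residual velocity variance. -/
lemma moments_eq_integral_norm_sub_sq (hρL : LocallyIntegrable ρ volume)
    (hEL : LocallyIntegrable E volume)
    (hJL : ∀ j, LocallyIntegrable (fun x => J x j) volume)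
    (hV : ∀ᵐ x, 2 * m * E x = ρ x * ‖V x‖ ^ 2 ∧ m • J x = ρ x • V x)
    {φ : Space d → ℝ} (hφ : Continuous φ) (hφc : HasCompactSupport φ)
    {b : Space d → Space d} (hb : Continuous b) :
    Integrable (fun x => φ x * ρ x * ‖V x - b x‖ ^ 2) volume ∧
    2 * m * (∫ x, E x * φ x) - 2 * m * (∑ j, ∫ x, J x j * (φ x * b x j)) +
      ∫ x, ρ x * (φ x * ‖b x‖ ^ 2) = ∫ x, φ x * ρ x * ‖V x - b x‖ ^ 2 := by
  have hI : ∀ {f g : Space d → ℝ}, LocallyIntegrable f volume → Continuous g →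
      HasCompactSupport g → Integrable (fun x => f x * g x) volume := fun hf hg hgc => by
    simpa only [smul_eq_mul, mul_comm] using hf.integrable_smul_left_of_hasCompactSupport hg hgc
  have h1 := (hI hEL hφ hφc).const_mul (2 * m)
  have hbj : ∀ j, Continuous fun x => b x j := fun j => by fun_prop
  have h2 : ∀ j ∈ Finset.univ, Integrable (fun x => J x j * (φ x * b x j)) volume := fun j _ =>
    hI (hJL j) (hφ.mul (hbj j)) hφc.mul_right
  have h3 := (integrable_finsetSum _ h2).const_mul (2 * m)
  have h4 : Integrable (fun x => ρ x * (φ x * ‖b x‖ ^ 2)) volume :=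
    hI hρL (hφ.mul (hb.norm.pow 2)) hφc.mul_right
  have hae : (fun x => 2 * m * (E x * φ x) - 2 * m * (∑ j, J x j * (φ x * b x j)) +
      ρ x * (φ x * ‖b x‖ ^ 2)) =ᵐ[volume] fun x => φ x * ρ x * ‖V x - b x‖ ^ 2 := by
    filter_upwards [hV] with x hx
    have h5 : m * (∑ j, J x j * (φ x * b x j)) = φ x * ρ x * inner ℝ (V x) (b x) := by
      rw [mul_assoc, ← real_inner_smul_left, ← hx.2, PiLp.inner_apply, Finset.mul_sum,
        Finset.mul_sum]
      refine Finset.sum_congr rfl fun j _ => ?_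
      simp only [RCLike.inner_apply, conj_trivial, PiLp.smul_apply, smul_eq_mul]
      ring
    rw [norm_sub_sq_real]
    linear_combination φ x * hx.1 - 2 * h5
  have h13 : Integrable (fun x => 2 * m * (E x * φ x) -
      2 * m * ∑ j, J x j * (φ x * b x j)) volume := h1.sub h3
  refine ⟨(h13.add h4).congr hae, ?_⟩
  rw [← integral_congr_ae hae, integral_add h13 h4, integral_sub h1 h3,
    integral_const_mul, integral_const_mul, integral_finsetSum _ h2]

/-- A nonnegative distribution whose velocity moments of order at most two are those of a
monokinetic measure agrees with it on real test functions. -/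
lemma re_eq_integral_monokinetic
    (hw : ∀ (f : Space d × Space d → ℝ) (hf : ContDiff ℝ ∞ f) (hfc : HasCompactSupport f),
      (∀ z, 0 ≤ f z) → 0 ≤ (w (realSchwartz f hf hfc)).re ∧ (w (realSchwartz f hf hfc)).im = 0)
    (hm : 0 < m) (hρ : IsDensity w ρ) (hJ : IsCurrent m w J) (hE : IsKineticEnergy m w E)
    (hρ0 : ∀ᵐ x, 0 ≤ ρ x) (hVm : AEMeasurable V volume)
    (hV : ∀ᵐ x, 2 * m * E x = ρ x * ‖V x‖ ^ 2 ∧ m • J x = ρ x • V x)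
    {Φ : Space d × Space d → ℝ} (hΦ : ContDiff ℝ ∞ Φ) (hΦc : HasCompactSupport Φ) :
    (w (realSchwartz Φ hΦ hΦc)).re = ∫ x, ρ x * Φ (x, V x) := by
  obtain ⟨φ, hφ, hφc, hφ0, hφ1, hφK⟩ := exists_smooth_cutoff (hΦc.isCompact.image continuous_fst)
  have hφΦ : ∀ x, φ x = 1 ∨ ∀ v, Φ (x, v) = 0 := fun x => by
    by_cases hx : ∃ v, Φ (x, v) ≠ 0
    · obtain ⟨v, hv⟩ := hx
      exact Or.inl (hφK x ⟨(x, v), subset_tsupport _ hv, rfl⟩)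
    · push Not at hx
      exact Or.inr hx
  obtain ⟨C, hC⟩ := ContDiff.lipschitzWith_of_hasCompactSupport (𝕂 := ℝ) hΦc hΦ (by simp)
  have hLip : ∀ x v v', |Φ (x, v) - Φ (x, v')| ≤ C * ‖v - v'‖ := fun x v v' => by
    have := hC.dist_le_mul (x, v) (x, v')
    simpa [Real.dist_eq, Prod.dist_eq, dist_eq_norm] using this
  have hρL : LocallyIntegrable ρ volume := hρ.1
  have hEL : LocallyIntegrable E volume := hE.1
  have hρφ : Integrable (fun x => ρ x * φ x) volume := by
    simpa only [smul_eq_mul, mul_comm] using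
      hρL.integrable_smul_left_of_hasCompactSupport hφ.continuous hφc
  have hφρ : Integrable (fun x => φ x * ρ x) volume := by simpa only [mul_comm] using hρφ
  have hφρ0 : ∀ᵐ x, 0 ≤ φ x * ρ x := hρ0.mono fun x hx => mul_nonneg (hφ0 x) hx
  obtain ⟨B, hB0, hB⟩ : ∃ B, 0 ≤ B ∧ ∀ z, ‖Φ z‖ ≤ B := by
    obtain ⟨B, hB⟩ := hΦ.continuous.bounded_above_of_compact_support hΦc
    exact ⟨B, (norm_nonneg _).trans (hB 0), hB⟩
  have hint : ∀ {u : Space d → Space d}, AEMeasurable u volume →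
      Integrable (fun x => ρ x * Φ (x, u x)) volume := fun {u} hu => by
    have h1 : AEStronglyMeasurable (fun x => Φ (x, u x)) volume :=
      (hΦ.continuous.measurable.comp_aemeasurable (aemeasurable_id.prodMk hu)).aestronglyMeasurable
    have h2 := hρφ.mul_bdd (c := B) h1 (Eventually.of_forall fun x => hB _)
    refine h2.congr (Eventually.of_forall fun x => ?_)
    rcases hφΦ x with h | h
    · simp [h]
    · simp [h]
  set M := ∫ x, ρ x * φ x
  have hM : 0 ≤ M := integral_nonneg_of_ae (hρ0.mono fun x hx => mul_nonneg hx (hφ0 x))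
  set ν := (volume : Measure (Space d)).withDensity fun x => ENNReal.ofReal (φ x * ρ x)
  have : IsFiniteMeasure ν := isFiniteMeasure_withDensity_ofReal hφρ.2
  -- The norm is finite because `φρ|V|² = 2mEφ` a.e.; this is the moment identity with `b = 0`.
  have hVν : MemLp V 2 ν := by
    refine (memLp_two_iff_integrable_sq_norm
      (hVm.mono_ac (withDensity_absolutelyContinuous _ _)).aestronglyMeasurable).2 ?_
    rw [integrable_withDensity_ofReal_iff hφρ.aemeasurable hφρ0]
    have := (moments_eq_integral_norm_sub_sq hρL hEL (fun j => (hJ j).1) hV hφ.continuous hφc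
      (b := fun _ => 0) continuous_const).1
    simpa using this
  have key : ∀ δ : ℝ, 0 < δ → |(w (realSchwartz Φ hΦ hΦc)).re - ∫ x, ρ x * Φ (x, V x)| ≤
      δ * (2 * M + C ^ 2 / 2) := by
    intro δ hδ
    -- `V` is only measurable, whereas moments are tested against smooth functions; hence the
    -- approximation in `L²(φρ dx)`.
    obtain ⟨b, hbc, hb, hbV⟩ := hVν.exist_eLpNorm_sub_le (by norm_num) one_le_two hδ
    have hbν : MemLp b 2 ν := hb.continuous.memLp_of_hasCompactSupport hbc
    obtain ⟨hint1, hmom⟩ := moments_eq_integral_norm_sub_sq hρL hEL (fun j => (hJ j).1) hV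
      hφ.continuous hφc hb.continuous
    set Q := ∫ x, φ x * ρ x * ‖V x - b x‖ ^ 2 with hQ
    have hQδ : Q ≤ δ ^ 2 := by
      have h1 := integral_norm_sq_eq_toReal (hVν.sub hbν)
      rw [integral_withDensity_ofReal hφρ.aemeasurable hφρ0] at h1
      rw [hQ]
      refine h1.trans_le (pow_le_pow_left₀ ENNReal.toReal_nonneg ?_ 2)
      exact ENNReal.toReal_le_of_le_ofReal hδ.le hbV
    -- Optimal in `C t ≤ δ + c t²`, the difference being a perfect square. Since `Q ≤ δ²`, the term
    -- `c Q` is still `O(δ)`. Comparing `w` with `b` and then `b` with `V` uses the bound twice.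
    set c : ℝ := C ^ 2 / (4 * δ) with hc
    have hc0 : 0 ≤ c := by positivity
    have hquad : ∀ x v v', |Φ (x, v) - Φ (x, v')| ≤ δ + c * ‖v - v'‖ ^ 2 := fun x v v' => by
      refine (hLip x v v').trans ?_
      have h1 : δ + c * ‖v - v'‖ ^ 2 - C * ‖v - v'‖ =
          (2 * δ - C * ‖v - v'‖) ^ 2 / (4 * δ) := by
        rw [hc]
        field_simp
        ring
      have h2 : 0 ≤ (2 * δ - C * ‖v - v'‖) ^ 2 / (4 * δ) := by positivity
      linarith
    have h1 := abs_sub_le_of_moments hw hm hρ hJ hE hΦ hΦc hφ hφc hφ0 hφΦ hb hδ.le hc0 hquad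
    rw [hmom] at h1
    have h2 : |(∫ x, ρ x * Φ (x, b x)) - ∫ x, ρ x * Φ (x, V x)| ≤ δ * M + c * Q := by
      rw [← integral_sub (hint hb.continuous.aemeasurable) (hint hVm), ← Real.norm_eq_abs,
        ← integral_const_mul, hQ, ← integral_const_mul,
        ← integral_add (hρφ.const_mul δ) (hint1.const_mul c)]
      refine norm_integral_le_of_norm_le ((hρφ.const_mul δ).add (hint1.const_mul c)) ?_
      filter_upwards [hρ0] with x hx
      rw [← mul_sub, norm_mul, Real.norm_of_nonneg hx, Real.norm_eq_abs]
      rcases hφΦ x with h | h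
      · have := mul_le_mul_of_nonneg_left (hquad x (b x) (V x)) hx
        rw [norm_sub_rev] at this
        rw [h]
        linarith
      · rw [h, h, sub_zero, abs_zero, mul_zero]
        have := hφ0 x
        positivity
    have h3 : c * Q ≤ C ^ 2 / 4 * δ := by
      refine (mul_le_mul_of_nonneg_left hQδ hc0).trans (le_of_eq ?_)
      rw [hc]
      field_simp
    have h4 := abs_sub_le (w (realSchwartz Φ hΦ hΦc)).re (∫ x, ρ x * Φ (x, b x))
      (∫ x, ρ x * Φ (x, V x))
    linarith
  have hK : 0 ≤ 2 * M + (C : ℝ) ^ 2 / 2 := by positivity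
  rw [← sub_eq_zero, ← abs_nonpos_iff]
  refine le_of_forall_pos_le_add fun ε hε => ?_
  refine (key (ε / (2 * M + (C : ℝ) ^ 2 / 2 + 1)) (by positivity)).trans ?_
  rw [zero_add, div_mul_eq_mul_div, div_le_iff₀ (by positivity)]
  nlinarith

lemma im_eq_zero_of_nonneg {F : Type*} [NormedAddCommGroup F] [NormedSpace ℝ F]
    [FiniteDimensional ℝ F] {w : 𝓢(F, ℂ) →ₗ[ℂ] ℂ}
    (hw : ∀ (f : F → ℝ) (hf : ContDiff ℝ ∞ f) (hfc : HasCompactSupport f),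
      (∀ z, 0 ≤ f z) → 0 ≤ (w (realSchwartz f hf hfc)).re ∧ (w (realSchwartz f hf hfc)).im = 0)
    {Φ : F → ℝ} (hΦ : ContDiff ℝ ∞ Φ) (hΦc : HasCompactSupport Φ) :
    (w (realSchwartz Φ hΦ hΦc)).im = 0 := by
  obtain ⟨θ, hθ, hθc, hθ0, -, hθ1⟩ := exists_smooth_cutoff (E := F) hΦc
  obtain ⟨B, hB⟩ := hΦ.continuous.bounded_above_of_compact_support hΦc
  have hB0 : 0 ≤ B := (norm_nonneg _).trans (hB 0)
  have h1 := (hw θ hθ hθc hθ0).2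
  -- A real test function becomes nonnegative after adding `Bθ`, on which `w` is already known to be
  -- real.
  have h2 := (nonneg_of_apply_eq hw ((B : ℂ) • realSchwartz θ hθ hθc + realSchwartz Φ hΦ hΦc)
    (F := fun z => B * θ z + Φ z) (fun z => by simp) (hθc.mul_left.add hΦc) fun z => by
      by_cases hz : z ∈ tsupport Φ
      · rw [hθ1 z hz]
        linarith [neg_abs_le (Φ z), hB z, Real.norm_eq_abs (Φ z)]
      · rw [image_eq_zero_of_notMem_tsupport hz, add_zero]
        exact mul_nonneg hB0 (hθ0 z)).2
  rw [map_add, map_smul, smul_eq_mul, Complex.add_im, Complex.im_ofReal_mul, h1] at h2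
  simpa using h2

end MonokineticLimit

end Semiclassical

/-! ### Compactly supported functions in the Schwartz space -/

namespace Semiclassical

section Density

variable {F : Type*} [NormedAddCommGroup F] [NormedSpace ℝ F]

/-- Since `1 - θ` vanishes on the unit ball, a constant bound can be traded for a linear one. After
rescaling, the factor `‖z‖` becomes `(n + 1)⁻¹‖z‖`, giving decay in `n` at the cost of one more
weight on `Φ`. -/
lemma exists_norm_iteratedFDeriv_one_sub_le {θ : F → ℝ} (hθ : ContDiff ℝ ∞ θ)
    (hθc : HasCompactSupport θ) (hθ1 : ∀ z, ‖z‖ ≤ 1 → θ z = 1) (i : ℕ) :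
    ∃ B, 0 ≤ B ∧ ∀ z, ‖iteratedFDeriv ℝ i (fun y => 1 - θ y) z‖ ≤ B * ‖z‖ := by
  obtain ⟨B, hB⟩ := (hθc.iteratedFDeriv (𝕜 := ℝ) i).exists_bound_of_continuous
    (hθ.continuous_iteratedFDeriv (m := i) (by exact_mod_cast le_top))
  have hB0 : 0 ≤ B := (norm_nonneg _).trans (hB 0)
  have hone : ∀ z : F, ‖iteratedFDeriv ℝ i (fun _ : F => (1 : ℝ)) z‖ ≤ 1 := fun z => by
    rcases eq_or_ne i 0 with rfl | hi
    · simp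
    · rw [iteratedFDeriv_const_of_ne hi]
      simp
  refine ⟨1 + B, by positivity, fun z => ?_⟩
  rcases lt_or_ge ‖z‖ 1 with hz | hz
  · have h : (fun y => 1 - θ y) =ᶠ[𝓝 z] fun _ => 0 := by
      filter_upwards [Metric.isOpen_ball.mem_nhds (mem_ball_zero_iff.2 hz)] with y hy
      rw [hθ1 y (mem_ball_zero_iff.1 hy).le, sub_self]
    rw [(h.iteratedFDeriv ℝ i).eq_of_nhds, iteratedFDeriv_fun_zero]
    simp only [Pi.zero_apply, norm_zero]
    positivity
  · have hθi : ContDiff ℝ i θ := hθ.of_le (by exact_mod_cast le_top)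
    rw [fun_iteratedFDeriv_sub_apply contDiff_const.contDiffAt hθi.contDiffAt]
    refine (norm_sub_le _ _).trans ((add_le_add (hone z) (hB z)).trans ?_)
    exact le_mul_of_one_le_right (by positivity) hz

/-- Compactly supported smooth functions are sequentially dense in the Schwartz space. -/
lemma exists_compactSupport_tendsto [FiniteDimensional ℝ F] (Φ : 𝓢(F, ℂ)) :
    ∃ S : ℕ → 𝓢(F, ℂ), (∀ n, HasCompactSupport (S n)) ∧ (∀ n z, ‖S n z‖ ≤ ‖Φ z‖) ∧
      (∀ z, Tendsto (fun n => S n z) atTop (𝓝 (Φ z))) ∧ Tendsto S atTop (𝓝 Φ) := by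
  obtain ⟨θ, hθ, hθc, hθ0, hθle, hθK⟩ := exists_smooth_cutoff (isCompact_closedBall (0 : F) 1)
  have hθ1 : ∀ z, ‖z‖ ≤ 1 → θ z = 1 := fun z hz => hθK z (by simpa using hz)
  have hε : ∀ n : ℕ, 0 < ((n : ℝ) + 1)⁻¹ := fun n => by positivity
  have hθn : ∀ n : ℕ, ContDiff ℝ ∞ fun z : F => θ (((n : ℝ) + 1)⁻¹ • z) := fun n =>
    hθ.comp (contDiff_const_smul _)
  have hθnc : ∀ n : ℕ, HasCompactSupport fun z : F => θ (((n : ℝ) + 1)⁻¹ • z) := fun n =>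
    hθc.comp_homeomorph (Homeomorph.smulOfNeZero _ (hε n).ne')
  let S : ℕ → 𝓢(F, ℂ) := fun n => HasCompactSupport.toSchwartzMap
    (f := fun z => θ (((n : ℝ) + 1)⁻¹ • z) • Φ z) (hθnc n).smul_right ((hθn n).smul (Φ.smooth _))
  have hS : ∀ n z, S n z = θ (((n : ℝ) + 1)⁻¹ • z) • Φ z := fun n z => rfl
  have hεlim : Tendsto (fun n : ℕ => ((n : ℝ) + 1)⁻¹) atTop (𝓝 0) :=
    tendsto_inv_atTop_zero.comp (tendsto_atTop_add_const_right _ 1 tendsto_natCast_atTop_atTop)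
  refine ⟨S, fun n => (hθnc n).smul_right, fun n z => ?_, fun z => ?_, ?_⟩
  · rw [hS, norm_smul, Real.norm_of_nonneg (hθ0 _)]
    exact mul_le_of_le_one_left (norm_nonneg _) (hθle _)
  · have h1 : Tendsto (fun n : ℕ => ((n : ℝ) + 1)⁻¹ • z) atTop (𝓝 0) := by
      simpa using hεlim.smul_const z
    have h2 := ((hθ.continuous.tendsto 0).comp h1).smul_const (Φ z)
    simpa [hθ1 0, Function.comp_def, hS] using h2
  rw [(schwartz_withSeminorms ℝ F ℂ).tendsto_nhds]
  rintro ⟨k, l⟩ ε hε0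
  choose B hB0 hB using exists_norm_iteratedFDeriv_one_sub_le hθ hθc hθ1
  set C := ∑ i ∈ Finset.range (l + 1),
    (l.choose i : ℝ) * B i * SchwartzMap.seminorm ℝ (k + 1) (l - i) Φ with hC
  have hC0 : 0 ≤ C := Finset.sum_nonneg fun i _ =>
    mul_nonneg (mul_nonneg (by positivity) (hB0 i)) (apply_nonneg _ _)
  have key : ∀ n, SchwartzMap.seminorm ℝ k l (S n - Φ) ≤ ((n : ℝ) + 1)⁻¹ * C := by
    intro n
    rw [map_sub_rev]
    refine SchwartzMap.seminorm_le_bound ℝ k l _ (mul_nonneg (hε n).le hC0) fun z => ?_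
    have hfun : ((Φ - S n : 𝓢(F, ℂ)) : F → ℂ) =
        fun z => (1 - θ (((n : ℝ) + 1)⁻¹ • z)) • Φ z := by
      ext z
      rw [sub_apply, hS, sub_smul, one_smul]
    have hl : (l : WithTop ℕ∞) ≤ ((⊤ : ℕ∞) : WithTop ℕ∞) := by exact_mod_cast le_top
    rw [hfun]
    have h1 := norm_iteratedFDeriv_smul_le (𝕜 := ℝ)
      ((contDiff_const (c := (1 : ℝ))).sub (hθn n)) (Φ.smooth ⊤) z hl
    refine (mul_le_mul_of_nonneg_left h1 (by positivity)).trans ?_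
    rw [hC, Finset.mul_sum, Finset.mul_sum]
    refine Finset.sum_le_sum fun i _ => ?_
    have hi : ContDiff ℝ i fun y => 1 - θ y :=
      (contDiff_const.sub hθ).of_le (by exact_mod_cast le_top)
    have h2 : ‖iteratedFDeriv ℝ i (fun y => 1 - θ (((n : ℝ) + 1)⁻¹ • y)) z‖ ≤
        B i * (((n : ℝ) + 1)⁻¹ * ‖z‖) := by
      rw [iteratedFDeriv_comp_const_smul (f := fun y => 1 - θ y) (((n : ℝ) + 1)⁻¹) hi]
      simp only [norm_smul, norm_pow, Real.norm_of_nonneg (hε n).le]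
      refine (mul_le_of_le_one_left (norm_nonneg _) (pow_le_one₀ (hε n).le
        (inv_le_one_of_one_le₀ (by linarith [n.cast_nonneg (α := ℝ)])))).trans ?_
      refine (hB i _).trans_eq ?_
      rw [norm_smul, Real.norm_of_nonneg (hε n).le]
    have h3 := SchwartzMap.le_seminorm ℝ (k + 1) (l - i) Φ z
    calc ‖z‖ ^ k * ((l.choose i : ℝ) *
          ‖iteratedFDeriv ℝ i (fun y => 1 - θ (((n : ℝ) + 1)⁻¹ • y)) z‖ *
            ‖iteratedFDeriv ℝ (l - i) Φ z‖)
        ≤ ‖z‖ ^ k * ((l.choose i : ℝ) * (B i * (((n : ℝ) + 1)⁻¹ * ‖z‖)) *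
            ‖iteratedFDeriv ℝ (l - i) Φ z‖) := by gcongr
      _ = ((n : ℝ) + 1)⁻¹ * ((l.choose i : ℝ) * B i *
            (‖z‖ ^ (k + 1) * ‖iteratedFDeriv ℝ (l - i) Φ z‖)) := by ring
      _ ≤ _ := by
        have := hB0 i
        gcongr
  have h0 : Tendsto (fun n : ℕ => ((n : ℝ) + 1)⁻¹ * C) atTop (𝓝 0) := by
    simpa using hεlim.mul_const C
  filter_upwards [h0.eventually_lt_const hε0] with n hn
  exact (key n).trans_lt hn

end Density

/-! ### From real test functions to the measure identity -/

section Conclusion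

variable {d : ℕ}

/-- Real and imaginary parts are treated separately for compact support. Continuity of `w` and
dominated convergence, available because `ρ` is globally integrable, reach all Schwartz functions;
the final step only unfolds the image measure. -/
lemma isMeasure_monokinetic {w : 𝓢'(Space d × Space d, ℂ)} {m : ℝ} {ρ E : Space d → ℝ}
    {J V : Space d → Space d}
    (hw : ∀ (f : Space d × Space d → ℝ) (hf : ContDiff ℝ ∞ f) (hfc : HasCompactSupport f),
      (∀ z, 0 ≤ f z) → 0 ≤ (w (realSchwartz f hf hfc)).re ∧ (w (realSchwartz f hf hfc)).im = 0)
    (hm : 0 < m) (hρ : IsDensity w ρ) (hJ : IsCurrent m w J) (hE : IsKineticEnergy m w E)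
    (hρ0 : ∀ᵐ x, 0 ≤ ρ x) (hρi : Integrable ρ volume) (hVm : AEMeasurable V volume)
    (hV : ∀ᵐ x, 2 * m * E x = ρ x * ‖V x‖ ^ 2 ∧ m • J x = ρ x • V x) :
    IsMeasure w (monokinetic ρ V) := by
  let w' : 𝓢(Space d × Space d, ℂ) →ₗ[ℂ] ℂ := LinearMapClass.linearMap w
  have hint : ∀ Φ : 𝓢(Space d × Space d, ℂ), Integrable (fun x => ρ x • Φ (x, V x)) volume := by
    intro Φ
    have h1 : AEStronglyMeasurable (fun x => Φ (x, V x)) volume :=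
      (Φ.continuous.measurable.comp_aemeasurable
        (aemeasurable_id.prodMk hVm)).aestronglyMeasurable
    obtain ⟨B, hB⟩ : ∃ B, ∀ z, ‖Φ z‖ ≤ B := ⟨_, SchwartzMap.norm_le_seminorm ℝ Φ⟩
    exact ((hρi.ofReal (𝕜 := ℂ)).mul_bdd (c := B) h1 (Eventually.of_forall fun x => hB _)).congr
      (Eventually.of_forall fun x => (Complex.real_smul).symm)
  have hcompact : ∀ S : 𝓢(Space d × Space d, ℂ), HasCompactSupport S →
      w S = ∫ x, ρ x • S (x, V x) := by
    intro S hS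
    have hre : ContDiff ℝ ∞ fun z => (S z).re := Complex.reCLM.contDiff.comp (S.smooth _)
    have him : ContDiff ℝ ∞ fun z => (S z).im := Complex.imCLM.contDiff.comp (S.smooth _)
    have hrec : HasCompactSupport fun z => (S z).re :=
      hS.comp_left (g := Complex.re) Complex.zero_re
    have himc : HasCompactSupport fun z => (S z).im :=
      hS.comp_left (g := Complex.im) Complex.zero_im
    have hsum : S = realSchwartz _ hre hrec + Complex.I • realSchwartz _ him himc := by
      ext z
      simp only [add_apply, smul_apply, realSchwartz_apply, smul_eq_mul]
      rw [mul_comm Complex.I, Complex.re_add_im]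
    have hreal : ∀ {f : Space d × Space d → ℝ} (hf : ContDiff ℝ ∞ f) (hfc : HasCompactSupport f),
        w (realSchwartz f hf hfc) = ((∫ x, ρ x * f (x, V x) : ℝ) : ℂ) := fun hf hfc =>
      Complex.ext
        ((re_eq_integral_monokinetic (w := w') hw hm hρ hJ hE hρ0 hVm hV hf hfc).trans
          (Complex.ofReal_re _).symm)
        ((im_eq_zero_of_nonneg (w := w') hw hf hfc).trans (Complex.ofReal_im _).symm)
    have h := integral_re_add_im (hint S)
    rw [← h]
    conv_lhs => rw [hsum]
    rw [map_add, map_smul, hreal hre hrec, hreal him himc, smul_eq_mul, mul_comm Complex.I]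
    simp
  have hall : ∀ Φ : 𝓢(Space d × Space d, ℂ), w Φ = ∫ x, ρ x • Φ (x, V x) := by
    intro Φ
    obtain ⟨S, hSc, hSle, hSlim, hS⟩ := exists_compactSupport_tendsto Φ
    have h1 : Tendsto (fun n => w (S n)) atTop (𝓝 (w Φ)) := ((map_continuous w).tendsto Φ).comp hS
    have h2 : Tendsto (fun n => ∫ x, ρ x • S n (x, V x)) atTop (𝓝 (∫ x, ρ x • Φ (x, V x))) := by
      refine tendsto_integral_of_dominated_convergence (fun x => ‖ρ x • Φ (x, V x)‖)
        (fun n => (hint (S n)).1) (hint Φ).norm (fun n => Eventually.of_forall fun x => ?_)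
        (Eventually.of_forall fun x => (hSlim _).const_smul _)
      rw [norm_smul, norm_smul]
      exact mul_le_mul_of_nonneg_left (hSle _ _) (norm_nonneg _)
    exact tendsto_nhds_unique h1 (h2.congr fun n => (hcompact _ (hSc n)).symm)
  intro Φ
  have hmap : AEMeasurable (fun x => (x, V x))
      ((volume : Measure (Space d)).withDensity fun x => ENNReal.ofReal (ρ x)) :=
    (aemeasurable_id.prodMk hVm).mono_ac (withDensity_absolutelyContinuous _ _)
  constructor
  · rw [monokinetic, integrable_map_measure Φ.continuous.aestronglyMeasurable hmap]
    exact (integrable_withDensity_ofReal_iff hρi.aemeasurable hρ0 _).2 (hint Φ)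
  · rw [monokinetic, integral_map hmap Φ.continuous.aestronglyMeasurable,
      integral_withDensity_ofReal hρi.aemeasurable hρ0]
    exact hall Φ

end Conclusion

end Semiclassical

/-! ### Assembly of the main theorem -/

theorem proposition6 (d : ℕ) (m : ℝ) (hm : 0 < m)
    (hbar : ℕ → ℝ) (hbar_pos : ∀ n, 0 < hbar n) (hbar_lim : Tendsto hbar atTop (𝓝 0))
    -- normalized nowhere vanishing wave functions of class C¹
    (ψ : ℕ → Space d → ℂ)
    (hψ_C1 : ∀ n, ContDiff ℝ 1 (ψ n))
    (hψ_ne : ∀ n x, ψ n x ≠ 0)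
    (hψ_norm : ∀ n, eLpNorm (ψ n) 2 volume = 1)
    -- convergence of the Wigner functions to w in the sense of tempered distributions
    (w : 𝓢'(Space d × Space d, ℂ))
    (hw : ∀ Φ : 𝓢(Space d × Space d, ℂ),
      Tendsto (fun n => wignerAction (hbar n) (ψ n) Φ) atTop (𝓝 (w Φ)))
    -- density (its continuous representative), current, kinetic energy of the Wigner functions
    (ρn : ℕ → Space d → ℝ) (Jn : ℕ → Space d → Space d) (En : ℕ → Space d → ℝ)
    (hρn_cont : ∀ n, Continuous (ρn n))
    (hρn : ∀ n, IsDensity (wignerAction (hbar n) (ψ n)) (ρn n))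
    (hJn : ∀ n, IsCurrent m (wignerAction (hbar n) (ψ n)) (Jn n))
    (hEn : ∀ n, IsKineticEnergy m (wignerAction (hbar n) (ψ n)) (En n))
    -- density, current, kinetic energy of w
    (ρ : Space d → ℝ) (J : Space d → Space d) (E : Space d → ℝ)
    (hρ : IsDensity w ρ) (hJ : IsCurrent m w J) (hE : IsKineticEnergy m w E)
    -- convergence assumptions
    (h_grad : ∀ r : ℝ, 0 < r → Tendsto (fun n => ENNReal.ofReal (hbar n) *
      eLpNorm (gradient (ρn n)) 2 (volume.restrict (Metric.ball 0 r))) atTop (𝓝 0))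
    (h_energy : TendstoWeaklyL2 En E)
    (h_density : TendstoL2Loc ρn ρ)
    (h_current : TendstoL2Loc Jn J) :
    (∀ᵐ x, 0 ≤ ρ x) ∧ AEMeasurable (velocity ρ J) volume ∧
      IsMeasure w (monokinetic ρ (fun x => m • velocity ρ J x)) := by
  have hL : ∀ n, MemLp (ψ n) 2 volume := fun n =>
    ⟨(hψ_C1 n).continuous.aestronglyMeasurable, by rw [hψ_norm n]; exact ENNReal.one_lt_top⟩
  have h1 : ∀ n, ∫ x, ‖ψ n x‖ ^ 2 = 1 := fun n => integral_norm_sq_eq_one (hL n) (hψ_norm n)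
  have hsq : ∀ n x, ρn n x = ‖ψ n x‖ ^ 2 := fun n x =>
    density_wigner_eq (hψ_C1 n).continuous (hL n) (hbar_pos n) (hρn_cont n) (hρn n) x
  have hρn0 : ∀ n x, 0 ≤ ρn n x := fun n x => by
    rw [hsq]
    positivity
  have hρ0 := h_density.ae_nonneg hρn0
  have hρi : Integrable ρ volume := h_density.integrable_of_integral_le hρn0
    (fun n => by simpa only [funext (hsq n)] using integrable_norm_sq (hL n)) (M := 1)
    (fun n => by simpa only [hsq] using (h1 n).le)
  have hVm : AEMeasurable (velocity ρ J) volume :=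
    aemeasurable_velocity hρi.aemeasurable h_current.locallyIntegrable.aestronglyMeasurable.aemeasurable
  have hpos : ∀ (f : Space d × Space d → ℝ) (hf : ContDiff ℝ ∞ f) (hfc : HasCompactSupport f),
      (∀ z, 0 ≤ f z) → 0 ≤ (w (realSchwartz f hf hfc)).re ∧ (w (realSchwartz f hf hfc)).im = 0 :=
    fun f hf hfc hf0 => nonneg_of_normSq_nonneg (LinearMapClass.linearMap w)
      (fun g g2 hg => wigner_limit_normSq_nonneg hbar_pos hbar_lim
        (fun n => (hψ_C1 n).continuous) hL h1 g g2 hg (hw g2)) hf hfc hf0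
  -- The strong, weak and gradient convergences combine here. The resulting identity and the vacuum
  -- statement after it are what leaves no room for velocity dispersion.
  have hEρ := energy_density_limit hm hbar_pos hbar_lim hψ_C1 hL hρn_cont hρn hJn hEn h_grad
    h_energy h_density h_current
  have hE0 := energy_eq_zero_of_density_eq_zero (w := LinearMapClass.linearMap w) hpos hm hρ hE
  exact ⟨hρ0, hVm, isMeasure_monokinetic hpos hm hρ hJ hE hρ0 hρi (hVm.const_smul m)
    (ae_velocity_relations hρ0 hEρ hm hE0)⟩
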